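/- **Corollary (Optimal work of the MLDLQMC estimator with exact sampling).** *Setting.* Let $g:[0,1]^{d_1}\times[0,1]^{d_2}\to J$ be measurable with $g(\mathbf y,\cdot)$ integrable, where $J\subseteq\mathbb R$ is an open interval, let $f\in C^2(J)$, and put $$\bar g(\mathbf y)=\int_{[0,1]^{d_2}}g(\mathbf y,\mathbf x)\,d\mathbf x,\qquad I=\int_{[0,1]^{d_1}}f(\bar g(\mathbf y))\,d\mathbf y .$$ Let $\mathbf u^{(n)}$ and $\mathbf t^{(m)}$ be Sobol' sequences in dimensions $d_1$ and $d_2$, let $M_0\ge1$ be an integer and $M_\ell=M_02^\ell$. Let $\boldsymbol\tau^{(0)},\boldsymbol\tau^{(1)},\dots$ and $\boldsymbol\rho$ be independent Owen (nested uniform, base 2) scramblings, and put $\mathbf y^{(\ell,n)}=\boldsymbol\tau^{(\ell)}(\mathbf u^{(n)})$, and $\mathbf x^{(m)}=\boldsymbol\rho(\mathbf t^{(m)})$. For a sequence $\mathbf z=(\mathbf z^{(m)})$ in $[0,1]^{d_2}$ write $\hat g_{M,\mathbf z}(\mathbf y)=\frac1M\sum_{m=1}^M g(\mathbf y,\mathbf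 z^{(m)})$. For $L\ge1$ and $N_0,\dots,N_L\ge1$ the MLDLQMC estimator with exact sampling is $$I_{\rm MLDLQ}=\frac1{N_0}\sum_{n=1}^{N_0}f\big(\hat g_{M_0,\mathbf t}(\mathbf y^{(0,n)})\big)+\sum_{\ell=1}^{L-1}\frac1{N_\ell}\sum_{n=1}^{N_\ell}\Big[f\big(\hat g_{M_\ell,\mathbf t}(\mathbf y^{(\ell,n)})\big)-f\big(\hat g_{M_{\ell-1},\mathbf t}(\mathbf y^{(\ell,n)})\big)\Big]+\frac1{N_L}\sum_{n=1}^{N_L}\Big[f\big(\hat g_{M_L,\mathbf x}(\mathbf y^{(L,n)})\big)-f\big(\hat g_{M_{L-1},\mathbf t}(\mathbf y^{(L,n)})\big)\Big].$$ Its work is $\sum_{\ell=0}^LN_\ell M_\ell+\sum_{\ell=0}^LM_\ell$. For $\alpha\in(0,1)$ and $C_\alpha=1/\sqrt\alpha$, the optimal work $W^\ast_{\rm MLDLQ}(TOL)$ is the infimum of the work over all integers $L\ge1$, $N_0,\dots,N_L\ge1$ for which $I_{\rm MLDLQ}$ is square integrable with $$|\mathbb E[I_{\rm MLDLQ}]-I|\le\tfrac12TOL,\qquad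 \mathbb V[I_{\rm MLDLQ}]\le\Big(\frac{TOL/2}{C_\alpha}\Big)^2$$ (so that $|I_{\rm MLDLQ}-I|\le TOL$ with probability at least $1-\alpha$), and $+\infty$ if there are none. *Assumptions.* A function $\varphi$ on $(0,1)^{d_1}$ satisfies the boundary growth condition with constant $B$ and exponents $A=(A_1,\dots,A_{d_1})$ if its mixed first-order partial derivatives $\partial^{u}\varphi$ exist for all $u\subseteq\{1,\dots,d_1\}$ and $$|\partial^u\varphi(\mathbf y)|\le B\prod_{i=1}^{d_1}\min(y_i,1-y_i)^{-A_i-\mathbf 1_{\{i\in u\}}}\qquad\text{for all }\mathbf y\in(0,1)^{d_1},\ u\subseteq\{1,\dots,d_1\}.$$ For $M\ge1$ and a sequence $\mathbf z$ put $\Delta_{M,\mathbf z}=\hat g_{M,\mathbf z}-\bar g$ and $$\varphi^{(I)}_{M,\mathbf z}=f'(\bar g)\,\Delta_{M,\mathbf z},\qquad \varphi^{(II)}_{M,\mathbf z}=\Delta_{M,\mathbf z}^2\int_0^1f''(\bar g+s\Delta_{M,\mathbf z})(1-s)\,ds .$$ Let $A^{(0)},A^{(I)},A^{(II)}\in\mathbb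 R^{d_1}$ be exponent vectors whose maxima $A^{(0)}_{\max},A^{(I)}_{\max},A^{(II)}_{\max}$ lie in $(0,1/2)$, let $A_{\max}$ be the largest of the three maxima, let $0<\epsilon<1-A_{\max}$, and let $b^{(0)},b^{(I)},b^{(II)}$ be constants such that - $f\circ\hat g_{M_0,\mathbf t}$ satisfies the boundary growth condition with constant $b^{(0)}$ and exponents $A^{(0)}$; - for all $\ell\ge0$, $\varphi^{(I)}_{M_\ell,\mathbf t}$ satisfies it with constant $b^{(I)}M_\ell^{-1+\epsilon}$ and exponents $A^{(I)}$, and $\varphi^{(II)}_{M_\ell,\mathbf t}$ with constant $b^{(II)}M_\ell^{-2+2\epsilon}$ and exponents $A^{(II)}$; - for all $\ell\ge1$, almost surely, the same holds with the scrambled points $\mathbf x$ in place of $\mathbf t$. *Conclusion.* Then $f\circ\bar g$ is integrable on $[0,1]^{d_1}$, and $$W^\ast_{\rm MLDLQ}(TOL)=\mathcal O\Big(TOL^{-\frac1{1-\epsilon-A_{\max}}}\Big)\qquad\text{as }TOL\to0^+ .$$ -/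

import Mathlib

open MeasureTheory ProbabilityTheory Set Filter Topology
open scoped ENNReal BigOperators

noncomputable section

namespace MLDLQ

/-! ## Cubes, Sobol' sequences, Owen's scrambling -/

/-- The closed unit cube `[0,1]^d`. -/
def cube (d : ℕ) : Set (Fin d → ℝ) := {x | ∀ i, x i ∈ Icc (0 : ℝ) 1}

/-- The open unit cube `(0,1)^d`. -/
def openCube (d : ℕ) : Set (Fin d → ℝ) := {x | ∀ i, x i ∈ Ioo (0 : ℝ) 1}

/-- The real number `∑ₖ aₖ 2^{-(k+1)}` in `[0,1]` with binary digits `a₀, a₁, …`. -/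
def ofBits (a : ℕ → ZMod 2) : ℝ := ∑' k, ((a k).val : ℝ) / 2 ^ (k + 1)

/-- The data of a Sobol' sequence in dimension `d`: one polynomial over the field with two elements
per coordinate (distinct and irreducible; this covers distinct primitive polynomials, and the
polynomial `X`, which yields the van der Corput sequence that is customary in the first
coordinate), and direction numbers `v_{j,0}, v_{j,1}, …`, where `dir j i k` is the `k`-th binary
digit after the point of `v_{j,i}` (digits are counted from `0`). -/
structure SobolData (d : ℕ) where
  poly : Fin d → Polynomial (ZMod 2)
  irreducible : ∀ j, Irreducible (poly j)
  distinct : Function.Injective poly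
  dir : Fin d → ℕ → ℕ → ZMod 2
  /-- `v_{j,i} = m / 2^{i+1}` with `m` odd -/
  diag : ∀ j i, dir j i i = 1
  /-- `v_{j,i} = m / 2^{i+1}` with `m` an integer -/
  upper : ∀ j i k, i < k → dir j i k = 0
  /-- The recurrence `∑ₘ cₘ v_{j,i+m} = v_{j,i} >> e` (sums are bitwise exclusive ors), where
  `p_j = ∑ₘ cₘ Xᵐ` has degree `e`; since `c_e = 1`, it determines `v_{j,i+e}`. -/
  recurrence : ∀ j i k,
    ∑ m ∈ Finset.range ((poly j).natDegree + 1), (poly j).coeff m * dir j (i + m) k =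
      if (poly j).natDegree ≤ k then dir j i (k - (poly j).natDegree) else 0

/-- The `k`-th binary digit of the `j`-th coordinate of the Sobol' point with index `n`
(indices start at `0`): the exclusive or of the direction numbers selected by the bits of `n`. -/
def SobolData.digit {d : ℕ} (S : SobolData d) (n : ℕ) (j : Fin d) (k : ℕ) : ZMod 2 :=
  ∑ i ∈ Finset.range n, if n.testBit i then S.dir j i k else 0

/-- The Sobol' point with index `n`. -/
def SobolData.point {d : ℕ} (S : SobolData d) (n : ℕ) : Fin d → ℝ :=
  fun j => ofBits (S.digit n j)

/-- Nested scrambling of a binary expansion `a`: the digit `a k` is permuted by a permutation of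
`{0,1}` (that is, a translation of `ZMod 2`) that depends on the preceding digits of `a`. -/
def scramble (c : List (ZMod 2) → ZMod 2) (a : ℕ → ZMod 2) : ℕ → ZMod 2 :=
  fun k => a k + c ((List.range k).map a)

/-- The point with index `n` of the Sobol' sequence, scrambled coordinate by coordinate with the
permutations encoded by `c`. -/
def SobolData.scrambledPoint {d : ℕ} (S : SobolData d) (c : Fin d × List (ZMod 2) → ZMod 2)
    (n : ℕ) : Fin d → ℝ :=
  fun j => ofBits (scramble (fun p => c (j, p)) (S.digit n j))

/-- A fair coin. -/
def coin : Measure (ZMod 2) := (PMF.uniformOfFintype (ZMod 2)).toMeasure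

instance : IsProbabilityMeasure coin := by
  unfold coin; infer_instance

/-- The law of the inner randomization `ρ`: independent fair coins, one for each coordinate
and each finite string of preceding digits, as in Owen's scrambling. -/
def innerLaw (d₂ : ℕ) : Measure (Fin d₂ × List (ZMod 2) → ZMod 2) :=
  Measure.infinitePi fun _ => coin

/-- The sample space: a scrambling of the outer points for every level, and a scrambling of the
inner points. -/
abbrev Sample (d₁ d₂ : ℕ) : Type :=
  (ℕ × Fin d₁ × List (ZMod 2) → ZMod 2) × (Fin d₂ × List (ZMod 2) → ZMod 2)

/-- All scramblings are independent Owen scramblings. -/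
def law (d₁ d₂ : ℕ) : Measure (Sample d₁ d₂) :=
  (Measure.infinitePi fun _ => coin).prod (innerLaw d₂)

/-! ## Integrands -/

/-- `ḡ(y) = ∫_{[0,1]^{d₂}} g(y,x) dx`. -/
def gBar {d₁ d₂ : ℕ} (g : (Fin d₁ → ℝ) → (Fin d₂ → ℝ) → ℝ) (y : Fin d₁ → ℝ) : ℝ :=
  ∫ x in cube d₂, g y x

/-- The nested integral `I = ∫_{[0,1]^{d₁}} f(∫_{[0,1]^{d₂}} g(y,x) dx) dy`. -/
def nested {d₁ d₂ : ℕ} (f : ℝ → ℝ) (g : (Fin d₁ → ℝ) → (Fin d₂ → ℝ) → ℝ) : ℝ :=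
  ∫ y in cube d₁, f (gBar g y)

/-- The inner average `(1/M) ∑_{m<M} g(y, x_m)` over the first `M` points of a sequence `x`. -/
def innerAvg {d₁ d₂ : ℕ} (g : (Fin d₁ → ℝ) → (Fin d₂ → ℝ) → ℝ) (M : ℕ) (x : ℕ → Fin d₂ → ℝ)
    (y : Fin d₁ → ℝ) : ℝ :=
  (∑ m ∈ Finset.range M, g y (x m)) / M

/-- `φ⁽⁰⁾ = f((1/M) ∑ g(·, x_m))`. -/
def phiZero {d₁ d₂ : ℕ} (f : ℝ → ℝ) (g : (Fin d₁ → ℝ) → (Fin d₂ → ℝ) → ℝ) (M : ℕ)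
    (x : ℕ → Fin d₂ → ℝ) (y : Fin d₁ → ℝ) : ℝ :=
  f (innerAvg g M x y)

/-- `φ⁽ᴵ⁾ = f'(ḡ) ((1/M) ∑ g(·, x_m) - ḡ)`. -/
def phiI {d₁ d₂ : ℕ} (f : ℝ → ℝ) (g : (Fin d₁ → ℝ) → (Fin d₂ → ℝ) → ℝ) (M : ℕ)
    (x : ℕ → Fin d₂ → ℝ) (y : Fin d₁ → ℝ) : ℝ :=
  deriv f (gBar g y) * (innerAvg g M x y - gBar g y)

/-- `φ⁽ᴵᴵ⁾ = ((1/M) ∑ g(·, x_m) - ḡ)² ∫₀¹ f''(ḡ + s ((1/M) ∑ g(·, x_m) - ḡ)) (1 - s) ds`. -/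
def phiII {d₁ d₂ : ℕ} (f : ℝ → ℝ) (g : (Fin d₁ → ℝ) → (Fin d₂ → ℝ) → ℝ) (M : ℕ)
    (x : ℕ → Fin d₂ → ℝ) (y : Fin d₁ → ℝ) : ℝ :=
  (innerAvg g M x y - gBar g y) ^ 2 *
    ∫ s in (0 : ℝ)..1, deriv (deriv f) (gBar g y + s * (innerAvg g M x y - gBar g y)) * (1 - s)

/-- The boundary growth condition with constant `B` and exponents `A`: the mixed first-order
partial derivatives `∂ᵘφ` exist in `(0,1)^d` for all `u ⊆ {1,…,d}` (they are the functions `D u`) and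
`|∂ᵘφ(y)| ≤ B ∏ᵢ min(yᵢ, 1 - yᵢ)^{-Aᵢ - 1{i ∈ u}}`. -/
def BoundaryGrowth {d : ℕ} (φ : (Fin d → ℝ) → ℝ) (B : ℝ) (A : Fin d → ℝ) : Prop :=
  ∃ D : Finset (Fin d) → (Fin d → ℝ) → ℝ,
    (∀ y ∈ openCube d, D ∅ y = φ y) ∧
    (∀ u : Finset (Fin d), ∀ j, j ∉ u → ∀ y ∈ openCube d,
      HasDerivAt (fun s => D u (Function.update y j s)) (D (insert j u) y) (y j)) ∧
    (∀ u : Finset (Fin d), ∀ y ∈ openCube d,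
      |D u y| ≤ B * ∏ i, (min (y i) (1 - y i)) ^ (-A i - if i ∈ u then (1 : ℝ) else 0))

/-- `maxᵢ Aᵢ`. -/
def maxExp {d : ℕ} (A : Fin d → ℝ) : ℝ := ⨆ i, A i

/-! ## The estimator and its optimal work -/

/-- The number of inner samples `M_ℓ = M₀ 2^ℓ` at level `ℓ`. -/
def innerSize (M₀ ℓ : ℕ) : ℕ := M₀ * 2 ^ ℓ

/-- The scrambled outer point with index `n` at level `ℓ`. -/
def outerPoint {d₁ d₂ : ℕ} (U : SobolData d₁) (ω : Sample d₁ d₂) (ℓ n : ℕ) : Fin d₁ → ℝ :=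
  U.scrambledPoint (fun p => ω.1 (ℓ, p)) n

/-- The multilevel double-loop randomized quasi-Monte Carlo estimator (with one randomization,
`S = R = 1`) with exact sampling of the inner integrand, with finest level `L ≥ 1`. The inner points
are deterministic Sobol' points, except in the leading term of level `L`, where they are
scrambled. -/
def estimator {d₁ d₂ : ℕ} (f : ℝ → ℝ) (g : (Fin d₁ → ℝ) → (Fin d₂ → ℝ) → ℝ)
    (U : SobolData d₁) (T : SobolData d₂) (M₀ L : ℕ) (N : ℕ → ℕ) (ω : Sample d₁ d₂) : ℝ :=
  (∑ n ∈ Finset.range (N 0), f (innerAvg g (innerSize M₀ 0) T.point (outerPoint U ω 0 n))) / N 0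
  + ∑ ℓ ∈ Finset.Ico 1 L,
      (∑ n ∈ Finset.range (N ℓ),
        (f (innerAvg g (innerSize M₀ ℓ) T.point (outerPoint U ω ℓ n))
          - f (innerAvg g (innerSize M₀ (ℓ - 1)) T.point (outerPoint U ω ℓ n)))) / N ℓ
  + (∑ n ∈ Finset.range (N L),
      (f (innerAvg g (innerSize M₀ L) (T.scrambledPoint ω.2) (outerPoint U ω L n))
        - f (innerAvg g (innerSize M₀ (L - 1)) T.point (outerPoint U ω L n)))) / N L

/-- The computational work `∑_{ℓ≤L} N_ℓ M_ℓ + ∑_{ℓ≤L} M_ℓ` (one inner evaluation has unit cost, as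
`h^{-γ} = 1` for `γ = 0`). -/
def work (M₀ L : ℕ) (N : ℕ → ℕ) : ℕ :=
  ∑ ℓ ∈ Finset.range (L + 1), N ℓ * innerSize M₀ ℓ + ∑ ℓ ∈ Finset.range (L + 1), innerSize M₀ ℓ

/-- The parameters `L, N₀, …, N_L` are admissible for the tolerance `TOL` and the confidence level
`1 - α`: the bias is at most `TOL/2` and the variance at most `((TOL/2)/C_α)²` with the Chebyshev
constant `C_α = 1/√α`. -/
def Admissible {d₁ d₂ : ℕ} (f : ℝ → ℝ) (g : (Fin d₁ → ℝ) → (Fin d₂ → ℝ) → ℝ)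
    (U : SobolData d₁) (T : SobolData d₂) (M₀ : ℕ) (α TOL : ℝ) (L : ℕ) (N : ℕ → ℕ) : Prop :=
  1 ≤ L ∧ (∀ ℓ ≤ L, 1 ≤ N ℓ) ∧
  MemLp (estimator f g U T M₀ L N) 2 (law d₁ d₂) ∧
  |(∫ ω, estimator f g U T M₀ L N ω ∂(law d₁ d₂)) - nested f g| ≤ TOL / 2 ∧
  variance (estimator f g U T M₀ L N) (law d₁ d₂) ≤ ((TOL / 2) / (1 / √α)) ^ 2

/-- The optimal work for the tolerance `TOL`: the least work of admissible parameters (`∞` if there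
are none). -/
def optimalWork {d₁ d₂ : ℕ} (f : ℝ → ℝ) (g : (Fin d₁ → ℝ) → (Fin d₂ → ℝ) → ℝ)
    (U : SobolData d₁) (T : SobolData d₂) (M₀ : ℕ) (α TOL : ℝ) : ℝ≥0∞ :=
  ⨅ (L : ℕ) (N : ℕ → ℕ) (_ : Admissible f g U T M₀ α TOL L N), (work M₀ L N : ℝ≥0∞)

end MLDLQ

end

/-!
The bias and the standard deviation of the estimator are both at most its root mean square error, so
it suffices to find parameters for which the error `I_MLDLQ - I` is at most `(√α / 2) TOL` in `L²`
(`admissible_of_eLpNorm_le`). This error is estimated by the triangle inequality over the levels; the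
independence of the scramblings of different levels is not needed. Write `a` for the largest exponent
`A_max` and `e = 1 - ε`.

**One level.** By Taylor's formula, the sum of the first- and the second-order term is the error
`f ∘ ĝ - f ∘ ḡ`, so the integrand of level `ℓ` has boundary growth with exponents `a` and a constant
of order `2 ^ (-e ℓ)`. The mean over `2 ^ k` scrambled Sobol' points integrates a function with
boundary growth with constant `B` up to an error of order `B 2 ^ (-k r)` in `L²`, for each `r < 1 - a`
(`exists_eLpNorm_scrambled_mean_le`). To see this, truncate the points to `K` digits and expand the
integrand in Walsh functions. The frequencies are grouped by their scale `κ`, the positions of their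
last digits in the coordinates, and each group is treated on its own:

* If `|κ|` is at most `k` up to a constant, the net property of the Sobol' points yields an index `z`
  for which `n ↦ n xor z` flips one last digit of the scale and nothing before it. The sum of the
  group over the points thus equals its negative and vanishes (`sum_level_eq_zero`).
* Otherwise, two scrambled points are uncorrelated in the group unless they share all but the last
  digit of the scale in each coordinate: a coin that enters only one of the two points changes the sign
  (`integral_level_mul_level`). By the net property, few pairs share these digits, so the mean square
  is of order `2 ^ (-k)` times the variance of the group (`integral_sq_sum_level_le`).
* The variance of a group is at most the mean square of the mixed difference of the integrand in the
  last digits of the scale (`avg_level_sq_le`). Interpolation between the bounds for the derivatives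
  and the function shows that it is of order `B² 2 ^ (-2 σ |κ|)` for `σ < 1 / 2 - a`, where `a + σ < 1 / 2`
  makes the weights square integrable (`avg_digitDiff_sq_le`, `avg_weight_sq_le`).

The net property itself is algebra over the field with two elements: the recurrence of the direction
numbers says that multiplication of the index, read as a polynomial, by `p_j` shifts the digits of the
`j`-th coordinate. Hence the first `Q deg p_j` digits vanish iff `p_j ^ Q` divides the index
polynomial (`SobolData.row_eq_zero_iff`), and coprimality of the `p_j` does the rest.

**All levels.** At the finest level a single outer point is used, and the error is bounded by the size
of the integrand, of order `2 ^ (-e L)`. With `r = e - a`, the choices `2 ^ L ≈ TOL ^ (-1 / e)` and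
`N_ℓ ≈ TOL ^ (-1 / r) 2 ^ (-θ ℓ)` for some `θ` in `(1, e / r)` make the errors and the work of the
other levels geometric sums of order `TOL` and `TOL ^ (-1 / r)` (`exists_parameters`). There is such a
`θ` since `0 < a`, and the work `2 ^ L` of the finest level is of smaller order for the same reason.
-/

noncomputable section

namespace MLDLQ

/-! ### The law of a scrambled point -/

lemma coin_map_add (z : ZMod 2) : coin.map (fun x => x + z) = coin := by
  refine Measure.ext_of_singleton fun x => ?_
  have h1 : ∀ y : ZMod 2, coin {y} = (2 : ℝ≥0∞)⁻¹ := fun y => by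
    rw [coin, PMF.toMeasure_apply_singleton _ _ (measurableSet_singleton y)]
    simp [ZMod.card]
  rw [Measure.map_apply (measurable_of_countable _) (measurableSet_singleton x)]
  have : (fun y => y + z) ⁻¹' {x} = {x - z} := by
    ext y; simp only [mem_preimage, mem_singleton_iff, eq_sub_iff_add_eq]
  rw [this, h1, h1]

/-- Translations preserve the law of a family of independent fair coins. -/
lemma measurePreserving_coins_add {ι : Type*} (e : ι → ZMod 2) :
    MeasurePreserving (fun c : ι → ZMod 2 => fun i => c i + e i)
      (Measure.infinitePi fun _ => coin) (Measure.infinitePi fun _ => coin) := by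
  refine ⟨by fun_prop, ?_⟩
  rw [Measure.infinitePi_map_pi (f := fun i x => x + e i) (fun _ => coin)
    (fun i => measurable_of_countable _)]
  simp_rw [coin_map_add]

lemma measurePreserving_coins_comp {ι κ : Type*} {e : κ → ι} (he : e.Injective) :
    MeasurePreserving (fun c : ι → ZMod 2 => fun k => c (e k))
      (Measure.infinitePi fun _ => coin) (Measure.infinitePi fun _ => coin) := by
  refine ⟨by fun_prop, ?_⟩
  exact Measure.map_infinitePi_infinitePi_of_inj (P := fun _ => coin) he

lemma summable_bits (a : ℕ → ZMod 2) : Summable fun k => ((a k).val : ℝ) / 2 ^ (k + 1) := by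
  have h : Summable fun k : ℕ => (1 / 2 : ℝ) ^ (k + 1) :=
    (summable_nat_add_iff 1).2 summable_geometric_two
  refine Summable.of_nonneg_of_le (fun k => by positivity) (fun k => ?_) h
  rw [div_pow, one_pow]
  have : ((a k).val : ℝ) ≤ 1 := by
    exact_mod_cast Nat.le_of_lt_succ (ZMod.val_lt (a k))
  gcongr

lemma ofBits_nonneg (a : ℕ → ZMod 2) : 0 ≤ ofBits a := tsum_nonneg fun k => by positivity

lemma ofBits_le_one (a : ℕ → ZMod 2) : ofBits a ≤ 1 := by
  have h : HasSum (fun k : ℕ => (1 / 2 : ℝ) ^ (k + 1)) 1 := by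
    have := (hasSum_nat_add_iff' 1).2 hasSum_geometric_two
    simpa [show (2 : ℝ) - 1 = 1 by norm_num] using this
  refine hasSum_le (fun k => ?_) (summable_bits a).hasSum h
  rw [div_pow, one_pow]
  have : ((a k).val : ℝ) ≤ 1 := by
    exact_mod_cast Nat.le_of_lt_succ (ZMod.val_lt (a k))
  gcongr

lemma ofBits_eq_sum_add (a : ℕ → ZMod 2) (K : ℕ) :
    ofBits a = ∑ k ∈ Finset.range K, ((a k).val : ℝ) / 2 ^ (k + 1)
      + ofBits (fun k => a (k + K)) / 2 ^ K := by
  rw [ofBits, ← (summable_bits a).sum_add_tsum_nat_add K, ofBits, ← tsum_div_const]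
  congr 2; ext k
  rw [div_div, ← pow_add]; congr 2; ring

lemma ofBits_succ (a : ℕ → ZMod 2) :
    ofBits a = ((a 0).val + ofBits (fun k => a (k + 1))) / 2 := by
  rw [ofBits_eq_sum_add a 1]; simp; ring

lemma measurable_ofBits : Measurable ofBits := by
  unfold ofBits
  refine Measurable.tsum fun k => ?_
  have : Measurable fun z : ZMod 2 => (z.val : ℝ) / 2 ^ (k + 1) := measurable_of_countable _
  exact this.comp (measurable_pi_apply k)

lemma _root_.MeasureTheory.MeasurePreserving.integral_comp_of_aestronglyMeasurable {α β E : Type*}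
    [MeasurableSpace α] [MeasurableSpace β] [NormedAddCommGroup E] [NormedSpace ℝ E]
    {P : Measure α} {Q : Measure β} {T : α → β} (hT : MeasurePreserving T P Q) {h : β → E}
    (hh : AEStronglyMeasurable h Q) : ∫ a, h (T a) ∂P = ∫ b, h b ∂Q := by
  rw [← hT.map_eq, integral_map hT.measurable.aemeasurable (hT.map_eq ▸ hh)]

/-- A probability measure on `ℝ` that is the average of its images under `x ↦ x / 2` and
`x ↦ (1 + x) / 2` has a characteristic function determined by its values near `0`. -/
lemma ext_of_charFun_bisection {μ ν : Measure ℝ} [IsProbabilityMeasure μ] [IsProbabilityMeasure ν]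
    (hμ : ∀ t, charFun μ t = (1 + Complex.exp (↑(t / 2) * Complex.I)) / 2 * charFun μ (t / 2))
    (hν : ∀ t, charFun ν t = (1 + Complex.exp (↑(t / 2) * Complex.I)) / 2 * charFun ν (t / 2)) :
    μ = ν := by
  refine Measure.ext_of_charFun (funext fun t => ?_)
  have h1 : ∀ t, ‖charFun μ t - charFun ν t‖ ≤ ‖charFun μ (t / 2) - charFun ν (t / 2)‖ := by
    intro t
    rw [hμ, hν, ← mul_sub, norm_mul]
    refine mul_le_of_le_one_left (norm_nonneg _) ?_
    rw [norm_div, Complex.norm_ofNat]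
    have : ‖1 + Complex.exp (↑(t / 2) * Complex.I)‖ ≤ 1 + 1 := by
      refine (norm_add_le _ _).trans ?_
      rw [Complex.norm_exp_ofReal_mul_I, norm_one]
    linarith
  have h2 : ∀ K : ℕ, ‖charFun μ t - charFun ν t‖ ≤
      ‖charFun μ (t / 2 ^ K) - charFun ν (t / 2 ^ K)‖ := by
    intro K
    induction K with
    | zero => simp
    | succ K ih =>
      refine ih.trans ((h1 _).trans_eq ?_)
      rw [div_div, ← pow_succ]
  have h3 : Tendsto (fun K : ℕ => ‖charFun μ (t / 2 ^ K) - charFun ν (t / 2 ^ K)‖) atTop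
      (𝓝 ‖charFun μ 0 - charFun ν 0‖) := by
    have hc : Continuous fun s => ‖charFun μ s - charFun ν s‖ := by fun_prop
    refine (hc.tendsto 0).comp ?_
    have := (tendsto_pow_atTop_nhds_zero_of_lt_one (r := (1 / 2 : ℝ)) (by norm_num)
      (by norm_num)).const_mul t
    simpa [div_eq_mul_inv] using this
  have h4 := ge_of_tendsto' h3 h2
  simp only [charFun_zero, probReal_univ, sub_self, norm_zero] at h4
  exact sub_eq_zero.1 (norm_le_zero_iff.1 h4)

/-- A number with independent uniform binary digits is uniformly distributed on the unit interval. -/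
lemma map_ofBits :
    (Measure.infinitePi fun _ : ℕ => coin).map ofBits = volume.restrict (Icc (0 : ℝ) 1) := by
  have : IsProbabilityMeasure ((Measure.infinitePi fun _ : ℕ => coin).map ofBits) :=
    Measure.isProbabilityMeasure_map measurable_ofBits.aemeasurable
  have : IsProbabilityMeasure (volume.restrict (Icc (0 : ℝ) 1)) := ⟨by simp⟩
  refine ext_of_charFun_bisection (fun t => ?_) fun t => ?_
  · set P := Measure.infinitePi fun _ : ℕ => coin
    have hE : ∀ s : ℝ, charFun (P.map ofBits) s = ∫ a, Complex.exp (s * ofBits a * Complex.I) ∂P := by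
      intro s
      rw [charFun_apply_real, integral_map measurable_ofBits.aemeasurable]
      exact (by fun_prop : Continuous fun x : ℝ =>
        Complex.exp (s * x * Complex.I)).aestronglyMeasurable
    have hm : ∀ s : ℝ, Measurable fun a => Complex.exp (s * ofBits a * Complex.I) := by
      intro s
      have := measurable_ofBits
      fun_prop
    have hi : ∀ s : ℝ, Integrable (fun a => Complex.exp (s * ofBits a * Complex.I)) P := by
      intro s
      refine Integrable.of_bound (hm s).aestronglyMeasurable 1 (ae_of_all _ fun a => ?_)
      rw [← Complex.ofReal_mul, Complex.norm_exp_ofReal_mul_I]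
    set e : ℕ → ZMod 2 := fun k => if k = 0 then 1 else 0 with he
    have hflip : ∫ a, Complex.exp (t * ofBits (fun k => a k + e k) * Complex.I) ∂P =
        ∫ a, Complex.exp (t * ofBits a * Complex.I) ∂P :=
      (measurePreserving_coins_add e).integral_comp_of_aestronglyMeasurable (hm t).aestronglyMeasurable
    have hshift : ∫ a, Complex.exp (↑(t / 2) * ofBits (fun k => a (k + 1)) * Complex.I) ∂P =
        ∫ a, Complex.exp (↑(t / 2) * ofBits a * Complex.I) ∂P :=
      (measurePreserving_coins_comp (add_left_injective 1)).integral_comp_of_aestronglyMeasurable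
        (hm (t / 2)).aestronglyMeasurable
    -- averaging over the first digit, the two images of the bisection appear
    have hpt : ∀ a : ℕ → ZMod 2, Complex.exp (t * ofBits a * Complex.I)
        + Complex.exp (t * ofBits (fun k => a k + e k) * Complex.I) =
        (1 + Complex.exp (↑(t / 2) * Complex.I)) *
          Complex.exp (↑(t / 2) * ofBits (fun k => a (k + 1)) * Complex.I) := by
      intro a
      rw [ofBits_succ a, ofBits_succ fun k => a k + e k]
      have h0 : e 0 = 1 := by simp [he]
      have hk : (fun k => a (k + 1) + e (k + 1)) = fun k => a (k + 1) := by
        funext k; simp [he]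
      rw [hk, h0, one_add_mul, ← Complex.exp_add]
      generalize ofBits (fun k => a (k + 1)) = x
      have h01 : a 0 = 0 ∨ a 0 = 1 := by generalize a 0 = z; revert z; decide
      have h11 : (1 + 1 : ZMod 2) = 0 := by decide
      rcases h01 with h | h
      · rw [h, zero_add, ZMod.val_zero, ZMod.val_one]
        congr 2 <;> push_cast <;> ring
      · rw [h, h11, ZMod.val_zero, ZMod.val_one, add_comm]
        congr 2 <;> push_cast <;> ring
    rw [hE, hE]
    have hi' : Integrable (fun a : ℕ → ZMod 2 =>
        Complex.exp (t * ofBits (fun k => a k + e k) * Complex.I)) P :=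
      (measurePreserving_coins_add e).integrable_comp_of_integrable (hi t)
    have : ∫ a, Complex.exp (t * ofBits a * Complex.I) ∂P
        + ∫ a, Complex.exp (t * ofBits (fun k => a k + e k) * Complex.I) ∂P =
        (1 + Complex.exp (↑(t / 2) * Complex.I)) *
          ∫ a, Complex.exp (↑(t / 2) * ofBits a * Complex.I) ∂P := by
      rw [← integral_add (hi t) hi', ← hshift, ← integral_const_mul]
      exact integral_congr_ae (ae_of_all _ hpt)
    rw [hflip] at this
    linear_combination this / 2
  · have hE : ∀ s : ℝ, charFun (volume.restrict (Icc (0 : ℝ) 1)) s =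
        ∫ x in (0 : ℝ)..1, Complex.exp (s * x * Complex.I) := by
      intro s
      rw [charFun_apply_real, integral_Icc_eq_integral_Ioc,
        intervalIntegral.integral_of_le zero_le_one]
    rw [hE, hE]
    have hc : ∀ a b : ℝ, IntervalIntegrable (fun x : ℝ => Complex.exp (t * x * Complex.I))
        volume a b := fun a b => (by fun_prop : Continuous fun x : ℝ =>
          Complex.exp (t * x * Complex.I)).intervalIntegrable a b
    rw [← intervalIntegral.integral_add_adjacent_intervals (hc 0 (1 / 2)) (hc (1 / 2) 1)]
    have h1 := intervalIntegral.integral_comp_div (a := 0) (b := 1) (c := 2)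
      (fun x : ℝ => Complex.exp (t * x * Complex.I)) two_ne_zero
    have h2 := intervalIntegral.integral_comp_div_add (a := 0) (b := 1) (c := 2)
      (fun x : ℝ => Complex.exp (t * x * Complex.I)) two_ne_zero (1 / 2)
    have e2 : ∫ x in (0 : ℝ)..1, Complex.exp (t * ↑(x / 2 + 1 / 2) * Complex.I) =
        Complex.exp (↑(t / 2) * Complex.I) *
          ∫ x in (0 : ℝ)..1, Complex.exp (↑(t / 2) * x * Complex.I) := by
      rw [← intervalIntegral.integral_const_mul]
      congr 1; ext x; rw [← Complex.exp_add]; congr 1; push_cast; ring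
    have e1 : ∫ x in (0 : ℝ)..1, Complex.exp (t * ↑(x / 2) * Complex.I) =
          ∫ x in (0 : ℝ)..1, Complex.exp (↑(t / 2) * x * Complex.I) := by
      congr 1; ext x; congr 1; push_cast; ring
    rw [e1] at h1
    rw [e2] at h2
    norm_num at h1 h2 ⊢
    linear_combination -h1 / 2 - h2 / 2

lemma measurePreserving_ofBits :
    MeasurePreserving ofBits (Measure.infinitePi fun _ : ℕ => coin)
      (volume.restrict (Icc (0 : ℝ) 1)) :=
  ⟨measurable_ofBits, map_ofBits⟩

lemma cube_eq (d : ℕ) : cube d = univ.pi fun _ => Icc (0 : ℝ) 1 := by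
  ext; simp only [cube, mem_ofPred_eq, mem_univ_pi]

lemma openCube_eq (d : ℕ) : openCube d = univ.pi fun _ => Ioo (0 : ℝ) 1 := by
  ext; simp [openCube]

lemma measurableSet_cube (d : ℕ) : MeasurableSet (cube d) := by
  rw [cube_eq]; exact MeasurableSet.univ_pi fun _ => measurableSet_Icc

lemma restrict_cube (d : ℕ) : (volume : Measure (Fin d → ℝ)).restrict (cube d) =
    Measure.pi fun _ => volume.restrict (Icc (0 : ℝ) 1) := by
  rw [cube_eq, volume_pi, Measure.restrict_pi_pi]

instance (d : ℕ) : IsProbabilityMeasure ((volume : Measure (Fin d → ℝ)).restrict (cube d)) := by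
  have : IsProbabilityMeasure (volume.restrict (Icc (0 : ℝ) 1)) := ⟨by simp⟩
  rw [restrict_cube]; infer_instance

lemma ae_mem_openCube (d : ℕ) : ∀ᵐ y ∂(volume : Measure (Fin d → ℝ)).restrict (cube d),
    y ∈ openCube d := by
  have h : openCube d =ᵐ[volume] cube d := by
    rw [openCube_eq, cube_eq, pi_univ_Icc]
    exact Measure.univ_pi_Ioo_ae_eq_Icc
  rw [ae_restrict_iff' (measurableSet_cube d)]
  filter_upwards [h] with y hy hyc
  exact hy.mpr hyc

instance (d : ℕ) : IsProbabilityMeasure (innerLaw d) := by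
  unfold innerLaw; infer_instance

lemma scrambledPoint_mem_cube {d : ℕ} (S : SobolData d) (c : Fin d × List (ZMod 2) → ZMod 2)
    (n : ℕ) : S.scrambledPoint c n ∈ cube d :=
  fun _ => ⟨ofBits_nonneg _, ofBits_le_one _⟩

lemma point_mem_cube {d : ℕ} (S : SobolData d) (n : ℕ) : S.point n ∈ cube d :=
  fun _ => ⟨ofBits_nonneg _, ofBits_le_one _⟩

/-- A single scrambled point is uniformly distributed on the cube: its digits are translates of
independent coins, since different digits read different coins. -/
lemma measurePreserving_scrambledPoint {d : ℕ} (S : SobolData d) (n : ℕ) :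
    MeasurePreserving (fun c => S.scrambledPoint c n) (innerLaw d)
      (volume.restrict (cube d)) := by
  have hinj : Function.Injective fun p : Fin d × ℕ =>
      (p.1, (List.range p.2).map (S.digit n p.1)) := by
    rintro ⟨i, k⟩ ⟨i', k'⟩ h
    simp only [Prod.mk.injEq] at h
    have := congrArg List.length h.2
    simp only [List.length_map, List.length_range] at this
    rw [h.1, this]
  have h1 := measurePreserving_coins_comp hinj
  have h2 := measurePreserving_coins_add fun p : Fin d × ℕ => S.digit n p.1 p.2
  have h3 : MeasurePreserving (MeasurableEquiv.curry (Fin d) ℕ (ZMod 2))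
      (Measure.infinitePi fun _ => coin)
      (Measure.infinitePi fun _ : Fin d => Measure.infinitePi fun _ : ℕ => coin) :=
    ⟨by fun_prop, Measure.infinitePi_map_curry fun _ _ => coin⟩
  have h4 : MeasurePreserving (fun (a : Fin d → ℕ → ZMod 2) i => ofBits (a i))
      (Measure.infinitePi fun _ : Fin d => Measure.infinitePi fun _ : ℕ => coin)
      (volume.restrict (cube d)) := by
    rw [Measure.infinitePi_eq_pi, restrict_cube]
    exact measurePreserving_pi _ _ fun _ => measurePreserving_ofBits
  have := h4.comp (h3.comp (h2.comp h1))
  have he : (fun c => S.scrambledPoint c n) = (fun (a : Fin d → ℕ → ZMod 2) i => ofBits (a i)) ∘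
      (MeasurableEquiv.curry (Fin d) ℕ (ZMod 2)) ∘
      (fun c i => c i + S.digit n i.1 i.2) ∘
      fun c k => c (k.1, List.map (S.digit n k.1) (List.range k.2)) := by
    funext c i
    exact congrArg ofBits (funext fun k => add_comm _ _)
  rw [he]
  exact this

/-! ### Boundary growth and mixed differences -/

/-- The distance of a point of `(0,1)` to the boundary of this interval. -/
def bdist (t : ℝ) : ℝ := min t (1 - t)

lemma bdist_pos {t : ℝ} (ht : t ∈ Ioo (0 : ℝ) 1) : 0 < bdist t :=
  lt_min ht.1 (by linarith [ht.2])

lemma bdist_lt_one (t : ℝ) : bdist t < 1 := by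
  unfold bdist
  rcases lt_or_ge t 1 with h | h
  · exact (min_le_left _ _).trans_lt h
  · exact (min_le_right _ _).trans_lt (by linarith)

lemma continuous_bdist : Continuous bdist := by unfold bdist; fun_prop

lemma min_bdist_le {x x' s : ℝ} (hs : s ∈ uIcc x x') : min (bdist x) (bdist x') ≤ bdist s := by
  unfold bdist
  rcases mem_uIcc.1 hs with h | h <;> simp only [le_min_iff, min_le_iff] <;> grind

lemma boundaryGrowth_def {d : ℕ} {φ : (Fin d → ℝ) → ℝ} {B : ℝ} {A : Fin d → ℝ} :
    BoundaryGrowth φ B A ↔ ∃ D : Finset (Fin d) → (Fin d → ℝ) → ℝ,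
      (∀ y ∈ openCube d, D ∅ y = φ y) ∧
      (∀ u : Finset (Fin d), ∀ j, j ∉ u → ∀ y ∈ openCube d,
        HasDerivAt (fun s => D u (Function.update y j s)) (D (insert j u) y) (y j)) ∧
      (∀ u : Finset (Fin d), ∀ y ∈ openCube d,
        |D u y| ≤ B * ∏ i, bdist (y i) ^ (-A i - if i ∈ u then (1 : ℝ) else 0)) := Iff.rfl

lemma prod_bdist_rpow_pos {d : ℕ} {y : Fin d → ℝ} (hy : y ∈ openCube d) (e : Fin d → ℝ)
    (u : Finset (Fin d)) : 0 < ∏ i ∈ u, bdist (y i) ^ e i :=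
  Finset.prod_pos fun i _ => Real.rpow_pos_of_pos (bdist_pos (hy i)) _

lemma half_mem_openCube (d : ℕ) : (fun _ => 1 / 2 : Fin d → ℝ) ∈ openCube d :=
  fun _ => ⟨by norm_num, by norm_num⟩

lemma BoundaryGrowth.const_nonneg {d : ℕ} {φ : (Fin d → ℝ) → ℝ} {B : ℝ} {A : Fin d → ℝ}
    (h : BoundaryGrowth φ B A) : 0 ≤ B := by
  obtain ⟨D, -, -, h3⟩ := boundaryGrowth_def.1 h
  have := (abs_nonneg _).trans (h3 ∅ _ (half_mem_openCube d))
  exact nonneg_of_mul_nonneg_left this (prod_bdist_rpow_pos (half_mem_openCube d) _ _)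

lemma BoundaryGrowth.abs_le {d : ℕ} {φ : (Fin d → ℝ) → ℝ} {B a : ℝ}
    (h : BoundaryGrowth φ B fun _ => a) {y : Fin d → ℝ} (hy : y ∈ openCube d) :
    |φ y| ≤ B * ∏ i, bdist (y i) ^ (-a) := by
  obtain ⟨D, h1, -, h3⟩ := boundaryGrowth_def.1 h
  have := h3 ∅ y hy
  simpa [h1 y hy] using this

lemma BoundaryGrowth.mono {d : ℕ} {φ : (Fin d → ℝ) → ℝ} {B B' : ℝ} {A A' : Fin d → ℝ}
    (h : BoundaryGrowth φ B A) (hB : B ≤ B') (hA : ∀ i, A i ≤ A' i) :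
    BoundaryGrowth φ B' A' := by
  have hB0 := h.const_nonneg
  obtain ⟨D, h1, h2, h3⟩ := boundaryGrowth_def.1 h
  refine boundaryGrowth_def.2 ⟨D, h1, h2, fun u y hy => (h3 u y hy).trans ?_⟩
  refine mul_le_mul hB ?_ (prod_bdist_rpow_pos hy _ _).le (hB0.trans hB)
  refine Finset.prod_le_prod (fun i _ => (Real.rpow_pos_of_pos (bdist_pos (hy i)) _).le)
    fun i _ => ?_
  exact Real.rpow_le_rpow_of_exponent_ge (bdist_pos (hy i)) (bdist_lt_one _).le
    (by linarith [hA i])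

lemma BoundaryGrowth.sub {d : ℕ} {φ ψ : (Fin d → ℝ) → ℝ} {B B' : ℝ} {A : Fin d → ℝ}
    (h : BoundaryGrowth φ B A) (h' : BoundaryGrowth ψ B' A) :
    BoundaryGrowth (fun y => φ y - ψ y) (B + B') A := by
  obtain ⟨D, h1, h2, h3⟩ := boundaryGrowth_def.1 h
  obtain ⟨D', h1', h2', h3'⟩ := boundaryGrowth_def.1 h'
  refine boundaryGrowth_def.2 ⟨fun u y => D u y - D' u y, fun y hy => ?_, fun u j hj y hy =>
    (h2 u j hj y hy).sub (h2' u j hj y hy), fun u y hy => ?_⟩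
  · simp only [h1 y hy, h1' y hy]
  · rw [add_mul]
    exact (abs_sub _ _).trans (add_le_add (h3 u y hy) (h3' u y hy))

lemma BoundaryGrowth.add {d : ℕ} {φ ψ : (Fin d → ℝ) → ℝ} {B B' : ℝ} {A : Fin d → ℝ}
    (h : BoundaryGrowth φ B A) (h' : BoundaryGrowth ψ B' A) :
    BoundaryGrowth (fun y => φ y + ψ y) (B + B') A := by
  obtain ⟨D, h1, h2, h3⟩ := boundaryGrowth_def.1 h
  obtain ⟨D', h1', h2', h3'⟩ := boundaryGrowth_def.1 h'
  refine boundaryGrowth_def.2 ⟨fun u y => D u y + D' u y, fun y hy => ?_, fun u j hj y hy =>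
    (h2 u j hj y hy).add (h2' u j hj y hy), fun u y hy => ?_⟩
  · simp only [h1 y hy, h1' y hy]
  · rw [add_mul]
    exact (abs_add_le _ _).trans (add_le_add (h3 u y hy) (h3' u y hy))

lemma BoundaryGrowth.congr {d : ℕ} {φ ψ : (Fin d → ℝ) → ℝ} {B : ℝ} {A : Fin d → ℝ}
    (h : BoundaryGrowth φ B A) (he : ∀ y ∈ openCube d, φ y = ψ y) : BoundaryGrowth ψ B A := by
  obtain ⟨D, h1, h2, h3⟩ := boundaryGrowth_def.1 h
  exact boundaryGrowth_def.2 ⟨D, fun y hy => (h1 y hy).trans (he y hy), h2, h3⟩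

/-- The bound for a difference with step `x' - x` in one coordinate: it interpolates between
the bound from the growth of the derivative and the one from the growth of the function. -/
def diffBound (σ q x x' : ℝ) : ℝ := 2 * |x - x'| ^ σ * (bdist x ^ (-q) + bdist x' ^ (-q))

lemma diffBound_nonneg {σ q x x' : ℝ} (hx : x ∈ Ioo (0 : ℝ) 1) (hx' : x' ∈ Ioo (0 : ℝ) 1) :
    0 ≤ diffBound σ q x x' := by
  have := Real.rpow_pos_of_pos (bdist_pos hx) (-q)
  have := Real.rpow_pos_of_pos (bdist_pos hx') (-q)
  unfold diffBound; positivity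

/-- In one variable: the difference is bounded by the mean value theorem if the step is shorter than the
distance to the boundary, and by the triangle inequality otherwise. -/
lemma abs_sub_le_diffBound {a σ c : ℝ} (ha : 0 ≤ a) (hσ : σ ∈ Icc (0 : ℝ) 1) {ψ ψ' : ℝ → ℝ}
    (hc : 0 ≤ c) (hd : ∀ s ∈ Ioo (0 : ℝ) 1, HasDerivAt ψ (ψ' s) s)
    (h0 : ∀ s ∈ Ioo (0 : ℝ) 1, |ψ s| ≤ c * bdist s ^ (-a))
    (h1 : ∀ s ∈ Ioo (0 : ℝ) 1, |ψ' s| ≤ c * bdist s ^ (-a - 1))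
    {x x' : ℝ} (hx : x ∈ Ioo (0 : ℝ) 1) (hx' : x' ∈ Ioo (0 : ℝ) 1) :
    |ψ x - ψ x'| ≤ c * diffBound σ (a + σ) x x' := by
  set μ := min (bdist x) (bdist x') with hμ
  have hμ0 : 0 < μ := lt_min (bdist_pos hx) (bdist_pos hx')
  have hseg : uIcc x x' ⊆ Ioo (0 : ℝ) 1 := ordConnected_Ioo.uIcc_subset hx hx'
  have hmvt : |ψ x - ψ x'| ≤ c * μ ^ (-a - 1) * |x - x'| := by
    refine (convex_uIcc x x').norm_image_sub_le_of_norm_hasDerivWithin_le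
      (fun s hs => (hd s (hseg hs)).hasDerivWithinAt) (fun s hs => ?_) right_mem_uIcc left_mem_uIcc
    refine (h1 s (hseg hs)).trans (mul_le_mul_of_nonneg_left ?_ hc)
    exact Real.rpow_le_rpow_of_nonpos hμ0 (min_bdist_le hs) (by linarith)
  have htri : |ψ x - ψ x'| ≤ c * (2 * μ ^ (-a)) := by
    refine (abs_sub _ _).trans ?_
    have e1 := (h0 x hx).trans (mul_le_mul_of_nonneg_left
      (Real.rpow_le_rpow_of_nonpos hμ0 (min_le_left _ _) (by linarith : -a ≤ 0)) hc)
    have e2 := (h0 x' hx').trans (mul_le_mul_of_nonneg_left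
      (Real.rpow_le_rpow_of_nonpos hμ0 (min_le_right _ _) (by linarith : -a ≤ 0)) hc)
    linarith
  set t := |x - x'| / μ with ht
  have ht0 : 0 ≤ t := by positivity
  have hint : |ψ x - ψ x'| ≤ c * (2 * (t ^ σ * μ ^ (-a))) := by
    have hpos : 0 ≤ c * μ ^ (-a) := by positivity
    rcases le_total t 1 with h | h
    · have e : t ≤ t ^ σ := by
        rcases ht0.eq_or_lt with h0 | h0
        · rw [← h0]; exact Real.rpow_nonneg le_rfl _
        · simpa using Real.rpow_le_rpow_of_exponent_ge h0 h hσ.2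
      have e2 : c * μ ^ (-a - 1) * |x - x'| = c * μ ^ (-a) * t := by
        rw [Real.rpow_sub_one hμ0.ne', ht]; ring
      rw [e2] at hmvt
      nlinarith [mul_le_mul_of_nonneg_left e hpos, mul_nonneg hpos ht0]
    · have e : 1 ≤ t ^ σ := Real.one_le_rpow h hσ.1
      nlinarith [mul_le_mul_of_nonneg_left e hpos]
  have hfin : t ^ σ * μ ^ (-a) = |x - x'| ^ σ * μ ^ (-(a + σ)) := by
    rw [ht, Real.div_rpow (abs_nonneg _) hμ0.le, div_mul_eq_mul_div, mul_div_assoc,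
      ← Real.rpow_sub hμ0]
    ring_nf
  have hμq : μ ^ (-(a + σ)) ≤ bdist x ^ (-(a + σ)) + bdist x' ^ (-(a + σ)) := by
    have e1 := Real.rpow_pos_of_pos (bdist_pos hx) (-(a + σ))
    have e2 := Real.rpow_pos_of_pos (bdist_pos hx') (-(a + σ))
    rcases min_choice (bdist x) (bdist x') with h | h <;> rw [hμ, h] <;> linarith
  refine hint.trans (mul_le_mul_of_nonneg_left ?_ hc)
  rw [hfin, diffBound, mul_assoc]
  gcongr

/-- The alternating sum of the values of `ψ` at the corners of the box with opposite corners `x` and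
`x'` in the coordinates `i ∈ u`. -/
def altDiff {d : ℕ} (ψ : (Fin d → ℝ) → ℝ) (u : Finset (Fin d)) (x x' : Fin d → ℝ) : ℝ :=
  ∑ v ∈ u.powerset, (-1) ^ v.card * ψ (v.piecewise x' x)

lemma altDiff_insert {d : ℕ} (ψ : (Fin d → ℝ) → ℝ) {u : Finset (Fin d)} {j : Fin d} (hj : j ∉ u)
    (x x' : Fin d → ℝ) : altDiff ψ (insert j u) x x' =
      altDiff ψ u x x' - altDiff ψ u (Function.update x j (x' j)) x' := by
  rw [altDiff, Finset.sum_powerset_insert hj, sub_eq_add_neg, altDiff, altDiff,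
    ← Finset.sum_neg_distrib]
  congr 1
  refine Finset.sum_congr rfl fun v hv => ?_
  have hjv : j ∉ v := fun h => hj (Finset.mem_powerset.1 hv h)
  rw [Finset.card_insert_of_notMem hjv, Finset.piecewise_insert,
    Finset.update_piecewise_of_notMem _ _ _ hjv, pow_succ]
  ring

lemma piecewise_mem_openCube {d : ℕ} {x x' : Fin d → ℝ} (hx : x ∈ openCube d)
    (hx' : x' ∈ openCube d) (v : Finset (Fin d)) : v.piecewise x' x ∈ openCube d := by
  intro i
  by_cases h : i ∈ v <;> simp only [h, hx i, hx' i, Finset.piecewise_eq_of_mem,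
    Finset.piecewise_eq_of_notMem, not_false_eq_true]

lemma update_mem_openCube {d : ℕ} {x : Fin d → ℝ} (hx : x ∈ openCube d) (j : Fin d) {s : ℝ}
    (hs : s ∈ Ioo (0 : ℝ) 1) : Function.update x j s ∈ openCube d := by
  intro i
  by_cases h : i = j
  · subst h; simpa using hs
  · simpa [h] using hx i

/-- Mixed differences of a function with boundary growth, and of its mixed partial derivatives:
one coordinate is differenced at a time. -/
lemma abs_altDiff_le_aux {d : ℕ} {D : Finset (Fin d) → (Fin d → ℝ) → ℝ} {B a σ : ℝ} (ha : 0 ≤ a)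
    (hσ : σ ∈ Icc (0 : ℝ) 1) (hB : 0 ≤ B)
    (h2 : ∀ u : Finset (Fin d), ∀ j, j ∉ u → ∀ y ∈ openCube d,
      HasDerivAt (fun s => D u (Function.update y j s)) (D (insert j u) y) (y j))
    (h3 : ∀ u : Finset (Fin d), ∀ y ∈ openCube d,
      |D u y| ≤ B * ∏ i, bdist (y i) ^ (-a - if i ∈ u then (1 : ℝ) else 0))
    (u : Finset (Fin d)) : ∀ v : Finset (Fin d), Disjoint u v → ∀ x ∈ openCube d,
      ∀ x' ∈ openCube d, |altDiff (D v) u x x'| ≤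
        B * (∏ i ∈ u, diffBound σ (a + σ) (x i) (x' i)) *
          ∏ i ∈ uᶜ, bdist (x i) ^ (-a - if i ∈ v then (1 : ℝ) else 0) := by
  induction u using Finset.induction_on with
  | empty =>
    intro v _ x hx x' hx'
    simpa [altDiff] using h3 v x hx
  | insert j u hj ih =>
    intro v hv x hx x' hx'
    rw [Finset.disjoint_insert_left] at hv
    obtain ⟨hjv, huv⟩ := hv
    have hcompl : uᶜ = insert j (insert j u)ᶜ := by
      ext i; by_cases h : i = j <;> simp [h, hj]
    have hjc : j ∉ (insert j u)ᶜ := by simp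
    -- the bound for the remaining coordinates, as a factor
    set c := B * (∏ i ∈ u, diffBound σ (a + σ) (x i) (x' i)) *
      ∏ i ∈ (insert j u)ᶜ, bdist (x i) ^ (-a - if i ∈ v then (1 : ℝ) else 0) with hc
    have hc0 : 0 ≤ c := by
      refine mul_nonneg (mul_nonneg hB (Finset.prod_nonneg fun i _ =>
        diffBound_nonneg (hx i) (hx' i))) (prod_bdist_rpow_pos hx _ _).le
    have hbound : ∀ (v' : Finset (Fin d)), Disjoint u v' → (∀ i, i ≠ j → (i ∈ v' ↔ i ∈ v)) →
        ∀ s ∈ Ioo (0 : ℝ) 1, |altDiff (D v') u (Function.update x j s) x'| ≤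
          c * bdist s ^ (-a - if j ∈ v' then (1 : ℝ) else 0) := by
      intro v' hd hv' s hs
      refine (ih v' hd _ (update_mem_openCube hx j hs) x' hx').trans_eq ?_
      rw [hcompl, Finset.prod_insert hjc, Function.update_self, hc]
      have e1 : ∏ i ∈ u, diffBound σ (a + σ) (Function.update x j s i) (x' i) =
          ∏ i ∈ u, diffBound σ (a + σ) (x i) (x' i) :=
        Finset.prod_congr rfl fun i hi => by
          rw [Function.update_of_ne (ne_of_mem_of_not_mem hi hj)]
      have e2 : ∏ i ∈ (insert j u)ᶜ, bdist (Function.update x j s i) ^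
            (-a - if i ∈ v' then (1 : ℝ) else 0) =
          ∏ i ∈ (insert j u)ᶜ, bdist (x i) ^ (-a - if i ∈ v then (1 : ℝ) else 0) :=
        Finset.prod_congr rfl fun i hi => by
          have hij : i ≠ j := fun h => hjc (h ▸ hi)
          rw [Function.update_of_ne hij]; simp only [hv' i hij]
      rw [e1, e2]; ring
    have hderiv : ∀ s ∈ Ioo (0 : ℝ) 1,
        HasDerivAt (fun s => altDiff (D v) u (Function.update x j s) x')
          (altDiff (D (insert j v)) u (Function.update x j s) x') s := by
      intro s hs
      unfold altDiff
      refine HasDerivAt.fun_sum fun t ht => HasDerivAt.const_mul _ ?_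
      have hjt : j ∉ t := fun h => hj (Finset.mem_powerset.1 ht h)
      have hy := piecewise_mem_openCube (update_mem_openCube hx j hs) hx' t
      have := h2 v j hjv _ hy
      simp only [← Finset.update_piecewise_of_notMem _ _ _ hjt, Function.update_idem,
        Function.update_self] at this ⊢
      exact this
    have key := abs_sub_le_diffBound ha hσ hc0 hderiv
      (fun s hs => by simpa [hjv] using hbound v huv (fun _ _ => Iff.rfl) s hs)
      (fun s hs => by
        simpa using hbound (insert j v) (Finset.disjoint_insert_right.2 ⟨hj, huv⟩)
          (fun i hi => by simp [hi]) s hs) (hx j) (hx' j)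
    simp only [Function.update_eq_self] at key
    rw [altDiff_insert _ hj]
    refine key.trans_eq ?_
    rw [hc, Finset.prod_insert hj]; ring

lemma BoundaryGrowth.abs_altDiff_le {d : ℕ} {φ : (Fin d → ℝ) → ℝ} {B a σ : ℝ}
    (h : BoundaryGrowth φ B fun _ => a) (ha : 0 ≤ a) (hσ : σ ∈ Icc (0 : ℝ) 1)
    (u : Finset (Fin d)) {x x' : Fin d → ℝ} (hx : x ∈ openCube d) (hx' : x' ∈ openCube d) :
    |altDiff φ u x x'| ≤ B * (∏ i ∈ u, (2 * |x i - x' i| ^ σ)) *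
      ∑ v ∈ u.powerset, ∏ i, bdist (v.piecewise x' x i) ^ (-(a + σ)) := by
  have hB := h.const_nonneg
  obtain ⟨D, h1, h2, h3⟩ := boundaryGrowth_def.1 h
  have e : altDiff φ u x x' = altDiff (D ∅) u x x' :=
    Finset.sum_congr rfl fun v _ => by rw [h1 _ (piecewise_mem_openCube hx hx' v)]
  rw [e]
  refine (abs_altDiff_le_aux ha hσ hB h2 h3 u ∅ (Finset.disjoint_empty_right _) x hx x' hx').trans ?_
  have hpw : ∀ v ∈ u.powerset, ∏ i, bdist (v.piecewise x' x i) ^ (-(a + σ)) =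
      ((∏ i ∈ v, bdist (x' i) ^ (-(a + σ))) * ∏ i ∈ u \ v, bdist (x i) ^ (-(a + σ))) *
        ∏ i ∈ uᶜ, bdist (x i) ^ (-(a + σ)) := by
    intro v hv
    have hvu := Finset.mem_powerset.1 hv
    rw [← Finset.prod_mul_prod_compl u, ← Finset.prod_sdiff hvu, mul_comm (∏ i ∈ u \ v, _)]
    congr 1
    · congr 1
      · exact Finset.prod_congr rfl fun i hi => by simp [hi]
      · exact Finset.prod_congr rfl fun i hi => by simp [(Finset.mem_sdiff.1 hi).2]
    · exact Finset.prod_congr rfl fun i hi => by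
        rw [Finset.piecewise_eq_of_notMem _ _ _ fun h => Finset.mem_compl.1 hi (hvu h)]
  rw [Finset.sum_congr rfl hpw, ← Finset.sum_mul, ← Finset.prod_add]
  have hdb : ∏ i ∈ u, diffBound σ (a + σ) (x i) (x' i) = (∏ i ∈ u, (2 * |x i - x' i| ^ σ)) *
      ∏ i ∈ u, (bdist (x' i) ^ (-(a + σ)) + bdist (x i) ^ (-(a + σ))) := by
    rw [← Finset.prod_mul_distrib]
    exact Finset.prod_congr rfl fun i _ => by rw [diffBound, add_comm (bdist (x i) ^ _)]
  rw [hdb, ← mul_assoc B, mul_assoc (B * _)]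
  have hP : 0 ≤ ∏ i ∈ u, (2 * |x i - x' i| ^ σ) := Finset.prod_nonneg fun i _ => by positivity
  have hS : 0 ≤ ∏ i ∈ u, (bdist (x' i) ^ (-(a + σ)) + bdist (x i) ^ (-(a + σ))) :=
    Finset.prod_nonneg fun i _ => (add_pos (Real.rpow_pos_of_pos (bdist_pos (hx' i)) _)
      (Real.rpow_pos_of_pos (bdist_pos (hx i)) _)).le
  refine mul_le_mul_of_nonneg_left (mul_le_mul_of_nonneg_left ?_ hS) (mul_nonneg hB hP)
  refine Finset.prod_le_prod (fun i _ => (Real.rpow_pos_of_pos (bdist_pos (hx i)) _).le)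
    fun i _ => ?_
  refine Real.rpow_le_rpow_of_exponent_ge (bdist_pos (hx i)) (bdist_lt_one _).le ?_
  simp only [Finset.notMem_empty, if_false]
  linarith [hσ.1]

/-- The partial derivatives are locally bounded, hence the function is continuous. -/
lemma BoundaryGrowth.tendsto {d : ℕ} {φ : (Fin d → ℝ) → ℝ} {B a : ℝ}
    (h : BoundaryGrowth φ B fun _ => a) (ha : 0 ≤ a) {y : Fin d → ℝ} (hy : y ∈ openCube d) :
    Tendsto φ (𝓝 y) (𝓝 (φ y)) := by
  have hopen : IsOpen (openCube d) := by
    rw [openCube_eq]; exact isOpen_set_pi finite_univ fun _ _ => isOpen_Ioo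
  have hev : ∀ᶠ z in 𝓝 y, z ∈ openCube d := hopen.mem_nhds hy
  have key : ∀ u : Finset (Fin d), Tendsto (fun z => φ (u.piecewise z y)) (𝓝 y) (𝓝 (φ y)) := by
    intro u
    induction u using Finset.induction_on with
    | empty => simp
    | insert j u hj ih =>
      -- changing one more coordinate is a difference of order one
      set G : (Fin d → ℝ) → ℝ := fun z => B * (2 * |y j - z j| ^ (1 : ℝ)) *
        (∏ i, bdist (u.piecewise z y i) ^ (-(a + 1)) +
          ∏ i, bdist ((insert j u).piecewise z y i) ^ (-(a + 1))) with hG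
      have hG0 : Tendsto G (𝓝 y) (𝓝 0) := by
        have hcb : ∀ v : Finset (Fin d), ContinuousAt
            (fun z => ∏ i, bdist (v.piecewise z y i) ^ (-(a + 1))) y := by
          intro v
          refine tendsto_finsetProd _ fun i _ => ?_
          have hc : Continuous fun z : Fin d → ℝ => bdist (v.piecewise z y i) := by
            refine continuous_bdist.comp ?_
            by_cases hi : i ∈ v <;> simp only [hi, Finset.piecewise_eq_of_mem,
              Finset.piecewise_eq_of_notMem, not_false_eq_true] <;> fun_prop
          refine (hc.continuousAt (x := y)).rpow_const (Or.inl ?_)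
          simpa [Finset.piecewise_same] using (bdist_pos (hy i)).ne'
        have : ContinuousAt G y := by
          refine ContinuousAt.mul ?_ ((hcb _).add (hcb _))
          simp only [Real.rpow_one]
          exact Continuous.continuousAt (by fun_prop)
        simpa [ContinuousAt, hG] using this
      have hle : ∀ᶠ z in 𝓝 y, ‖φ (u.piecewise z y) - φ ((insert j u).piecewise z y)‖ ≤ G z := by
        filter_upwards [hev] with z hz
        have hx := piecewise_mem_openCube hy hz u
        have hx' := update_mem_openCube hx j (hz j)
        have e := h.abs_altDiff_le ha (right_mem_Icc.2 zero_le_one) {j} hx hx'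
        have hp : Finset.powerset {j} = {∅, {j}} := by rfl
        have hne : (∅ : Finset (Fin d)) ≠ {j} := (Finset.singleton_ne_empty j).symm
        have hpw : Finset.piecewise {j} (Function.update (u.piecewise z y) j (z j))
            (u.piecewise z y) = (insert j u).piecewise z y := by
          rw [Finset.piecewise_insert, Finset.piecewise_singleton, Function.update_self]
        rw [altDiff, hp, Finset.sum_pair hne, Finset.sum_pair hne, hpw] at e
        simpa [hG, hj, ← sub_eq_add_neg] using e
      have := ih.sub (squeeze_zero_norm' hle hG0)
      simpa using this
  simpa using key Finset.univ

lemma integrableOn_bdist_rpow {q : ℝ} (hq : q < 1) :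
    Integrable (fun t => bdist t ^ (-q)) (volume.restrict (Icc (0 : ℝ) 1)) := by
  have h1 : IntervalIntegrable (fun t : ℝ => t ^ (-q)) volume 0 1 :=
    intervalIntegral.intervalIntegrable_rpow' (by linarith)
  have h2 : IntervalIntegrable (fun t : ℝ => (1 - t) ^ (-q)) volume 0 1 := by
    simpa using (h1.comp_sub_left 1).symm
  have h3 := h1.add h2
  rw [intervalIntegrable_iff_integrableOn_Icc_of_le zero_le_one] at h3
  have hm : Measurable fun t => bdist t ^ (-q) :=
    continuous_bdist.measurable.pow_const _
  refine Integrable.mono' h3 hm.aestronglyMeasurable ?_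
  refine (ae_restrict_iff' measurableSet_Icc).2 (ae_of_all _ fun t ht => ?_)
  have e1 : 0 ≤ t ^ (-q) := Real.rpow_nonneg ht.1 _
  have e2 : 0 ≤ (1 - t) ^ (-q) := Real.rpow_nonneg (by linarith [ht.2]) _
  have e3 : 0 ≤ bdist t := le_min ht.1 (by linarith [ht.2])
  rw [Real.norm_of_nonneg (Real.rpow_nonneg e3 _)]
  show _ ≤ t ^ (-q) + (1 - t) ^ (-q)
  unfold bdist
  rcases min_choice t (1 - t) with h | h <;> rw [h] <;> linarith

lemma integrable_prod_bdist {d : ℕ} {q : ℝ} (hq : q < 1) :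
    Integrable (fun y : Fin d → ℝ => ∏ i, bdist (y i) ^ (-q)) (volume.restrict (cube d)) := by
  rw [restrict_cube]
  exact Integrable.fintype_prod fun _ => integrableOn_bdist_rpow hq

/-! ### The net property of Sobol' sequences -/

section Sobol
open Polynomial

/-- The `k`-th row of the `j`-th generator matrix, as a linear functional on polynomials:
`Xⁱ ↦ v_{j,i,k}`. -/
def SobolData.row {d : ℕ} (S : SobolData d) (j : Fin d) (k : ℕ) : (ZMod 2)[X] →ₗ[ZMod 2] ZMod 2 :=
  Polynomial.lsum fun i => LinearMap.mulRight (ZMod 2) (S.dir j i k)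

namespace SobolData
variable {d : ℕ} (S : SobolData d)

lemma row_X_pow (j : Fin d) (k i : ℕ) : S.row j k (X ^ i) = S.dir j i k := by
  rw [row, Polynomial.lsum_apply, ← monomial_one_right_eq_X_pow, sum_monomial_index] <;> simp

lemma row_eq_sum (j : Fin d) (k : ℕ) (q : (ZMod 2)[X]) :
    S.row j k q = ∑ i ∈ Finset.range (q.natDegree + 1), q.coeff i * S.dir j i k := by
  rw [row, Polynomial.lsum_apply, Polynomial.sum_over_range] <;> simp

/-- The recurrence of the direction numbers: multiplication by `p_j` shifts the rows. -/
lemma row_poly_mul (j : Fin d) (k : ℕ) (q : (ZMod 2)[X]) : S.row j k (S.poly j * q) =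
    if (S.poly j).natDegree ≤ k then S.row j (k - (S.poly j).natDegree) q else 0 := by
  induction q using Polynomial.induction_on' with
  | add p q hp hq => rw [mul_add, map_add, hp, hq]; split_ifs <;> simp
  | monomial i c =>
    have h1 : (monomial i c : (ZMod 2)[X]) = c • X ^ i := by
      rw [← monomial_one_right_eq_X_pow, smul_monomial, smul_eq_mul, mul_one]
    have h2 : S.poly j * X ^ i = ∑ m ∈ Finset.range ((S.poly j).natDegree + 1),
        (S.poly j).coeff m • (X : (ZMod 2)[X]) ^ (i + m) := by
      conv_lhs => rw [(S.poly j).as_sum_range_C_mul_X_pow, Finset.sum_mul]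
      refine Finset.sum_congr rfl fun m _ => ?_
      rw [smul_eq_C_mul, mul_assoc, ← pow_add, add_comm m]
    rw [h1, mul_smul_comm, map_smul, h2, map_sum]
    simp only [map_smul, row_X_pow, smul_eq_mul]
    rw [S.recurrence]
    split_ifs <;> simp

/-- The generator matrices are triangular with ones on the diagonal. -/
lemma eq_zero_of_row_eq_zero (j : Fin d) {q : (ZMod 2)[X]} {n : ℕ} (hq : q.degree < n)
    (h : ∀ k < n, S.row j k q = 0) : q = 0 := by
  by_contra h0
  have hn : q.natDegree < n := (natDegree_lt_iff_degree_lt h0).2 hq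
  have := h _ hn
  rw [row_eq_sum, Finset.sum_range_succ, S.diag, mul_one, Finset.sum_eq_zero, zero_add] at this
  · exact h0 (leadingCoeff_eq_zero.1 this)
  · intro i hi
    rw [S.upper j i _ (Finset.mem_range.1 hi), mul_zero]

/-- The digits of a coordinate that come first vanish iff the index polynomial is divisible by a power of
`p_j`. -/
lemma row_eq_zero_iff (j : Fin d) (Q : ℕ) (q : (ZMod 2)[X]) :
    (∀ k < Q * (S.poly j).natDegree, S.row j k q = 0) ↔ S.poly j ^ Q ∣ q := by
  induction Q generalizing q with
  | zero => simp
  | succ Q ih =>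
    have hshift : ∀ q', (∀ k < (Q + 1) * (S.poly j).natDegree, S.row j k (S.poly j * q') = 0) ↔
        ∀ k < Q * (S.poly j).natDegree, S.row j k q' = 0 := by
      intro q'
      constructor
      · intro h k hk
        have := h (k + (S.poly j).natDegree) (by rw [add_mul, one_mul]; omega)
        rwa [row_poly_mul, if_pos (by omega), Nat.add_sub_cancel] at this
      · intro h k hk
        rw [add_mul, one_mul] at hk
        rw [row_poly_mul]
        split_ifs with hek
        · exact h _ (by omega)
        · rfl
    have h0 := (S.irreducible j).ne_zero
    constructor
    · intro h
      have hmod : q % S.poly j = 0 := by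
        refine S.eq_zero_of_row_eq_zero j (n := (S.poly j).natDegree) ?_ fun k hk => ?_
        · rw [← degree_eq_natDegree h0]; exact EuclideanDomain.mod_lt q h0
        · have := h k (hk.trans_le (by rw [add_mul, one_mul]; omega))
          rw [← EuclideanDomain.div_add_mod q (S.poly j), map_add, row_poly_mul,
            if_neg (by omega), zero_add] at this
          exact this
      obtain ⟨q', rfl⟩ := EuclideanDomain.mod_eq_zero.1 hmod
      rw [pow_succ', mul_dvd_mul_iff_left h0, ← ih]
      exact (hshift q').1 h
    · intro h
      obtain ⟨q', rfl⟩ := (dvd_pow_self (S.poly j) Q.succ_ne_zero).trans h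
      rw [pow_succ', mul_dvd_mul_iff_left h0, ← ih] at h
      exact (hshift q').2 h

lemma monic_poly (j : Fin d) : (S.poly j).Monic := by
  have h := leadingCoeff_ne_zero.2 (S.irreducible j).ne_zero
  unfold Monic
  revert h
  generalize (S.poly j).leadingCoeff = z
  revert z; decide

lemma natDegree_poly_pos (j : Fin d) : 0 < (S.poly j).natDegree :=
  (S.irreducible j).natDegree_pos

lemma isCoprime_poly {i j : Fin d} (h : i ≠ j) : IsCoprime (S.poly i) (S.poly j) := by
  refine (dvd_or_isCoprime _ _ (S.irreducible i)).resolve_left fun hd => h (S.distinct ?_)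
  exact eq_of_monic_of_associated (S.monic_poly i) (S.monic_poly j)
    ((S.irreducible i).associated_of_dvd (S.irreducible j) hd)

end SobolData

/-- The polynomial whose coefficients are the binary digits of `n`. -/
def bitPoly (n : ℕ) : (ZMod 2)[X] := ∑ i ∈ Finset.range n, if n.testBit i then X ^ i else 0

lemma bitPoly_coeff (n i : ℕ) : (bitPoly n).coeff i = if n.testBit i then 1 else 0 := by
  have h : ∀ k, (if n.testBit k then (X : (ZMod 2)[X]) ^ k else 0).coeff i =
      if k = i then (if n.testBit i then 1 else 0) else 0 := by
    intro k
    by_cases hk : k = i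
    · subst hk; rw [if_pos rfl]; split_ifs <;> simp
    · rw [if_neg hk]; split_ifs
      · rw [coeff_X_pow, if_neg (Ne.symm hk)]
      · rw [coeff_zero]
  rw [bitPoly, finsetSum_coeff, Finset.sum_congr rfl fun k _ => h k, Finset.sum_ite_eq']
  by_cases hb : n.testBit i
  · have : i < n := Nat.lt_of_lt_of_le Nat.lt_two_pow_self (Nat.ge_two_pow_of_testBit hb)
    rw [if_pos (Finset.mem_range.2 this)]
  · simp [hb]

lemma bitPoly_injective : Function.Injective bitPoly := by
  intro m n h
  refine Nat.eq_of_testBit_eq fun i => ?_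
  have := congrArg (fun q => q.coeff i) h
  simp only [bitPoly_coeff] at this
  by_cases h1 : m.testBit i <;> by_cases h2 : n.testBit i <;> simp_all

lemma bitPoly_xor (m n : ℕ) : bitPoly (m ^^^ n) = bitPoly m + bitPoly n := by
  ext i
  rw [coeff_add, bitPoly_coeff, bitPoly_coeff, bitPoly_coeff, Nat.testBit_xor]
  have h11 : (1 + 1 : ZMod 2) = 0 := by decide
  by_cases h1 : m.testBit i <;> by_cases h2 : n.testBit i <;> simp [h1, h2, h11]

lemma bitPoly_degree_lt {n m : ℕ} (h : n < 2 ^ m) : (bitPoly n).degree < m := by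
  rw [degree_lt_iff_coeff_zero]
  intro i hi
  rw [bitPoly_coeff, Nat.testBit_lt_two_pow (h.trans_le (Nat.pow_le_pow_right two_pos hi))]
  simp

lemma exists_bitPoly_eq {q : (ZMod 2)[X]} {m : ℕ} (hq : q.degree < m) :
    ∃ n < 2 ^ m, bitPoly n = q := by
  refine ⟨Nat.ofBits fun i : Fin m => decide (q.coeff i = 1), Nat.ofBits_lt_two_pow _, ?_⟩
  ext i
  have h01 : q.coeff i = 0 ∨ q.coeff i = 1 := by
    generalize q.coeff i = z; revert z; decide
  rw [bitPoly_coeff]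
  by_cases hi : i < m
  · rw [Nat.testBit_ofBits_lt _ _ hi]
    rcases h01 with h | h <;> simp [h]
  · rw [Nat.testBit_ofBits_ge _ _ (by omega), (degree_lt_iff_coeff_zero _ _).1 hq i (by omega)]
    simp

namespace SobolData
variable {d : ℕ} (S : SobolData d)

lemma digit_eq_row (n : ℕ) (j : Fin d) (k : ℕ) : S.digit n j k = S.row j k (bitPoly n) := by
  rw [bitPoly, map_sum, digit]
  refine Finset.sum_congr rfl fun i _ => ?_
  split_ifs
  · rw [row_X_pow]
  · simp

lemma digit_xor (m n : ℕ) (j : Fin d) (k : ℕ) :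
    S.digit (m ^^^ n) j k = S.digit m j k + S.digit n j k := by
  simp only [digit_eq_row, bitPoly_xor, map_add]

/-- The sum of the degrees of the polynomials: a bound for the quality parameter. -/
def degSum : ℕ := ∑ j, (S.poly j).natDegree

lemma prod_pow_dvd {s : Finset (Fin d)} {Q : Fin d → ℕ} {q : (ZMod 2)[X]}
    (h : ∀ j ∈ s, S.poly j ^ Q j ∣ q) : ∏ j ∈ s, S.poly j ^ Q j ∣ q :=
  Finset.prod_dvd_of_coprime (fun _ _ _ _ hij => (S.isCoprime_poly hij).pow) h

lemma natDegree_prod_pow (s : Finset (Fin d)) (Q : Fin d → ℕ) :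
    (∏ j ∈ s, S.poly j ^ Q j).natDegree = ∑ j ∈ s, Q j * (S.poly j).natDegree := by
  rw [natDegree_prod_of_monic _ _ fun j _ => (S.monic_poly j).pow _]
  exact Finset.sum_congr rfl fun j _ => natDegree_pow _ _

/-- There are few points with index below `2 ^ m` in an elementary interval at the origin. -/
lemma card_digit_eq_zero_le (m : ℕ) (κ : Fin d → ℕ) (h : m < ∑ j, κ j + S.degSum) :
    ((Finset.range (2 ^ m)).filter fun n => ∀ j, ∀ k < κ j - 1, S.digit n j k = 0).card ≤
      2 ^ (2 * S.degSum) := by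
  set Q : Fin d → ℕ := fun j => (κ j - 1) / (S.poly j).natDegree with hQ
  set P := ∏ j, S.poly j ^ Q j with hP
  have hPm : P.Monic := monic_prod_of_monic _ _ fun j _ => (S.monic_poly j).pow _
  have hdeg : P.natDegree + 2 * S.degSum ≥ m := by
    have : ∑ j, κ j ≤ ∑ j, (Q j * (S.poly j).natDegree + (S.poly j).natDegree) := by
      refine Finset.sum_le_sum fun j _ => ?_
      have := Nat.lt_div_mul_add (a := κ j - 1) (S.natDegree_poly_pos j)
      simp only [hQ]; omega
    rw [Finset.sum_add_distrib, ← natDegree_prod_pow] at this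
    unfold degSum at h ⊢
    rw [hP]
    omega
  have hdvd : ∀ n ∈ (Finset.range (2 ^ m)).filter
      fun n => ∀ j, ∀ k < κ j - 1, S.digit n j k = 0, P ∣ bitPoly n := by
    intro n hn
    refine S.prod_pow_dvd fun j _ => (S.row_eq_zero_iff j _ _).1 fun k hk => ?_
    rw [← digit_eq_row]
    exact (Finset.mem_filter.1 hn).2 j k (hk.trans_le (Nat.div_mul_le_self _ _))
  have hcard : (Finset.univ : Finset (Fin (2 * S.degSum) → ZMod 2)).card =
      2 ^ (2 * S.degSum) := by simp [ZMod.card]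
  rw [← hcard]
  refine Finset.card_le_card_of_injOn (fun n i => (bitPoly n / P).coeff i)
    (fun _ _ => Finset.mem_univ _) fun n hn n' hn' he => bitPoly_injective ?_
  rw [Finset.mem_coe] at hn hn'
  have hq : bitPoly n / P = bitPoly n' / P := by
    have hz : ∀ n ∈ (Finset.range (2 ^ m)).filter
        (fun n => ∀ j, ∀ k < κ j - 1, S.digit n j k = 0), ∀ i, 2 * S.degSum ≤ i →
        (bitPoly n / P).coeff i = 0 := by
      intro n hn i hi
      obtain ⟨w, hw⟩ := hdvd n hn
      have hlt := bitPoly_degree_lt (Finset.mem_range.1 (Finset.mem_filter.1 hn).1)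
      rw [hw, mul_div_cancel_left₀ _ hPm.ne_zero]
      by_contra h0
      have hw0 : w ≠ 0 := fun h => h0 (by rw [h, coeff_zero])
      rw [hw, ← natDegree_lt_iff_degree_lt (mul_ne_zero hPm.ne_zero hw0),
        natDegree_mul hPm.ne_zero hw0] at hlt
      have := le_natDegree_of_ne_zero h0
      omega
    ext i
    rcases lt_or_ge i (2 * S.degSum) with h | h
    · exact congrFun he ⟨i, h⟩
    · rw [hz n hn i h, hz n' hn' i h]
  rw [← EuclideanDomain.mul_div_cancel' hPm.ne_zero (hdvd n hn), hq,
    EuclideanDomain.mul_div_cancel' hPm.ne_zero (hdvd n' hn')]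

/-- The net property: the first digits of a point with index below `2 ^ m` can be prescribed.
Here, only one digit is nonzero. -/
lemma exists_digit_eq (m : ℕ) (κ : Fin d → ℕ) (h : ∑ j, κ j + S.degSum ≤ m) (i : Fin d) :
    ∃ z < 2 ^ m, ∀ j, ∀ k < κ j, S.digit z j k = if j = i ∧ k = κ i - 1 then 1 else 0 := by
  set Q : Fin d → ℕ := fun j => κ j / (S.poly j).natDegree + 1 with hQ
  have hQκ : ∀ j, κ j < Q j * (S.poly j).natDegree := fun j => by
    have := Nat.lt_div_mul_add (a := κ j) (S.natDegree_poly_pos j)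
    simp only [hQ]; rw [add_mul, one_mul]; exact this
  have hQle : ∀ j, Q j * (S.poly j).natDegree ≤ κ j + (S.poly j).natDegree := fun j => by
    have := Nat.div_mul_le_self (κ j) (S.poly j).natDegree
    simp only [hQ]; rw [add_mul, one_mul]; omega
  set M := Q i * (S.poly i).natDegree with hM
  set P := ∏ j ∈ Finset.univ.erase i, S.poly j ^ Q j with hP
  have hPm : P.Monic := monic_prod_of_monic _ _ fun j _ => (S.monic_poly j).pow _
  have hPdeg : P.natDegree + M ≤ m := by
    rw [hP, natDegree_prod_pow, hM, Finset.sum_erase_add _ _ (Finset.mem_univ i)]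
    refine (Finset.sum_le_sum fun j _ => hQle j).trans ?_
    rw [Finset.sum_add_distrib]
    exact h
  have hcop : IsCoprime (S.poly i ^ Q i) P :=
    IsCoprime.prod_right fun j hj => (S.isCoprime_poly (Finset.ne_of_mem_erase hj).symm).pow
  -- the first `M` rows of the `i`-th matrix, restricted to the multiples of `P`
  let Λ : (Fin M → ZMod 2) →ₗ[ZMod 2] (Fin M → ZMod 2) :=
    (LinearMap.pi fun k : Fin M => (S.row i k) ∘ₗ LinearMap.mulLeft (ZMod 2) P) ∘ₗ
      (degreeLT (ZMod 2) M).subtype ∘ₗ (degreeLTEquiv (ZMod 2) M).symm.toLinearMap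
  have hinj : Function.Injective Λ := by
    rw [← LinearMap.ker_eq_bot, LinearMap.ker_eq_bot']
    intro w hw
    set p := (degreeLTEquiv (ZMod 2) M).symm w with hp
    have h1 : S.poly i ^ Q i ∣ P * p.1 :=
      (S.row_eq_zero_iff i _ _).1 fun k hk => congrFun hw ⟨k, hk⟩
    have h2 : p.1 = 0 := by
      refine eq_zero_of_dvd_of_degree_lt (hcop.dvd_of_dvd_mul_left h1) ?_
      rw [degree_eq_natDegree ((S.monic_poly i).pow _).ne_zero, natDegree_pow]
      exact mem_degreeLT.1 p.2
    have h3 : p = 0 := Subtype.ext h2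
    simpa [hp] using h3
  obtain ⟨w, hw⟩ := (LinearMap.injective_iff_surjective.1 hinj)
    fun k => if (k : ℕ) = κ i - 1 then 1 else 0
  set p := (degreeLTEquiv (ZMod 2) M).symm w with hp
  have hdeg : (P * p.1).degree < m := by
    rw [degree_mul, degree_eq_natDegree hPm.ne_zero]
    calc (P.natDegree : WithBot ℕ) + p.1.degree < P.natDegree + M :=
          WithBot.add_lt_add_left WithBot.coe_ne_bot (mem_degreeLT.1 p.2)
      _ ≤ m := by exact_mod_cast hPdeg
  obtain ⟨z, hz, hzq⟩ := exists_bitPoly_eq hdeg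
  refine ⟨z, hz, fun j k hk => ?_⟩
  rw [digit_eq_row, hzq]
  by_cases hj : j = i
  · subst hj
    simp only [true_and]
    exact congrFun hw ⟨k, hk.trans (hQκ j)⟩
  · simp only [hj, false_and, if_false]
    refine (S.row_eq_zero_iff j (Q j) _).2 ?_ k (hk.trans (hQκ j))
    exact (Finset.dvd_prod_of_mem _ (Finset.mem_erase.2 ⟨hj, Finset.mem_univ j⟩)).mul_right _

end SobolData

end Sobol

/-! ### Walsh analysis of functions of finitely many digits -/

/-- The nontrivial character of `ZMod 2`, with real values. -/
def sgn (z : ZMod 2) : ℝ := if z = 0 then 1 else -1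

lemma sgn_add (z w : ZMod 2) : sgn (z + w) = sgn z * sgn w := by
  have : ∀ z w : ZMod 2, (z + w = 0 ↔ (z = 0 ↔ w = 0)) := by decide
  unfold sgn
  by_cases hz : z = 0 <;> by_cases hw : w = 0 <;> simp [this, hz, hw]

lemma sgn_mul_self (z : ZMod 2) : sgn z * sgn z = 1 := by
  unfold sgn; split_ifs <;> norm_num

section Walsh
variable {ι : Type*}

/-- The Walsh function with frequency `s`. -/
def chi (s : Finset ι) (a : ι → ZMod 2) : ℝ := ∏ p ∈ s, sgn (a p)

lemma chi_add (s : Finset ι) (a b : ι → ZMod 2) : chi s (a + b) = chi s a * chi s b := by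
  simp only [chi, Pi.add_apply, sgn_add, Finset.prod_mul_distrib]

lemma chi_mul_self (s : Finset ι) (a : ι → ZMod 2) : chi s a * chi s a = 1 := by
  rw [chi, ← Finset.prod_mul_distrib]
  exact Finset.prod_eq_one fun p _ => sgn_mul_self _

variable [Fintype ι]

lemma sum_chi_mul_chi (a b : ι → ZMod 2) :
    ∑ s : Finset ι, chi s a * chi s b = if a = b then 2 ^ Fintype.card ι else 0 := by
  have h : ∑ s : Finset ι, chi s a * chi s b = ∏ p, (1 + sgn (a p) * sgn (b p)) := by
    rw [Finset.prod_one_add, Finset.powerset_univ]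
    exact Finset.sum_congr rfl fun s _ => by rw [chi, chi, Finset.prod_mul_distrib]
  rw [h]
  split_ifs with hab
  · subst hab
    simp only [sgn_mul_self]
    norm_num
  · obtain ⟨p, hp⟩ := Function.ne_iff.1 hab
    refine Finset.prod_eq_zero (Finset.mem_univ p) ?_
    have : ∀ z w : ZMod 2, z ≠ w → (z = 0 ↔ ¬ w = 0) := by decide
    have := this _ _ hp
    unfold sgn
    by_cases hb : b p = 0 <;> simp_all

variable [DecidableEq ι]

/-- The mean of a function of finitely many binary digits. -/
def avg (F : (ι → ZMod 2) → ℝ) : ℝ := (∑ a, F a) / 2 ^ Fintype.card ι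

lemma avg_add_right (F : (ι → ZMod 2) → ℝ) (e : ι → ZMod 2) : avg (fun a => F (a + e)) = avg F := by
  unfold avg
  rw [Fintype.sum_equiv (Equiv.addRight e) (fun a => F (a + e)) F fun _ => rfl]

lemma avg_mono {F H : (ι → ZMod 2) → ℝ} (h : ∀ a, F a ≤ H a) : avg F ≤ avg H := by
  unfold avg
  gcongr
  exact h _

lemma avg_const_mul (c : ℝ) (F : (ι → ZMod 2) → ℝ) : avg (fun a => c * F a) = c * avg F := by
  simp only [avg, ← Finset.mul_sum, mul_div_assoc]

lemma avg_sum {α : Type*} (s : Finset α) (F : α → (ι → ZMod 2) → ℝ) :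
    avg (fun a => ∑ x ∈ s, F x a) = ∑ x ∈ s, avg (F x) := by
  simp only [avg, Finset.sum_div]
  rw [Finset.sum_comm]

lemma avg_const (c : ℝ) : avg (fun _ : ι → ZMod 2 => c) = c := by
  simp [avg, ZMod.card]

/-- The Walsh coefficient of `F` at the frequency `s`. -/
def walsh (F : (ι → ZMod 2) → ℝ) (s : Finset ι) : ℝ := avg fun a => F a * chi s a

lemma walsh_inversion (F : (ι → ZMod 2) → ℝ) (a : ι → ZMod 2) :
    ∑ s, walsh F s * chi s a = F a := by
  have h : ∑ s, walsh F s * chi s a =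
      (∑ b, F b * ∑ s, chi s b * chi s a) / 2 ^ Fintype.card ι := by
    simp only [walsh, avg, div_mul_eq_mul_div, Finset.sum_mul, ← Finset.sum_div, Finset.mul_sum]
    rw [Finset.sum_comm]
    simp only [mul_assoc]
  rw [h]
  simp [sum_chi_mul_chi]

lemma avg_chi_mul_chi (s t : Finset ι) :
    avg (fun a => chi s a * chi t a) = if s = t then 1 else 0 := by
  split_ifs with h
  · subst h; simp only [chi_mul_self, avg_const]
  · -- translating by a digit in the symmetric difference changes the sign
    have key : ∀ p, ∀ s t : Finset ι, p ∈ s → p ∉ t → avg (fun a => chi s a * chi t a) = 0 := by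
      intro p s t hs ht
      have h1 := avg_add_right (fun a => chi s a * chi t a) (Pi.single p 1)
      have hsgn : ∀ q, sgn ((Pi.single p 1 : ι → ZMod 2) q) = if q = p then -1 else 1 := by
        intro q
        by_cases hq : q = p
        · subst hq; simp [sgn]
        · simp [hq, sgn]
      have h2 : chi s (Pi.single p 1) = -1 := by
        simp only [chi, hsgn, Finset.prod_ite_eq', hs, if_true]
      have h3 : chi t (Pi.single p 1) = 1 := by
        simp only [chi, hsgn, Finset.prod_ite_eq', ht, if_false]
      simp only [chi_add, h2, h3] at h1
      have h4 := avg_const_mul (-1) fun a => chi s a * chi t a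
      have h5 : (fun a => -1 * (chi s a * chi t a)) = fun a => chi s a * -1 * (chi t a * 1) := by
        funext a; ring
      rw [h5, h1] at h4
      linarith
    have : ∃ p, ¬ (p ∈ s ↔ p ∈ t) := by
      by_contra! hc
      exact h (Finset.ext hc)
    obtain ⟨p, hp⟩ := this
    by_cases hs : p ∈ s
    · exact key p s t hs fun ht => hp ⟨fun _ => ht, fun _ => hs⟩
    · have ht : p ∈ t := by by_contra ht; exact hp ⟨fun h => absurd h hs, fun h => absurd h ht⟩
      simpa [mul_comm] using key p t s ht hs

lemma avg_sq_sum_walsh (c : Finset ι → ℝ) (𝒮 : Finset (Finset ι)) :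
    avg (fun a => (∑ s ∈ 𝒮, c s * chi s a) ^ 2) = ∑ s ∈ 𝒮, c s ^ 2 := by
  have h : (fun a => (∑ s ∈ 𝒮, c s * chi s a) ^ 2) =
      fun a => ∑ s ∈ 𝒮, ∑ t ∈ 𝒮, (c s * c t) * (chi s a * chi t a) := by
    funext a
    rw [sq, Finset.sum_mul_sum]
    exact Finset.sum_congr rfl fun s _ => Finset.sum_congr rfl fun t _ => by ring
  rw [h, avg_sum]
  refine Finset.sum_congr rfl fun s hs => ?_
  rw [avg_sum]
  simp [avg_const_mul, avg_chi_mul_chi, hs, sq]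

/-- Parseval's identity. -/
lemma sum_walsh_sq (F : (ι → ZMod 2) → ℝ) : ∑ s, walsh F s ^ 2 = avg fun a => F a ^ 2 := by
  rw [← avg_sq_sum_walsh]
  simp only [walsh_inversion]

lemma walsh_add_right (F : (ι → ZMod 2) → ℝ) (e : ι → ZMod 2) (s : Finset ι) :
    walsh (fun a => F (a + e)) s = chi s e * walsh F s := by
  have h := avg_add_right (fun a => F a * (chi s a * chi s e)) e
  simp only [chi_add, mul_assoc, chi_mul_self, mul_one] at h
  rw [walsh, h, walsh, ← avg_const_mul]
  congr 1; funext a; ring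

end Walsh

section Levels
variable {d K : ℕ}

/-- For each coordinate, one more than the largest index of a digit that occurs in the frequency
`s`, or zero if there is none. -/
def scale (s : Finset (Fin d × Fin K)) (i : Fin d) : ℕ :=
  (Finset.univ.filter fun k : Fin K => (i, k) ∈ s).sup fun k => (k : ℕ) + 1

lemma lt_scale {s : Finset (Fin d × Fin K)} {i : Fin d} {k : Fin K} (h : (i, k) ∈ s) :
    (k : ℕ) < scale s i :=
  Finset.le_sup (f := fun k : Fin K => (k : ℕ) + 1) (by simpa using h)

lemma exists_mem_of_scale_pos {s : Finset (Fin d × Fin K)} {i : Fin d} (h : 0 < scale s i) :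
    ∃ k, (i, k) ∈ s ∧ (k : ℕ) + 1 = scale s i := by
  have hne : (Finset.univ.filter fun k : Fin K => (i, k) ∈ s).Nonempty := by
    by_contra hc
    rw [Finset.not_nonempty_iff_eq_empty] at hc
    simp [scale, hc] at h
  obtain ⟨k, hk, he⟩ := Finset.exists_mem_eq_sup _ hne fun k : Fin K => (k : ℕ) + 1
  exact ⟨k, by simpa using hk, he.symm⟩

lemma scale_le (s : Finset (Fin d × Fin K)) (i : Fin d) : scale s i ≤ K :=
  Finset.sup_le fun k _ => k.2

lemma scale_eq_zero_iff (s : Finset (Fin d × Fin K)) : scale s = 0 ↔ s = ∅ := by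
  constructor
  · intro h
    refine Finset.eq_empty_of_forall_notMem fun p hp => ?_
    have := lt_scale (i := p.1) (k := p.2) hp
    rw [h] at this
    exact absurd this (Nat.not_lt_zero _)
  · rintro rfl
    funext i; simp [scale]

/-- The part of `F` with the frequencies of a given scale. -/
def level (F : (Fin d × Fin K → ZMod 2) → ℝ) (κ : Fin d → ℕ) (a : Fin d × Fin K → ZMod 2) : ℝ :=
  ∑ s ∈ Finset.univ.filter fun s => scale s = κ, walsh F s * chi s a

/-- The set of all scales that occur. -/
def scales (d K : ℕ) : Finset (Fin d → ℕ) := Fintype.piFinset fun _ => Finset.range (K + 1)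

lemma sum_level (F : (Fin d × Fin K → ZMod 2) → ℝ) (a : Fin d × Fin K → ZMod 2) :
    ∑ κ ∈ scales d K, level F κ a = F a := by
  rw [← walsh_inversion F a]
  refine Finset.sum_fiberwise_of_maps_to (g := scale) (fun s _ => ?_) _
  exact Fintype.mem_piFinset.2 fun i => Finset.mem_range.2 (Nat.lt_succ_of_le (scale_le s i))

lemma level_zero (F : (Fin d × Fin K → ZMod 2) → ℝ) (a : Fin d × Fin K → ZMod 2) :
    level F 0 a = avg F := by
  have : (Finset.univ.filter fun s : Finset (Fin d × Fin K) => scale s = 0) = {∅} := by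
    ext s; simp [scale_eq_zero_iff]
  simp [level, this, walsh, chi]

/-- The function `level F κ` depends on the digits before position `κ i` in the coordinate `i`, and
it is odd under a change of the last of these digits. -/
lemma level_eq_neg (F : (Fin d × Fin K → ZMod 2) → ℝ) {κ : Fin d → ℕ} {i₀ : Fin d}
    (hi : 0 < κ i₀) {a a' : Fin d × Fin K → ZMod 2}
    (h : ∀ p : Fin d × Fin K, (p.2 : ℕ) < κ p.1 →
      a' p = a p + if p.1 = i₀ ∧ (p.2 : ℕ) = κ i₀ - 1 then 1 else 0) :
    level F κ a' = -level F κ a := by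
  rw [level, level, ← Finset.sum_neg_distrib]
  refine Finset.sum_congr rfl fun s hs => ?_
  have hs' : scale s = κ := (Finset.mem_filter.1 hs).2
  obtain ⟨k, hk, hke⟩ := exists_mem_of_scale_pos (s := s) (i := i₀) (by rw [hs']; exact hi)
  have e : chi s a' = ∏ p ∈ s, sgn (a p) * if p = (i₀, k) then -1 else 1 := by
    refine Finset.prod_congr rfl fun p hp => ?_
    rw [h p (by rw [← hs']; exact lt_scale hp), sgn_add]
    have : (p.1 = i₀ ∧ (p.2 : ℕ) = κ i₀ - 1) ↔ p = (i₀, k) := by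
      rw [Prod.ext_iff, ← hs', ← hke, Nat.add_sub_cancel, ← Fin.ext_iff]
    simp only [this]
    split_ifs <;> simp [sgn]
  rw [e, Finset.prod_mul_distrib, Finset.prod_ite_eq', if_pos hk, chi]
  ring

/-- The digit vector that flips the last digit of the scale `κ` in the coordinates in `v`. -/
def flipVec (K : ℕ) (κ : Fin d → ℕ) (v : Finset (Fin d)) : Fin d × Fin K → ZMod 2 :=
  fun p => if p.1 ∈ v ∧ (p.2 : ℕ) + 1 = κ p.1 then 1 else 0

/-- The coordinates in which a scale is nontrivial. -/
def active (κ : Fin d → ℕ) : Finset (Fin d) := Finset.univ.filter fun i => 0 < κ i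

/-- The mixed difference of `F` in the last digits of the scale `κ`. -/
def digitDiff (F : (Fin d × Fin K → ZMod 2) → ℝ) (κ : Fin d → ℕ) (a : Fin d × Fin K → ZMod 2) : ℝ :=
  ((1 : ℝ) / 2) ^ (active κ).card *
    ∑ v ∈ (active κ).powerset, (-1) ^ v.card * F (a + flipVec K κ v)

lemma chi_flipVec {s : Finset (Fin d × Fin K)} {v : Finset (Fin d)} (hv : v ⊆ active (scale s)) :
    chi s (flipVec K (scale s) v) = (-1) ^ v.card := by
  have h : chi s (flipVec K (scale s) v) =
      ∏ p ∈ s, if p.1 ∈ v ∧ (p.2 : ℕ) + 1 = scale s p.1 then (-1 : ℝ) else 1 := by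
    refine Finset.prod_congr rfl fun p _ => ?_
    unfold flipVec
    split_ifs <;> simp [sgn]
  rw [h, Finset.prod_ite, Finset.prod_const_one, mul_one, Finset.prod_const]
  congr 1
  refine Finset.card_nbij Prod.fst (fun p hp => (Finset.mem_filter.1 hp).2.1) ?_ ?_
  · intro p hp q hq he
    have h1 := (Finset.mem_filter.1 hp).2.2
    have h2 := (Finset.mem_filter.1 hq).2.2
    refine Prod.ext he (Fin.ext ?_)
    rw [he] at h1; omega
  · intro i hi
    obtain ⟨k, hk, hke⟩ := exists_mem_of_scale_pos (s := s) (i := i)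
      (Finset.mem_filter.1 (hv hi)).2
    exact ⟨(i, k), by simpa [hk, hke] using hi, rfl⟩

/-- At the frequencies of scale `κ`, the function and its mixed difference in the last digits of `κ`
have the same Walsh coefficients; Parseval's identity turns this into a bound. -/
lemma avg_level_sq_le (F : (Fin d × Fin K → ZMod 2) → ℝ) (κ : Fin d → ℕ) :
    avg (fun a => level F κ a ^ 2) ≤ avg fun a => digitDiff F κ a ^ 2 := by
  unfold level
  rw [avg_sq_sum_walsh, ← sum_walsh_sq]
  have h : ∀ s ∈ Finset.univ.filter fun s : Finset (Fin d × Fin K) => scale s = κ,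
      walsh F s ^ 2 = walsh (digitDiff F κ) s ^ 2 := by
    intro s hs
    obtain rfl : scale s = κ := (Finset.mem_filter.1 hs).2
    congr 1
    have e : walsh (digitDiff F (scale s)) s = (1 / 2 : ℝ) ^ (active (scale s)).card *
        ∑ v ∈ (active (scale s)).powerset,
          (-1) ^ v.card * walsh (fun a => F (a + flipVec K (scale s) v)) s := by
      simp only [walsh, ← avg_const_mul, ← avg_sum]
      congr 1; funext a
      simp only [digitDiff, Finset.sum_mul, Finset.mul_sum, mul_assoc]
    have e2 : ∀ v ∈ (active (scale s)).powerset,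
        (-1) ^ v.card * walsh (fun a => F (a + flipVec K (scale s) v)) s = walsh F s := by
      intro v hv
      rw [walsh_add_right, chi_flipVec (Finset.mem_powerset.1 hv), ← mul_assoc, ← mul_pow]
      norm_num
    rw [e, Finset.sum_congr rfl e2, Finset.sum_const, Finset.card_powerset, nsmul_eq_mul,
      ← mul_assoc, Nat.cast_pow, ← mul_pow]
    norm_num
  rw [Finset.sum_congr rfl h]
  exact Finset.sum_le_sum_of_subset_of_nonneg (Finset.subset_univ _) fun _ _ _ => sq_nonneg _

end Levels

section Scrambling
variable {d K : ℕ} (S : SobolData d)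

/-- The first `K` digits of the coordinates of a scrambled point. -/
def SobolData.scrDigits (K : ℕ) (c : Fin d × List (ZMod 2) → ZMod 2) (n : ℕ) :
    Fin d × Fin K → ZMod 2 :=
  fun p => scramble (fun q => c (p.1, q)) (S.digit n p.1) p.2

lemma measurable_scrDigits (n : ℕ) : Measurable fun c => S.scrDigits K c n := by
  refine measurable_pi_lambda _ fun p => ?_
  have h : Measurable fun z : ZMod 2 => S.digit n p.1 p.2 + z := measurable_of_countable _
  exact h.comp (measurable_pi_apply _)

lemma integrable_scrDigits₂ (n n' : ℕ)
    (H : (Fin d × Fin K → ZMod 2) × (Fin d × Fin K → ZMod 2) → ℝ) :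
    Integrable (fun c => H (S.scrDigits K c n, S.scrDigits K c n')) (innerLaw d) := by
  have hm : Measurable fun c => H (S.scrDigits K c n, S.scrDigits K c n') :=
    (measurable_of_countable H).comp
      ((measurable_scrDigits S n).prodMk (measurable_scrDigits S n'))
  refine Integrable.of_bound hm.aestronglyMeasurable (∑ p, |H p|) (ae_of_all _ fun c => ?_)
  exact Finset.single_le_sum (f := fun p => |H p|) (fun _ _ => abs_nonneg _) (Finset.mem_univ _)

lemma integrable_scrDigits (n : ℕ) (H : (Fin d × Fin K → ZMod 2) → ℝ) :
    Integrable (fun c => H (S.scrDigits K c n)) (innerLaw d) :=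
  integrable_scrDigits₂ S n n fun p => H p.1

lemma integral_coins_add (e : Fin d × List (ZMod 2) → ZMod 2)
    {H : (Fin d × List (ZMod 2) → ZMod 2) → ℝ} (hH : AEStronglyMeasurable H (innerLaw d)) :
    ∫ c, H (fun q => c q + e q) ∂innerLaw d = ∫ c, H c ∂innerLaw d :=
  (measurePreserving_coins_add e).integral_comp_of_aestronglyMeasurable hH

/-- The digits of a single scrambled point are uniformly distributed. -/
lemma integral_scrDigits (n : ℕ) (H : (Fin d × Fin K → ZMod 2) → ℝ) :
    ∫ c, H (S.scrDigits K c n) ∂innerLaw d = avg H := by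
  have h1 : ∀ g : Fin d × Fin K → ZMod 2, ∫ c, H (S.scrDigits K c n + g) ∂innerLaw d =
      ∫ c, H (S.scrDigits K c n) ∂innerLaw d := by
    intro g
    rw [← integral_coins_add (fun q => if h : q.2.length < K then g (q.1, ⟨_, h⟩) else 0)
      (integrable_scrDigits S n H).aestronglyMeasurable]
    congr 1; funext c; congr 1; funext p
    simp [SobolData.scrDigits, scramble, add_assoc]
  have h2 : ∫ c, avg (fun g => H (S.scrDigits K c n + g)) ∂innerLaw d =
      avg fun g => ∫ c, H (S.scrDigits K c n + g) ∂innerLaw d := by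
    unfold avg
    rw [integral_div, integral_finsetSum _ fun g _ => integrable_scrDigits S n fun a => H (a + g)]
  simp only [h1, avg_const] at h2
  rw [← h2]
  have h3 : ∀ b, avg (fun g => H (b + g)) = avg H := fun b => by
    simpa only [add_comm] using avg_add_right H b
  simp [h3]

/-- Two scrambled points are uncorrelated at the scale `κ` unless, in each coordinate, all but the
last digit of this scale agree: otherwise there is a coin that affects the last digit of only one of
them. -/
lemma integral_level_mul_level (F : (Fin d × Fin K → ZMod 2) → ℝ) (κ : Fin d → ℕ) {n n' : ℕ}
    {j : Fin d} {k : ℕ} (hk : k < κ j - 1) (hne : S.digit n j k ≠ S.digit n' j k) :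
    ∫ c, level F κ (S.scrDigits K c n) * level F κ (S.scrDigits K c n') ∂innerLaw d = 0 := by
  set l := (List.range (κ j - 1)).map (S.digit n j) with hl
  have hl' : (List.range (κ j - 1)).map (S.digit n' j) ≠ l := by
    intro h
    exact hne ((List.map_inj_left.1 h) k (List.mem_range.2 hk)).symm
  have h1 := integral_coins_add (fun q => if q = (j, l) then 1 else 0)
    (integrable_scrDigits₂ S n n' fun p : (Fin d × Fin K → ZMod 2) × (Fin d × Fin K → ZMod 2) =>
      level F κ p.1 * level F κ p.2).aestronglyMeasurable
  have hlen : ∀ (i : Fin d) (r : ℕ) (n : ℕ), (i, (List.range r).map (S.digit n i)) = (j, l) →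
      i = j ∧ r = κ j - 1 := by
    intro i r n h
    rw [Prod.mk.injEq] at h
    have := congrArg List.length h.2
    exact ⟨h.1, by simpa [hl] using this⟩
  have e1 : ∀ c, level F κ (S.scrDigits K (fun q => c q + if q = (j, l) then 1 else 0) n) =
      -level F κ (S.scrDigits K c n) := by
    intro c
    refine level_eq_neg F (i₀ := j) (by omega) fun p _ => ?_
    have : ((p.1, (List.range (p.2 : ℕ)).map (S.digit n p.1)) = (j, l)) ↔
        (p.1 = j ∧ (p.2 : ℕ) = κ j - 1) := by
      refine ⟨hlen _ _ _, fun h => ?_⟩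
      rw [h.1, h.2]
    simp only [SobolData.scrDigits, scramble, this, add_assoc]
  have e2 : ∀ c, S.scrDigits K (fun q => c q + if q = (j, l) then 1 else 0) n' =
      S.scrDigits K c n' := by
    intro c
    funext p
    have : (p.1, (List.range (p.2 : ℕ)).map (S.digit n' p.1)) ≠ (j, l) := by
      intro h
      obtain ⟨h1, h2⟩ := hlen _ _ _ h
      rw [Prod.mk.injEq, h1, h2] at h
      exact hl' h.2
    simp only [SobolData.scrDigits, scramble, this, if_false, add_zero]
  simp only [e1, e2, neg_mul, integral_neg] at h1
  linarith

lemma add_self_zmod_two (z : ZMod 2) : z + z = 0 := by revert z; decide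

lemma sum_range_xor {α : Type*} [AddCommMonoid α] {m z : ℕ} (hz : z < 2 ^ m) (h : ℕ → α) :
    ∑ n ∈ Finset.range (2 ^ m), h (n ^^^ z) = ∑ n ∈ Finset.range (2 ^ m), h n := by
  have hm : ∀ n ∈ Finset.range (2 ^ m), n ^^^ z ∈ Finset.range (2 ^ m) := fun n hn =>
    Finset.mem_range.2 (Nat.xor_lt_two_pow (Finset.mem_range.1 hn) hz)
  exact Finset.sum_nbij' (fun n => n ^^^ z) (fun n => n ^^^ z) hm hm
    (fun n _ => by simp) (fun n _ => by simp) fun n _ => rfl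

/-- Exactness at coarse scales: the net property provides a permutation of the indices that
flips the last digit of the scale in one coordinate. -/
lemma sum_level_eq_zero (F : (Fin d × Fin K → ZMod 2) → ℝ) {κ : Fin d → ℕ} (hκ : κ ≠ 0) {m : ℕ}
    (hm : ∑ j, κ j + S.degSum ≤ m) (c : Fin d × List (ZMod 2) → ZMod 2) :
    ∑ n ∈ Finset.range (2 ^ m), level F κ (S.scrDigits K c n) = 0 := by
  obtain ⟨i, hi⟩ := Function.ne_iff.1 hκ
  have hi0 : 0 < κ i := Nat.pos_of_ne_zero hi
  obtain ⟨z, hz, hdig⟩ := S.exists_digit_eq m κ hm i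
  have h1 := sum_range_xor hz fun n => level F κ (S.scrDigits K c n)
  have h2 : ∀ n, level F κ (S.scrDigits K c (n ^^^ z)) = -level F κ (S.scrDigits K c n) := by
    intro n
    refine level_eq_neg F hi0 fun p hp => ?_
    have hpre : (List.range (p.2 : ℕ)).map (S.digit (n ^^^ z) p.1) =
        (List.range (p.2 : ℕ)).map (S.digit n p.1) := by
      refine List.map_congr_left fun k hk => ?_
      have hk' := List.mem_range.1 hk
      rw [S.digit_xor, hdig p.1 k (hk'.trans hp), if_neg, add_zero]
      rintro ⟨h1, h2⟩
      rw [h1] at hp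
      omega
    simp only [SobolData.scrDigits, scramble, hpre, S.digit_xor, hdig _ _ hp]
    ring
  simp only [h2, Finset.sum_neg_distrib] at h1
  linarith

/-- The mean square of a fine scale: only pairs of points with the same digits before the last ones of
the scale are correlated, and each point belongs to a bounded number of such pairs. -/
lemma integral_sq_sum_level_le (F : (Fin d × Fin K → ZMod 2) → ℝ) (κ : Fin d → ℕ) {m : ℕ}
    (hm : m < ∑ j, κ j + S.degSum) :
    ∫ c, (∑ n ∈ Finset.range (2 ^ m), level F κ (S.scrDigits K c n)) ^ 2 ∂innerLaw d ≤
      2 ^ m * 2 ^ (2 * S.degSum) * avg fun a => level F κ a ^ 2 := by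
  set b := level F κ with hb
  set E := avg fun a => b a ^ 2 with hE
  have hE0 : 0 ≤ E := by
    have := avg_mono (F := fun _ : Fin d × Fin K → ZMod 2 => 0) fun a => sq_nonneg (b a)
    rwa [avg_const] at this
  have hint : ∀ n n', Integrable (fun c => b (S.scrDigits K c n) * b (S.scrDigits K c n'))
      (innerLaw d) := fun n n' => integrable_scrDigits₂ S n n' fun p => b p.1 * b p.2
  have hpair : ∀ n n', ∫ c, b (S.scrDigits K c n) * b (S.scrDigits K c n') ∂innerLaw d ≤
      if ∀ j, ∀ k < κ j - 1, S.digit (n' ^^^ n) j k = 0 then E else 0 := by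
    intro n n'
    split_ifs with h
    · have h2 : ∫ c, b (S.scrDigits K c n) * b (S.scrDigits K c n') ∂innerLaw d ≤
          ∫ c, (b (S.scrDigits K c n) ^ 2 + b (S.scrDigits K c n') ^ 2) / 2 ∂innerLaw d := by
        refine integral_mono (hint n n') (integrable_scrDigits₂ S n n'
          fun p => (b p.1 ^ 2 + b p.2 ^ 2) / 2) fun c => ?_
        have := two_mul_le_add_sq (b (S.scrDigits K c n)) (b (S.scrDigits K c n'))
        show _ ≤ _
        linarith
      refine h2.trans_eq ?_
      rw [integral_div, integral_add (integrable_scrDigits S n fun a => b a ^ 2)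
        (integrable_scrDigits S n' fun a => b a ^ 2), integral_scrDigits S n fun a => b a ^ 2,
        integral_scrDigits S n' fun a => b a ^ 2]
      ring
    · push Not at h
      obtain ⟨j, k, hk, hne⟩ := h
      refine (integral_level_mul_level S F κ hk fun he => hne ?_).le
      rw [S.digit_xor, he, add_self_zmod_two]
  have hexp : ∫ c, (∑ n ∈ Finset.range (2 ^ m), b (S.scrDigits K c n)) ^ 2 ∂innerLaw d =
      ∑ n ∈ Finset.range (2 ^ m), ∑ n' ∈ Finset.range (2 ^ m),
        ∫ c, b (S.scrDigits K c n) * b (S.scrDigits K c n') ∂innerLaw d := by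
    simp only [sq, Finset.sum_mul_sum]
    rw [integral_finsetSum _ fun n _ => integrable_finsetSum _ fun n' _ => hint n n']
    exact Finset.sum_congr rfl fun n _ => integral_finsetSum _ fun n' _ => hint n n'
  rw [hexp]
  have hrow : ∀ n ∈ Finset.range (2 ^ m), ∑ n' ∈ Finset.range (2 ^ m),
      ∫ c, b (S.scrDigits K c n) * b (S.scrDigits K c n') ∂innerLaw d ≤
        2 ^ (2 * S.degSum) * E := by
    intro n hn
    refine (Finset.sum_le_sum fun n' _ => hpair n n').trans ?_
    rw [sum_range_xor (Finset.mem_range.1 hn)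
      fun r => if ∀ j, ∀ k < κ j - 1, S.digit r j k = 0 then E else 0,
      ← Finset.sum_filter, Finset.sum_const, nsmul_eq_mul]
    refine mul_le_mul_of_nonneg_right ?_ hE0
    exact_mod_cast S.card_digit_eq_zero_le m κ hm
  refine (Finset.sum_le_sum hrow).trans_eq ?_
  simp [mul_assoc]

end Scrambling

/-! ### Walsh components of functions with boundary growth -/

lemma BoundaryGrowth.aestronglyMeasurable {d : ℕ} {φ : (Fin d → ℝ) → ℝ} {B a : ℝ}
    (h : BoundaryGrowth φ B fun _ => a) (ha : 0 ≤ a) :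
    AEStronglyMeasurable φ (volume.restrict (cube d)) := by
  have hopen : IsOpen (openCube d) := by
    rw [openCube_eq]; exact isOpen_set_pi finite_univ fun _ _ => isOpen_Ioo
  have hae : openCube d =ᵐ[volume] cube d := by
    rw [openCube_eq, cube_eq, pi_univ_Icc]
    exact Measure.univ_pi_Ioo_ae_eq_Icc
  rw [← Measure.restrict_congr_set hae]
  exact ContinuousOn.aestronglyMeasurable
    (fun y hy => (h.tendsto ha hy).mono_left nhdsWithin_le_nhds) hopen.measurableSet

lemma BoundaryGrowth.integrable {d : ℕ} {φ : (Fin d → ℝ) → ℝ} {B a : ℝ}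
    (h : BoundaryGrowth φ B fun _ => a) (ha : 0 ≤ a) (ha1 : a < 1) :
    Integrable φ (volume.restrict (cube d)) := by
  refine Integrable.mono' ((integrable_prod_bdist ha1).const_mul B)
    (h.aestronglyMeasurable ha) ?_
  filter_upwards [ae_mem_openCube d] with y hy
  exact h.abs_le hy

lemma eLpNorm_two_sq {Ω : Type*} [MeasurableSpace Ω] {μ : Measure Ω} {f : Ω → ℝ}
    (hf2 : Integrable (fun ω => f ω ^ 2) μ) :
    eLpNorm f 2 μ ^ 2 = ENNReal.ofReal (∫ ω, f ω ^ 2 ∂μ) := by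
  have h1 := eLpNorm_nnreal_pow_eq_lintegral (f := f) (μ := μ) (p := 2) two_ne_zero
  simp only [ENNReal.coe_ofNat, NNReal.coe_ofNat, ENNReal.rpow_two] at h1
  rw [h1, ofReal_integral_eq_lintegral_ofReal hf2 (ae_of_all _ fun ω => sq_nonneg _)]
  refine lintegral_congr fun ω => ?_
  rw [← sq_abs, ENNReal.ofReal_pow (abs_nonneg _), Real.enorm_eq_ofReal_abs]

lemma eLpNorm_two_le {Ω : Type*} [MeasurableSpace Ω] {μ : Measure Ω} {f : Ω → ℝ} {C : ℝ}
    (hC : 0 ≤ C) (hf2 : Integrable (fun ω => f ω ^ 2) μ)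
    (h : ∫ ω, f ω ^ 2 ∂μ ≤ C ^ 2) : eLpNorm f 2 μ ≤ ENNReal.ofReal C := by
  rw [← ENNReal.pow_le_pow_left_iff two_ne_zero, eLpNorm_two_sq hf2, ← ENNReal.ofReal_pow hC]
  exact ENNReal.ofReal_le_ofReal h

section Center
variable {d K : ℕ}

/-- The centre of the dyadic box whose points have the given first digits. -/
def center (a : Fin d × Fin K → ZMod 2) : Fin d → ℝ :=
  fun i => ∑ k : Fin K, ((a (i, k)).val : ℝ) / 2 ^ ((k : ℕ) + 1) + 1 / 2 ^ (K + 1)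

lemma val_le_one (z : ZMod 2) : (z.val : ℝ) ≤ 1 := by
  exact_mod_cast Nat.le_of_lt_succ (ZMod.val_lt z)

lemma le_bdist_center (a : Fin d × Fin K → ZMod 2) (i : Fin d) :
    1 / 2 ^ (K + 1) ≤ bdist (center a i) := by
  have h0 : 0 ≤ ∑ k : Fin K, ((a (i, k)).val : ℝ) / 2 ^ ((k : ℕ) + 1) :=
    Finset.sum_nonneg fun k _ => by positivity
  have h1 : ∑ k : Fin K, ((a (i, k)).val : ℝ) / 2 ^ ((k : ℕ) + 1) ≤ 1 - 1 / 2 ^ K := by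
    have hgeo : ∀ K : ℕ, ∑ k ∈ Finset.range K, (1 : ℝ) / 2 ^ (k + 1) = 1 - 1 / 2 ^ K := by
      intro K
      induction K with
      | zero => simp
      | succ K ih => rw [Finset.sum_range_succ, ih, pow_succ]; field_simp; ring
    rw [← hgeo K, ← Fin.sum_univ_eq_sum_range fun k => (1 : ℝ) / 2 ^ (k + 1)]
    refine Finset.sum_le_sum fun k _ => ?_
    have := val_le_one (a (i, k))
    gcongr
  have h2 : (1 : ℝ) / 2 ^ K = 1 / 2 ^ (K + 1) + 1 / 2 ^ (K + 1) := by
    rw [pow_succ]; field_simp; norm_num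
  unfold bdist center
  refine le_min ?_ ?_ <;> linarith

lemma center_mem_openCube (a : Fin d × Fin K → ZMod 2) : center a ∈ openCube d := by
  intro i
  have h := (by positivity : (0 : ℝ) < 1 / 2 ^ (K + 1)).trans_le (le_bdist_center a i)
  unfold bdist at h
  rw [lt_min_iff] at h
  exact ⟨h.1, by linarith [h.2]⟩

lemma abs_scrambledPoint_sub_center_le (S : SobolData d) (K : ℕ)
    (c : Fin d × List (ZMod 2) → ZMod 2) (n : ℕ) (i : Fin d) :
    |S.scrambledPoint c n i - center (S.scrDigits K c n) i| ≤ 1 / 2 ^ (K + 1) := by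
  have h : S.scrambledPoint c n i - center (S.scrDigits K c n) i =
      (ofBits (fun k => scramble (fun p => c (i, p)) (S.digit n i) (k + K)) - 1 / 2) / 2 ^ K := by
    rw [SobolData.scrambledPoint, ofBits_eq_sum_add _ K, center,
      ← Fin.sum_univ_eq_sum_range
        (fun k => ((scramble (fun p => c (i, p)) (S.digit n i) k).val : ℝ) / 2 ^ (k + 1))]
    simp only [SobolData.scrDigits]
    rw [pow_succ]; field_simp; ring
  have h0 := ofBits_nonneg fun k => scramble (fun p => c (i, p)) (S.digit n i) (k + K)
  have h1 := ofBits_le_one fun k => scramble (fun p => c (i, p)) (S.digit n i) (k + K)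
  rw [h, abs_div, abs_of_pos (by positivity : (0 : ℝ) < 2 ^ K), pow_succ, mul_comm, ← div_div]
  gcongr
  rw [abs_le]; constructor <;> linarith

lemma tendsto_center (S : SobolData d) (c : Fin d × List (ZMod 2) → ZMod 2) (n : ℕ) :
    Tendsto (fun K => center (S.scrDigits K c n)) atTop (𝓝 (S.scrambledPoint c n)) := by
  rw [tendsto_pi_nhds]
  intro i
  have h0 : Tendsto (fun K : ℕ => (1 : ℝ) / 2 ^ (K + 1)) atTop (𝓝 0) := by
    have := (tendsto_add_atTop_iff_nat 1).2
      (tendsto_pow_atTop_nhds_zero_of_lt_one (r := (1 / 2 : ℝ)) (by norm_num) (by norm_num))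
    simpa [div_pow] using this
  rw [tendsto_iff_norm_sub_tendsto_zero]
  refine squeeze_zero (fun _ => norm_nonneg _) (fun K => ?_) h0
  rw [norm_sub_rev]
  exact abs_scrambledPoint_sub_center_le S K c n i

/-- The centre of a dyadic box is at least half as far from the boundary as any other point
of the box. -/
lemma prod_bdist_center_le (S : SobolData d) (K : ℕ) (c : Fin d × List (ZMod 2) → ZMod 2) (n : ℕ)
    {q : ℝ} (hq : 0 ≤ q) (hy : S.scrambledPoint c n ∈ openCube d) :
    ∏ i, bdist (center (S.scrDigits K c n) i) ^ (-q) ≤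
      (2 ^ q) ^ d * ∏ i, bdist (S.scrambledPoint c n i) ^ (-q) := by
  have hconst : ((2 : ℝ) ^ q) ^ d = ∏ _i : Fin d, (2 : ℝ) ^ q := by simp
  rw [hconst, ← Finset.prod_mul_distrib]
  refine Finset.prod_le_prod (fun i _ => (Real.rpow_pos_of_pos
    (bdist_pos (center_mem_openCube _ i)) _).le) fun i _ => ?_
  have h1 := abs_scrambledPoint_sub_center_le S K c n i
  have h2 := le_bdist_center (S.scrDigits K c n) i
  have h3 : bdist (S.scrambledPoint c n i) / 2 ≤ bdist (center (S.scrDigits K c n) i) := by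
    have h4 : bdist (S.scrambledPoint c n i) - bdist (center (S.scrDigits K c n) i) ≤
        1 / 2 ^ (K + 1) := by
      rw [abs_le] at h1
      unfold bdist
      generalize S.scrambledPoint c n i = y at *
      generalize center (S.scrDigits K c n) i = z at *
      generalize (1 : ℝ) / 2 ^ (K + 1) = t at *
      grind
    linarith
  have hpos := bdist_pos (hy i)
  refine (Real.rpow_le_rpow_of_nonpos (half_pos hpos) h3 (by linarith)).trans_eq ?_
  rw [Real.div_rpow hpos.le two_pos.le, Real.rpow_neg two_pos.le, div_inv_eq_mul, mul_comm]

lemma abs_center_sub_le (a : Fin d × Fin K → ZMod 2) (κ : Fin d → ℕ) (v : Finset (Fin d))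
    (i : Fin d) : |center a i - center (a + flipVec K κ v) i| ≤ 1 / 2 ^ κ i := by
  have h : center a i - center (a + flipVec K κ v) i = ∑ k : Fin K,
      (((a (i, k)).val : ℝ) - ((a + flipVec K κ v) (i, k)).val) / 2 ^ ((k : ℕ) + 1) := by
    simp only [center, add_sub_add_right_eq_sub, sub_div, Finset.sum_sub_distrib]
  have hterm : ∀ k : Fin K,
      |(((a (i, k)).val : ℝ) - ((a + flipVec K κ v) (i, k)).val) / 2 ^ ((k : ℕ) + 1)| ≤
        if (k : ℕ) + 1 = κ i then 1 / 2 ^ κ i else 0 := by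
    intro k
    split_ifs with hk
    · rw [hk, abs_div, abs_of_pos (by positivity : (0 : ℝ) < 2 ^ κ i)]
      gcongr
      have := val_le_one (a (i, k))
      have := val_le_one ((a + flipVec K κ v) (i, k))
      rw [abs_le]; constructor <;> linarith [Nat.cast_nonneg (α := ℝ) (a (i, k)).val,
        Nat.cast_nonneg (α := ℝ) ((a + flipVec K κ v) (i, k)).val]
    · simp [flipVec, hk]
  rw [h]
  refine (Finset.abs_sum_le_sum_abs _ _).trans ((Finset.sum_le_sum fun k _ => hterm k).trans ?_)
  by_cases hex : ∃ k₀ : Fin K, (k₀ : ℕ) + 1 = κ i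
  · obtain ⟨k₀, hk₀⟩ := hex
    have : ∀ k : Fin K, ((k : ℕ) + 1 = κ i) ↔ k = k₀ := fun k => by
      rw [Fin.ext_iff]; omega
    simp [this]
  · push Not at hex
    simp [hex]

lemma center_add_flipVec (a : Fin d × Fin K → ZMod 2) (κ : Fin d → ℕ) {u v : Finset (Fin d)}
    (hv : v ⊆ u) : center (a + flipVec K κ v) =
      v.piecewise (center (a + flipVec K κ u)) (center a) := by
  funext i
  by_cases hi : i ∈ v
  · simp [hi, center, flipVec, hv hi]
  · simp [hi, center, flipVec]

/-- The growth weight at the centre of a dyadic box. -/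
def weight (q : ℝ) (a : Fin d × Fin K → ZMod 2) : ℝ := ∏ i, bdist (center a i) ^ (-q)

/-- A flip of the digit at position `κ i` moves the centre by at most `2 ^ (-κ i)`, so that each
coordinate contributes a factor `2 ^ (-σ κ i)`. -/
lemma abs_digitDiff_le {φ : (Fin d → ℝ) → ℝ} {B b σ : ℝ}
    (h : BoundaryGrowth φ B fun _ => b) (hb : 0 ≤ b) (hσ : σ ∈ Icc (0 : ℝ) 1) (κ : Fin d → ℕ)
    (a : Fin d × Fin K → ZMod 2) :
    |digitDiff (fun a => φ (center a)) κ a| ≤ B * 2 ^ (-(σ * ∑ i, (κ i : ℝ))) *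
      ∑ v ∈ (active κ).powerset, weight (b + σ) (a + flipVec K κ v) := by
  set u := active κ with hu
  have hx := center_mem_openCube a
  have hx' := center_mem_openCube (a + flipVec K κ u)
  have e1 : digitDiff (fun a => φ (center a)) κ a = ((1 : ℝ) / 2) ^ u.card *
      altDiff φ u (center a) (center (a + flipVec K κ u)) := by
    rw [digitDiff, altDiff]
    congr 1
    refine Finset.sum_congr rfl fun v hv => ?_
    rw [center_add_flipVec a κ (Finset.mem_powerset.1 hv)]
  have e2 : ∑ v ∈ u.powerset, weight (b + σ) (a + flipVec K κ v) = ∑ v ∈ u.powerset,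
      ∏ i, bdist (v.piecewise (center (a + flipVec K κ u)) (center a) i) ^ (-(b + σ)) := by
    refine Finset.sum_congr rfl fun v hv => ?_
    rw [weight, center_add_flipVec a κ (Finset.mem_powerset.1 hv)]
  have hW : 0 ≤ ∑ v ∈ u.powerset, weight (b + σ) (a + flipVec K κ v) :=
    Finset.sum_nonneg fun v _ => (prod_bdist_rpow_pos (center_mem_openCube _) _ _).le
  have key := h.abs_altDiff_le hb hσ u hx hx'
  rw [← e2] at key
  rw [e1, abs_mul, abs_of_nonneg (by positivity)]
  have hprod : ((1 : ℝ) / 2) ^ u.card *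
      ∏ i ∈ u, (2 * |center a i - center (a + flipVec K κ u) i| ^ σ) ≤
        2 ^ (-(σ * ∑ i, (κ i : ℝ))) := by
    have e3 : (2 : ℝ) ^ (-(σ * ∑ i, (κ i : ℝ))) = ∏ i ∈ u, ((1 : ℝ) / 2 ^ κ i) ^ σ := by
      have h1 : ∑ i, (κ i : ℝ) = ∑ i ∈ u, (κ i : ℝ) := by
        refine (Finset.sum_subset (Finset.subset_univ u) fun i _ hi => ?_).symm
        have : ¬ 0 < κ i := fun h => hi (Finset.mem_filter.2 ⟨Finset.mem_univ i, h⟩)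
        simp only [not_lt, Nat.le_zero] at this
        simp [this]
      rw [h1, ← neg_mul, Finset.mul_sum, Real.rpow_sum_of_pos two_pos]
      refine Finset.prod_congr rfl fun i _ => ?_
      rw [one_div, ← Real.rpow_natCast, ← Real.rpow_neg two_pos.le, ← Real.rpow_mul two_pos.le]
      congr 1; ring
    rw [e3, Finset.prod_mul_distrib, Finset.prod_const, ← mul_assoc, ← mul_pow]
    norm_num
    refine Finset.prod_le_prod (fun i _ => by positivity) fun i _ => ?_
    refine Real.rpow_le_rpow (abs_nonneg _) ?_ hσ.1
    simpa using abs_center_sub_le a κ u i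
  calc _ ≤ ((1 : ℝ) / 2) ^ u.card *
        (B * (∏ i ∈ u, (2 * |center a i - center (a + flipVec K κ u) i| ^ σ)) *
          ∑ v ∈ u.powerset, weight (b + σ) (a + flipVec K κ v)) := by gcongr
    _ = B * (((1 : ℝ) / 2) ^ u.card *
          (∏ i ∈ u, (2 * |center a i - center (a + flipVec K κ u) i| ^ σ))) *
          ∑ v ∈ u.powerset, weight (b + σ) (a + flipVec K κ v) := by ring
    _ ≤ _ := by
      have := h.const_nonneg
      gcongr

lemma avg_digitDiff_sq_le {φ : (Fin d → ℝ) → ℝ} {B b σ : ℝ}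
    (h : BoundaryGrowth φ B fun _ => b) (hb : 0 ≤ b) (hσ : σ ∈ Icc (0 : ℝ) 1) (κ : Fin d → ℕ) :
    avg (fun a : Fin d × Fin K → ZMod 2 => digitDiff (fun a => φ (center a)) κ a ^ 2) ≤
      (B * 2 ^ (-(σ * ∑ i, (κ i : ℝ)))) ^ 2 * ((2 ^ d) ^ 2 *
        avg fun a : Fin d × Fin K → ZMod 2 => weight (b + σ) a ^ 2) := by
  have hcard : ((active κ).powerset.card : ℝ) ≤ 2 ^ d := by
    rw [Finset.card_powerset]
    push_cast
    exact pow_le_pow_right₀ one_le_two ((Finset.card_le_univ _).trans_eq (Fintype.card_fin d))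
  have hpt : ∀ a : Fin d × Fin K → ZMod 2, digitDiff (fun a => φ (center a)) κ a ^ 2 ≤
      (B * 2 ^ (-(σ * ∑ i, (κ i : ℝ)))) ^ 2 * (2 ^ d *
        ∑ v ∈ (active κ).powerset, weight (b + σ) (a + flipVec K κ v) ^ 2) := by
    intro a
    rw [← sq_abs]
    refine (pow_le_pow_left₀ (abs_nonneg _) (abs_digitDiff_le h hb hσ κ a) 2).trans ?_
    rw [mul_pow]
    gcongr
    refine sq_sum_le_card_mul_sum_sq.trans ?_
    gcongr
  refine (avg_mono hpt).trans ?_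
  rw [avg_const_mul, avg_const_mul, avg_sum]
  have : ∀ v ∈ (active κ).powerset, avg (fun a : Fin d × Fin K → ZMod 2 =>
      weight (b + σ) (a + flipVec K κ v) ^ 2) =
        avg fun a : Fin d × Fin K → ZMod 2 => weight (b + σ) a ^ 2 := fun v _ =>
    avg_add_right (fun a => weight (b + σ) a ^ 2) _
  have hnn : 0 ≤ avg fun a : Fin d × Fin K → ZMod 2 => weight (b + σ) a ^ 2 := by
    have := avg_mono (F := fun _ : Fin d × Fin K → ZMod 2 => 0)
      fun a => sq_nonneg (weight (b + σ) a)
    rwa [avg_const] at this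
  rw [Finset.sum_congr rfl this, Finset.sum_const, nsmul_eq_mul, sq ((2 : ℝ) ^ d), mul_assoc]
  gcongr

/-- The weights are square summable uniformly in the number of digits: they are dominated by their
analogue at a scrambled point, which is uniformly distributed on the cube. -/
lemma avg_weight_sq_le (S : SobolData d) {q : ℝ} (hq0 : 0 ≤ q) (hq : q < 1 / 2) :
    avg (fun a : Fin d × Fin K → ZMod 2 => weight q a ^ 2) ≤
      (2 ^ (2 * q)) ^ d * ∫ y in cube d, ∏ i, bdist (y i) ^ (-(2 * q)) := by
  have hint : Integrable (fun y : Fin d → ℝ => ∏ i, bdist (y i) ^ (-(2 * q)))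
    (volume.restrict (cube d)) := integrable_prod_bdist (by linarith)
  have hmp := measurePreserving_scrambledPoint S 0
  rw [← hmp.integral_comp_of_aestronglyMeasurable hint.aestronglyMeasurable,
    ← integral_const_mul, ← integral_scrDigits S 0]
  refine integral_mono_ae (integrable_scrDigits S 0 fun a => weight q a ^ 2)
    ((hmp.integrable_comp_of_integrable hint).const_mul _) ?_
  filter_upwards [hmp.quasiMeasurePreserving.ae (ae_mem_openCube d)] with c hc
  refine (le_of_eq ?_).trans (prod_bdist_center_le S K c 0 (by linarith) hc)
  rw [weight, ← Finset.prod_pow]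
  refine Finset.prod_congr rfl fun i _ => ?_
  rw [← Real.rpow_natCast, ← Real.rpow_mul (bdist_pos (center_mem_openCube _ i)).le]
  congr 1; push_cast; ring

end Center

/-! ### The mean square error of scrambled means -/

section MeanSquare

variable {d K : ℕ} (S : SobolData d)

/-- The sum over the scales factorizes into geometric series. -/
lemma sum_scales_le {η : ℝ} (hη : 0 < η) (d K : ℕ) :
    ∑ κ ∈ scales d K, (2 : ℝ) ^ (-(η * ∑ i, (κ i : ℝ))) ≤ (1 - 2 ^ (-η))⁻¹ ^ d := by
  have hx0 : (0 : ℝ) < 2 ^ (-η) := by positivity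
  have hx1 : (2 : ℝ) ^ (-η) < 1 := Real.rpow_lt_one_of_one_lt_of_neg one_lt_two (by linarith)
  have h : ∀ κ : Fin d → ℕ, (2 : ℝ) ^ (-(η * ∑ i, (κ i : ℝ))) =
      ∏ i, ((2 : ℝ) ^ (-η)) ^ κ i := by
    intro κ
    rw [← neg_mul, Finset.mul_sum, Real.rpow_sum_of_pos two_pos]
    exact Finset.prod_congr rfl fun i _ => by rw [Real.rpow_mul_natCast two_pos.le]
  simp only [h, scales]
  rw [← Finset.prod_univ_sum (fun _ : Fin d => Finset.range (K + 1))
    (fun _ k => ((2 : ℝ) ^ (-η)) ^ k), Finset.prod_const, Finset.card_univ, Fintype.card_fin]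
  refine pow_le_pow_left₀ (Finset.sum_nonneg fun k _ => by positivity) ?_ d
  rw [← tsum_geometric_of_lt_one hx0.le hx1]
  exact (summable_geometric_of_lt_one hx0.le hx1).sum_le_tsum _ fun k _ => by positivity

/-- The contribution of one scale to the error of the scrambled mean. -/
lemma eLpNorm_level_le {φ : (Fin d → ℝ) → ℝ} {B b σ η V : ℝ}
    (h : BoundaryGrowth φ B fun _ => b) (hb : 0 ≤ b) (hσ : σ ∈ Icc (0 : ℝ) 1) (hη0 : 0 < η)
    (hη : η ≤ σ)
    (hV0 : 0 ≤ V) (hV : avg (fun a : Fin d × Fin K → ZMod 2 => weight (b + σ) a ^ 2) ≤ V ^ 2)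
    {κ : Fin d → ℕ} (hκ : κ ≠ 0) (m : ℕ) :
    eLpNorm (fun c => (∑ n ∈ Finset.range (2 ^ m),
      level (fun a => φ (center a)) κ (S.scrDigits K c n)) / 2 ^ m) 2 (innerLaw d) ≤
      ENNReal.ofReal (4 ^ S.degSum * 2 ^ d * V * B * 2 ^ (-(m * (1 / 2 + σ - η))) *
        2 ^ (-(η * ∑ i, (κ i : ℝ)))) := by
  have hB := h.const_nonneg
  by_cases hm : m < ∑ j, κ j + S.degSum
  swap
  · simp [sum_level_eq_zero S _ hκ (not_lt.1 hm)]
  set F : (Fin d × Fin K → ZMod 2) → ℝ := fun a => φ (center a) with hF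
  have hint : Integrable (fun c => (∑ n ∈ Finset.range (2 ^ m),
      level F κ (S.scrDigits K c n)) ^ 2) (innerLaw d) := by
    simp only [sq, Finset.sum_mul_sum]
    exact integrable_finsetSum _ fun n _ => integrable_finsetSum _ fun n' _ =>
      integrable_scrDigits₂ S n n' fun p => level F κ p.1 * level F κ p.2
  have hV' : 0 ≤ B * 2 ^ (-(σ * ∑ i, (κ i : ℝ))) := by positivity
  refine (eLpNorm_two_le (C := 2 ^ S.degSum * 2 ^ d * V * B * 2 ^ (-(m / 2 : ℝ)) *
    2 ^ (-(σ * ∑ i, (κ i : ℝ)))) (by positivity) ?_ ?_).trans (ENNReal.ofReal_le_ofReal ?_)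
  · simp only [div_pow]
    exact hint.div_const _
  · simp only [div_pow]
    rw [integral_div]
    have h1 := integral_sq_sum_level_le S F κ hm
    have h2 := (avg_level_sq_le F κ).trans (avg_digitDiff_sq_le h hb hσ κ)
    have h3 : avg (fun a => level F κ a ^ 2) ≤
        (B * 2 ^ (-(σ * ∑ i, (κ i : ℝ)))) ^ 2 * ((2 ^ d) ^ 2 * V ^ 2) := by
      refine h2.trans ?_
      gcongr
    rw [div_le_iff₀ (by positivity)]
    refine h1.trans ((mul_le_mul_of_nonneg_left h3 (by positivity)).trans_eq ?_)
    have e1 : ((2 : ℝ) ^ (-(m / 2 : ℝ))) ^ 2 * (2 ^ m) ^ 2 = 2 ^ m := by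
      rw [← mul_pow, ← Real.rpow_natCast 2 m, ← Real.rpow_add two_pos, ← Real.rpow_natCast _ 2,
        ← Real.rpow_mul two_pos.le]
      congr 1; push_cast; ring
    rw [pow_mul']
    linear_combination (-(2 ^ S.degSum) ^ 2 * (2 ^ d) ^ 2 * V ^ 2 * B ^ 2 *
      (2 ^ (-(σ * ∑ i, (κ i : ℝ)))) ^ 2) * e1
  · -- the excess `2 ^ (-((σ - η) |κ|))` is traded for a power of `2 ^ (-m)`, as `m < |κ| + degSum`
    have hm' : (m : ℝ) ≤ ∑ i, (κ i : ℝ) + S.degSum := by exact_mod_cast hm.le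
    have hσ2 := hσ.2
    have e : (2 : ℝ) ^ (-(m / 2 : ℝ)) * 2 ^ (-(σ * ∑ i, (κ i : ℝ))) ≤
        2 ^ S.degSum * (2 ^ (-(m * (1 / 2 + σ - η))) * 2 ^ (-(η * ∑ i, (κ i : ℝ)))) := by
      rw [← Real.rpow_natCast 2 S.degSum, ← Real.rpow_add two_pos, ← Real.rpow_add two_pos,
        ← Real.rpow_add two_pos]
      refine Real.rpow_le_rpow_of_exponent_le one_le_two ?_
      have h1 : (m - ∑ i, (κ i : ℝ)) * (σ - η) ≤ S.degSum * (σ - η) :=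
        mul_le_mul_of_nonneg_right (by linarith) (by linarith)
      have h2 : (S.degSum : ℝ) * (σ - η) ≤ S.degSum * 1 :=
        mul_le_mul_of_nonneg_left (by linarith) (Nat.cast_nonneg _)
      linarith
    have : (4 : ℝ) ^ S.degSum = 2 ^ S.degSum * 2 ^ S.degSum := by rw [← mul_pow]; norm_num
    rw [this]
    calc _ = 2 ^ S.degSum * 2 ^ d * V * B *
          ((2 : ℝ) ^ (-(m / 2 : ℝ)) * 2 ^ (-(σ * ∑ i, (κ i : ℝ)))) := by ring
      _ ≤ 2 ^ S.degSum * 2 ^ d * V * B * (2 ^ S.degSum *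
          (2 ^ (-(m * (1 / 2 + σ - η))) * 2 ^ (-(η * ∑ i, (κ i : ℝ))))) := by gcongr
      _ = _ := by ring

/-- The error of the scrambled mean for the function that is sampled at the centres of the
dyadic boxes, uniformly in the size of the boxes. -/
lemma eLpNorm_center_le {φ : (Fin d → ℝ) → ℝ} {B b σ η V : ℝ}
    (h : BoundaryGrowth φ B fun _ => b) (hb : 0 ≤ b) (hσ : σ ∈ Icc (0 : ℝ) 1) (hη0 : 0 < η)
    (hη : η ≤ σ) (hV0 : 0 ≤ V)
    (hV : avg (fun a : Fin d × Fin K → ZMod 2 => weight (b + σ) a ^ 2) ≤ V ^ 2) (m : ℕ) :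
    eLpNorm (fun c => (∑ n ∈ Finset.range (2 ^ m), φ (center (S.scrDigits K c n))) / 2 ^ m
        - avg fun a : Fin d × Fin K → ZMod 2 => φ (center a)) 2 (innerLaw d) ≤
      ENNReal.ofReal (4 ^ S.degSum * 2 ^ d * V * (1 - 2 ^ (-η))⁻¹ ^ d * B *
        2 ^ (-(m * (1 / 2 + σ - η)))) := by
  have hB := h.const_nonneg
  set F : (Fin d × Fin K → ZMod 2) → ℝ := fun a => φ (center a) with hF
  have h0 : (0 : Fin d → ℕ) ∈ scales d K := by simp [scales]
  have e : (fun c => (∑ n ∈ Finset.range (2 ^ m), F (S.scrDigits K c n)) / 2 ^ m - avg F) =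
      ∑ κ ∈ (scales d K).erase 0, fun c => (∑ n ∈ Finset.range (2 ^ m),
        level F κ (S.scrDigits K c n)) / 2 ^ m := by
    funext c
    rw [Finset.sum_apply, ← Finset.sum_div, Finset.sum_comm]
    have : ∀ n, F (S.scrDigits K c n) = ∑ κ ∈ (scales d K).erase 0,
        level F κ (S.scrDigits K c n) + avg F := fun n => by
      rw [← level_zero F (S.scrDigits K c n), Finset.sum_erase_add _ _ h0, sum_level]
    simp only [this, Finset.sum_add_distrib, Finset.sum_const, Finset.card_range]
    rw [add_div, nsmul_eq_mul]; push_cast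
    rw [mul_div_cancel_left₀ _ (by positivity : (2 : ℝ) ^ m ≠ 0)]
    ring
  show eLpNorm (fun c => (∑ n ∈ Finset.range (2 ^ m), F (S.scrDigits K c n)) / 2 ^ m - avg F) 2 _ ≤ _
  rw [e]
  refine (eLpNorm_sum_le (fun κ _ => ?_) one_le_two).trans ?_
  · exact ((integrable_finsetSum _ fun n _ => integrable_scrDigits S n
      (level F κ)).div_const _).aestronglyMeasurable
  refine (Finset.sum_le_sum fun κ hκ => eLpNorm_level_le S h hb hσ hη0 hη hV0 hV
    (Finset.ne_of_mem_erase hκ) m).trans ?_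
  rw [← ENNReal.ofReal_sum_of_nonneg fun κ _ => by positivity, ← Finset.mul_sum]
  refine ENNReal.ofReal_le_ofReal ?_
  have hs : ∑ κ ∈ (scales d K).erase 0, (2 : ℝ) ^ (-(η * ∑ i, (κ i : ℝ))) ≤
      (1 - 2 ^ (-η))⁻¹ ^ d :=
    (Finset.sum_le_sum_of_subset_of_nonneg (Finset.erase_subset _ _)
      fun _ _ _ => by positivity).trans (sum_scales_le hη0 d K)
  refine (mul_le_mul_of_nonneg_left hs (by positivity)).trans_eq ?_
  ring

/-- The root mean square error of the mean over `2 ^ m` scrambled Sobol' points, for functions with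
boundary growth: any rate below `1 - b` is attained. -/
theorem exists_eLpNorm_scrambled_mean_le {b r : ℝ} (hb0 : 0 ≤ b) (hb : b < 1 / 2)
    (hr : r < 1 - b) : ∃ C : ℝ, 0 ≤ C ∧ ∀ (φ : (Fin d → ℝ) → ℝ) (B : ℝ),
      BoundaryGrowth φ B (fun _ => b) → ∀ m : ℕ,
        eLpNorm (fun c => (∑ n ∈ Finset.range (2 ^ m), φ (S.scrambledPoint c n)) / 2 ^ m
          - ∫ y in cube d, φ y) 2 (innerLaw d) ≤ ENNReal.ofReal (C * B * 2 ^ (-(m * r))) := by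
  -- the smoothness `σ` keeps `b + σ < 1 / 2`, and the rate `1 / 2 + σ - η` is at least `r`
  set η := min ((1 - b - r) / 2) ((1 / 2 - b) / 2) with hη
  have hη0 : 0 < η := lt_min (by linarith) (by linarith)
  have hη1 : η ≤ (1 - b - r) / 2 := min_le_left _ _
  have hη2 : η ≤ (1 / 2 - b) / 2 := min_le_right _ _
  set σ := 1 / 2 - b - η with hσ
  have hσ01 : σ ∈ Icc (0 : ℝ) 1 := ⟨by linarith, by linarith⟩
  set V := √((2 ^ (2 * (b + σ))) ^ d * ∫ y in cube d, ∏ i, bdist (y i) ^ (-(2 * (b + σ)))) with hV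
  have hVK : ∀ K, avg (fun a : Fin d × Fin K → ZMod 2 => weight (b + σ) a ^ 2) ≤ V ^ 2 := by
    intro K
    have h1 := avg_weight_sq_le (K := K) S (q := b + σ) (by linarith [hσ01.1]) (by linarith)
    rw [hV, Real.sq_sqrt]
    · exact h1
    · refine le_trans ?_ h1
      have := avg_mono (F := fun _ : Fin d × Fin K → ZMod 2 => 0)
        fun a => sq_nonneg (weight (b + σ) a)
      rwa [avg_const] at this
  have hpos : 0 ≤ (1 - (2 : ℝ) ^ (-η))⁻¹ := by
    have : (2 : ℝ) ^ (-η) < 1 := Real.rpow_lt_one_of_one_lt_of_neg one_lt_two (by linarith)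
    exact inv_nonneg.2 (by linarith)
  refine ⟨4 ^ S.degSum * 2 ^ d * V * (1 - 2 ^ (-η))⁻¹ ^ d, by positivity, fun φ B h m => ?_⟩
  have hB := h.const_nonneg
  have hmp := measurePreserving_scrambledPoint S
  have hin : ∀ᵐ c ∂innerLaw d, ∀ n, S.scrambledPoint c n ∈ openCube d :=
    ae_all_iff.2 fun n => (hmp n).quasiMeasurePreserving.ae (ae_mem_openCube d)
  have hconv : ∀ᵐ c ∂innerLaw d, ∀ n, Tendsto (fun K => φ (center (S.scrDigits K c n))) atTop
      (𝓝 (φ (S.scrambledPoint c n))) := by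
    filter_upwards [hin] with c hc n
    exact (h.tendsto hb0 (hc n)).comp (tendsto_center S c n)
  have havg : Tendsto (fun K => avg fun a : Fin d × Fin K → ZMod 2 => φ (center a)) atTop
      (𝓝 (∫ y in cube d, φ y)) := by
    rw [← (hmp 0).integral_comp_of_aestronglyMeasurable (h.aestronglyMeasurable hb0)]
    simp only [← fun K => integral_scrDigits (K := K) S 0 fun a => φ (center a)]
    refine tendsto_integral_of_dominated_convergence
      (fun c => B * ((2 ^ b) ^ d * ∏ i, bdist (S.scrambledPoint c 0 i) ^ (-b)))
      (fun K => (integrable_scrDigits S 0 fun a => φ (center a)).aestronglyMeasurable)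
      ?_ (fun K => ?_) ?_
    · exact (((hmp 0).integrable_comp_of_integrable
        (integrable_prod_bdist (by linarith : b < 1))).const_mul _).const_mul _
    · filter_upwards [hin] with c hc
      refine (h.abs_le (center_mem_openCube _)).trans ?_
      have := prod_bdist_center_le S K c 0 hb0 (hc 0)
      gcongr
    · filter_upwards [hconv] with c hc using hc 0
  have hlim : ∀ᵐ c ∂innerLaw d, Tendsto (fun K =>
      (∑ n ∈ Finset.range (2 ^ m), φ (center (S.scrDigits K c n))) / 2 ^ m
        - avg fun a : Fin d × Fin K → ZMod 2 => φ (center a)) atTop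
      (𝓝 ((∑ n ∈ Finset.range (2 ^ m), φ (S.scrambledPoint c n)) / 2 ^ m
        - ∫ y in cube d, φ y)) := by
    filter_upwards [hconv] with c hc
    exact ((tendsto_finsetSum _ fun n _ => hc n).div_const _).sub havg
  -- the points with `K` digits approximate the scrambled points; Fatou's lemma
  refine (Lp.eLpNorm_lim_le_liminf_eLpNorm (fun K => ?_) _ hlim).trans ?_
  · exact (((integrable_finsetSum _ fun n _ => integrable_scrDigits S n
      fun a => φ (center a)).div_const _).sub (integrable_const _)).aestronglyMeasurable
  refine liminf_le_of_le (by isBoundedDefault) fun t ht => ?_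
  obtain ⟨K, hK⟩ := ht.exists
  refine hK.trans ((eLpNorm_center_le S h hb0 hσ01 hη0 (by linarith) (Real.sqrt_nonneg _)
    (hVK K) m).trans (ENNReal.ofReal_le_ofReal ?_))
  gcongr
  · exact one_le_two
  · linarith

end MeanSquare

/-! ### The choice of the parameters -/

lemma exists_two_pow_mem_Icc {x : ℝ} (hx : 0 ≤ x) : ∃ k : ℕ, x ≤ 2 ^ k ∧ (2 : ℝ) ^ k ≤ 1 + 2 * x := by
  rcases le_total x 1 with h | h
  · exact ⟨0, by simpa using h, by simp; linarith⟩
  · obtain ⟨n, h1, h2⟩ := exists_nat_pow_near h one_lt_two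
    exact ⟨n + 1, h2.le, by rw [pow_succ]; linarith⟩

lemma sum_range_rpow_le {δ : ℝ} (hδ : 0 < δ) (L : ℕ) :
    ∑ ℓ ∈ Finset.range L, (2 : ℝ) ^ (-(δ * ℓ)) ≤ (1 - 2 ^ (-δ))⁻¹ := by
  have hx0 : (0 : ℝ) < 2 ^ (-δ) := by positivity
  have hx1 : (2 : ℝ) ^ (-δ) < 1 := Real.rpow_lt_one_of_one_lt_of_neg one_lt_two (by linarith)
  rw [← tsum_geometric_of_lt_one hx0.le hx1]
  simp only [← neg_mul, Real.rpow_mul_natCast two_pos.le]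
  exact (summable_geometric_of_lt_one hx0.le hx1).sum_le_tsum _ fun k _ => by positivity

/-- The choice of the parameters: `N_ℓ ≈ X 2 ^ (-θ ℓ)` with `1 < θ < e / r` makes the sum of the
errors and the sum of the work over the levels geometric. -/
lemma exists_parameters {C r e s : ℝ} (hC : 0 ≤ C) (hr : 0 < r) (hre : r < e) (hs : 0 < s) :
    ∃ C' : ℝ, 0 ≤ C' ∧ ∀ t : ℝ, 0 < t → t ≤ 1 → ∃ (L : ℕ) (k : ℕ → ℕ), 1 ≤ L ∧
      C * (∑ ℓ ∈ Finset.range L, 2 ^ (-(e * ℓ)) * 2 ^ (-(k ℓ * r)) + 2 ^ (-(e * L))) ≤ s * t ∧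
      ∑ ℓ ∈ Finset.range L, (2 : ℝ) ^ k ℓ * 2 ^ ℓ + 2 ^ L + ∑ ℓ ∈ Finset.range (L + 1), (2 : ℝ) ^ ℓ ≤
        C' * t ^ (-(1 / r)) := by
  have he : 0 < e := hr.trans hre
  set θ := (1 + e / r) / 2 with hθ
  have her : 1 < e / r := (one_lt_div hr).2 hre
  have hθ1 : 0 < θ - 1 := by linarith
  set δ := e - θ * r with hδ
  have hδ0 : 0 < δ := by
    have : θ * r = (r + e) / 2 := by rw [hθ]; field_simp
    linarith
  set G₁ := (1 - (2 : ℝ) ^ (-δ))⁻¹ with hG₁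
  set G₂ := (1 - (2 : ℝ) ^ (-(θ - 1)))⁻¹ with hG₂
  have hG₁0 : 0 ≤ G₁ := (sum_range_rpow_le hδ0 0).trans' (by simp)
  have hG₂0 : 0 ≤ G₂ := (sum_range_rpow_le hθ1 0).trans' (by simp)
  set K₁ := 2 * (C * G₁) / s + 1 with hK₁
  set K₂ := 2 * C / s + 1 with hK₂
  have hK₁0 : 0 < K₁ := by positivity
  have hK₂0 : 0 < K₂ := by positivity
  refine ⟨8 + 16 * K₂ ^ (1 / e) + 2 * G₂ * K₁ ^ (1 / r), by positivity, fun t ht ht1 => ?_⟩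
  -- `X` is chosen with `X ^ (-r) = t / K₁`, and `2 ^ L ≈ Z` with `Z ^ (-e) = t / K₂`
  set X := (K₁ / t) ^ (1 / r) with hX
  set Z := (K₂ / t) ^ (1 / e) with hZ
  have hX0 : 0 < X := by positivity
  have hZ0 : 0 < Z := by positivity
  have hXr : X ^ (-r) = t / K₁ := by
    rw [hX, ← Real.rpow_mul (by positivity), show 1 / r * -r = -1 by field_simp, Real.rpow_neg_one,
      inv_div]
  have hZe : Z ^ (-e) = t / K₂ := by
    rw [hZ, ← Real.rpow_mul (by positivity), show 1 / e * -e = -1 by field_simp, Real.rpow_neg_one,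
      inv_div]
  have hk : ∀ ℓ : ℕ, ∃ k : ℕ, X * 2 ^ (-(θ * ℓ)) ≤ 2 ^ k ∧
      (2 : ℝ) ^ k ≤ 1 + 2 * (X * 2 ^ (-(θ * ℓ))) := fun ℓ =>
    exists_two_pow_mem_Icc (by positivity)
  choose k hk1 hk2 using hk
  obtain ⟨j, hj1, hj2⟩ := exists_two_pow_mem_Icc hZ0.le
  refine ⟨j + 1, k, by omega, ?_, ?_⟩
  · have h1 : ∀ ℓ ∈ Finset.range (j + 1), (2 : ℝ) ^ (-(e * ℓ)) * 2 ^ (-(k ℓ * r)) ≤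
        t / K₁ * 2 ^ (-(δ * ℓ)) := by
      intro ℓ _
      have h2 : (2 : ℝ) ^ (-(k ℓ * r)) ≤ t / K₁ * 2 ^ (θ * ℓ * r) := by
        have h3 : (2 : ℝ) ^ (-(k ℓ * r)) = ((2 : ℝ) ^ k ℓ) ^ (-r) := by
          rw [← Real.rpow_natCast 2 (k ℓ), ← Real.rpow_mul two_pos.le, mul_neg]
        rw [h3]
        refine (Real.rpow_le_rpow_of_nonpos (by positivity) (hk1 ℓ) (by linarith)).trans_eq ?_
        rw [Real.mul_rpow hX0.le (by positivity), hXr, ← Real.rpow_mul two_pos.le]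
        congr 2; ring
      refine (mul_le_mul_of_nonneg_left h2 (by positivity)).trans_eq ?_
      rw [mul_left_comm, ← Real.rpow_add two_pos]
      congr 2; rw [hδ]; ring
    have h2 := (Finset.sum_le_sum h1).trans_eq (Finset.mul_sum _ _ _).symm
    have h3 := h2.trans (mul_le_mul_of_nonneg_left (sum_range_rpow_le hδ0 (j + 1))
      (by positivity : 0 ≤ t / K₁))
    have h4 : (2 : ℝ) ^ (-(e * ((j + 1 : ℕ) : ℝ))) ≤ t / K₂ := by
      rw [← hZe]
      have h5 : (2 : ℝ) ^ (-(e * ((j + 1 : ℕ) : ℝ))) = ((2 : ℝ) ^ (j + 1)) ^ (-e) := by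
        rw [← Real.rpow_natCast 2 (j + 1), ← Real.rpow_mul two_pos.le]; congr 1; ring
      rw [h5]
      refine Real.rpow_le_rpow_of_nonpos hZ0 (hj1.trans ?_) (by linarith)
      exact pow_le_pow_right₀ one_le_two (Nat.le_succ j)
    have h6 : C * (t / K₁ * G₁) ≤ s * t / 2 := by
      rw [div_mul_eq_mul_div, mul_div_assoc', div_le_iff₀ hK₁0, hK₁]
      have : s * t / 2 * (2 * (C * G₁) / s + 1) = C * (t * G₁) + s * t / 2 := by
        field_simp
      rw [this]
      have : 0 ≤ s * t / 2 := by positivity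
      linarith
    have h7 : C * (t / K₂) ≤ s * t / 2 := by
      rw [mul_div_assoc', div_le_iff₀ hK₂0, hK₂]
      have : s * t / 2 * (2 * C / s + 1) = C * t + s * t / 2 := by
        field_simp
      rw [this]
      have : 0 ≤ s * t / 2 := by positivity
      linarith
    have h8 := mul_le_mul_of_nonneg_left h3 hC
    have h9 := mul_le_mul_of_nonneg_left h4 hC
    rw [mul_add]
    linarith
  · have hgeo : ∀ n : ℕ, ∑ ℓ ∈ Finset.range n, (2 : ℝ) ^ ℓ ≤ 2 ^ n := fun n => by
      rw [geom_sum_eq (by norm_num)]; norm_num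
    have h1 : ∀ ℓ ∈ Finset.range (j + 1), (2 : ℝ) ^ k ℓ * 2 ^ ℓ ≤
        2 ^ ℓ + 2 * X * 2 ^ (-((θ - 1) * ℓ)) := by
      intro ℓ _
      refine (mul_le_mul_of_nonneg_right (hk2 ℓ) (by positivity)).trans_eq ?_
      rw [show -((θ - 1) * (ℓ : ℝ)) = -(θ * ℓ) + ℓ by ring, Real.rpow_add two_pos,
        Real.rpow_natCast]
      ring
    have h2 := Finset.sum_le_sum h1
    rw [Finset.sum_add_distrib, ← Finset.mul_sum] at h2
    have h3 := mul_le_mul_of_nonneg_left (sum_range_rpow_le hθ1 (j + 1))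
      (by positivity : 0 ≤ 2 * X)
    have h4 := hgeo (j + 1)
    have h5 := hgeo (j + 1 + 1)
    have h6 : (1 : ℝ) ≤ t ^ (-(1 / r)) :=
      Real.one_le_rpow_of_pos_of_le_one_of_nonpos ht ht1 (by simp [hr.le])
    have hdiv : ∀ K q : ℝ, 0 < K → (K / t) ^ q = K ^ q * t ^ (-q) := fun K q hK => by
      rw [Real.div_rpow hK.le ht.le, Real.rpow_neg ht.le]; rfl
    have h7 : Z ≤ K₂ ^ (1 / e) * t ^ (-(1 / r)) := by
      rw [hZ, hdiv _ _ hK₂0]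
      refine mul_le_mul_of_nonneg_left ?_ (by positivity)
      refine Real.rpow_le_rpow_of_exponent_ge ht ht1 (neg_le_neg ?_)
      exact one_div_le_one_div_of_le hr hre.le
    have h8 : X = K₁ ^ (1 / r) * t ^ (-(1 / r)) := by rw [hX, hdiv _ _ hK₁0]
    have h9 : (2 : ℝ) ^ (j + 1) = 2 * 2 ^ j := by ring
    have h10 : (2 : ℝ) ^ (j + 1 + 1) = 4 * 2 ^ j := by ring
    rw [← hG₂] at h3
    have h11 : 2 * X * G₂ = 2 * G₂ * K₁ ^ (1 / r) * t ^ (-(1 / r)) := by rw [h8]; ring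
    rw [h9] at h4 ⊢
    rw [h10] at h5
    nlinarith

section Integrand
variable {d₁ d₂ : ℕ} {f : ℝ → ℝ} {J : Set ℝ} {g : (Fin d₁ → ℝ) → (Fin d₂ → ℝ) → ℝ}

/-- A mean value of an integrand with values in an interval lies in the interval. -/
lemma gBar_mem (hJ : J.OrdConnected) {y : Fin d₁ → ℝ} (hmem : ∀ x ∈ cube d₂, g y x ∈ J)
    (hint : IntegrableOn (g y) (cube d₂)) : gBar g y ∈ J := by
  have hnull : (volume : Measure (Fin d₂ → ℝ)).restrict (cube d₂) {x | ¬ x ∈ cube d₂} = 0 :=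
    ae_restrict_mem (measurableSet_cube d₂)
  obtain ⟨x, hx, hle⟩ := exists_notMem_null_le_integral hint hnull
  obtain ⟨x', hx', hle'⟩ := exists_notMem_null_integral_le hint hnull
  exact hJ.out (hmem x (not_not.1 hx)) (hmem x' (not_not.1 hx')) ⟨hle, hle'⟩

/-- An average of values in an interval lies in the interval. -/
lemma innerAvg_mem (hJ : J.OrdConnected) {y : Fin d₁ → ℝ} (hmem : ∀ x ∈ cube d₂, g y x ∈ J)
    {M : ℕ} (hM : 1 ≤ M) {x : ℕ → Fin d₂ → ℝ} (hx : ∀ m, x m ∈ cube d₂) : innerAvg g M x y ∈ J := by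
  have hM' : (0 : ℝ) < M := by exact_mod_cast hM
  have h := hJ.convex.sum_mem (t := Finset.range M) (w := fun _ => (1 : ℝ) / M)
    (z := fun m => g y (x m)) (fun _ _ => by positivity)
    (by simp [hM'.ne']) fun m _ => hmem _ (hx m)
  rw [innerAvg, Finset.sum_div]
  simpa [div_eq_inv_mul] using h

/-- Taylor's formula of first order with integral remainder. -/
lemma taylor_integral (hJo : IsOpen J) (hJ : J.OrdConnected) (hf : ContDiffOn ℝ 2 f J) {p q : ℝ}
    (hp : p ∈ J) (hq : q ∈ J) : f q = f p + deriv f p * (q - p) +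
      (q - p) ^ 2 * ∫ s in (0 : ℝ)..1, deriv (deriv f) (p + s * (q - p)) * (1 - s) := by
  have hf' : ContDiffOn ℝ 1 (deriv f) J := by
    have : ContDiffOn ℝ (1 + 1) f J := by simpa [one_add_one_eq_two] using hf
    exact ((contDiffOn_succ_iff_deriv_of_isOpen hJo).1 this).2.2
  have hf'' : ContinuousOn (deriv (deriv f)) J := hf'.continuousOn_deriv_of_isOpen hJo le_rfl
  have hseg : ∀ s ∈ uIcc (0 : ℝ) 1, p + s * (q - p) ∈ J := by
    intro s hs
    rw [uIcc_of_le zero_le_one] at hs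
    have := hJ.convex hp hq (by linarith [hs.2] : 0 ≤ 1 - s) hs.1 (by ring)
    simp only [smul_eq_mul] at this
    convert this using 1; ring
  have hline : ∀ s : ℝ, HasDerivAt (fun s => p + s * (q - p)) (q - p) s := fun s => by
    simpa using ((hasDerivAt_id s).mul_const (q - p)).const_add p
  have hder : ∀ s ∈ uIcc (0 : ℝ) 1, HasDerivAt
      (fun s => f (p + s * (q - p)) + deriv f (p + s * (q - p)) * (q - p) * (1 - s))
      ((q - p) ^ 2 * (deriv (deriv f) (p + s * (q - p)) * (1 - s))) s := by
    intro s hs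
    have hn := hJo.mem_nhds (hseg s hs)
    have h1 := ((hf.contDiffAt hn).differentiableAt (by norm_num)).hasDerivAt.comp s (hline s)
    have h2 := ((hf'.contDiffAt hn).differentiableAt (by norm_num)).hasDerivAt.comp s (hline s)
    have h3 := h1.add ((h2.mul_const (q - p)).mul ((hasDerivAt_id s).const_sub 1))
    refine h3.congr_deriv ?_
    simp only [id, Function.comp_apply]
    ring
  have hcont : ContinuousOn
      (fun s : ℝ => (q - p) ^ 2 * (deriv (deriv f) (p + s * (q - p)) * (1 - s)))
      (uIcc (0 : ℝ) 1) := by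
    refine continuousOn_const.mul (ContinuousOn.mul ?_ (by fun_prop))
    exact hf''.comp (by fun_prop) hseg
  have := intervalIntegral.integral_eq_sub_of_hasDerivAt hder hcont.intervalIntegrable
  rw [intervalIntegral.integral_const_mul] at this
  rw [this]
  simp

end Integrand

/-! ### The estimator -/

section Estimator

variable {d₁ d₂ : ℕ}

instance : IsProbabilityMeasure (law d₁ d₂) := by
  unfold law; infer_instance

/-- The scrambling of the outer points of a level is an Owen scrambling. -/
lemma measurePreserving_level (ℓ : ℕ) :
    MeasurePreserving (fun (ω : Sample d₁ d₂) p => ω.1 (ℓ, p)) (law d₁ d₂) (innerLaw d₁) :=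
  (measurePreserving_coins_comp (Prod.mk_right_injective ℓ)).comp measurePreserving_fst

/-- The `L²` norm of a function of the scrambling of a level. -/
lemma eLpNorm_level_comp {x : (Fin d₁ × List (ZMod 2) → ZMod 2) → ℝ}
    (hx : AEStronglyMeasurable x (innerLaw d₁)) (ℓ : ℕ) :
    eLpNorm (fun ω : Sample d₁ d₂ => x fun p => ω.1 (ℓ, p)) 2 (law d₁ d₂) =
      eLpNorm x 2 (innerLaw d₁) :=
  eLpNorm_comp_measurePreserving hx (measurePreserving_level ℓ)

lemma le_maxExp {d : ℕ} (A : Fin d → ℝ) (i : Fin d) : A i ≤ maxExp A :=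
  le_ciSup (Set.finite_range A).bddAbove i

lemma innerSize_pos {M₀ : ℕ} (hM₀ : 1 ≤ M₀) (ℓ : ℕ) : 1 ≤ innerSize M₀ ℓ :=
  Nat.mul_pos hM₀ (pow_pos two_pos ℓ)

lemma innerSize_rpow_le {M₀ : ℕ} (hM₀ : 1 ≤ M₀) (ℓ : ℕ) {e : ℝ} (he : 0 ≤ e) :
    (innerSize M₀ ℓ : ℝ) ^ (-e) ≤ 2 ^ (-(e * ℓ)) := by
  have h : (2 : ℝ) ^ ℓ ≤ innerSize M₀ ℓ := by
    unfold innerSize; push_cast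
    exact le_mul_of_one_le_left (by positivity) (by exact_mod_cast hM₀)
  refine (Real.rpow_le_rpow_of_nonpos (by positivity) h (by linarith)).trans_eq ?_
  rw [← Real.rpow_natCast, ← Real.rpow_mul two_pos.le]; congr 1; ring

/-- The mean square error controls both the bias and the variance. -/
lemma admissible_of_eLpNorm_le {f : ℝ → ℝ} {g : (Fin d₁ → ℝ) → (Fin d₂ → ℝ) → ℝ}
    {U : SobolData d₁} {T : SobolData d₂} {M₀ : ℕ} {α t : ℝ} (hα : α ∈ Ioo (0 : ℝ) 1) (ht : 0 < t)
    {L : ℕ} {N : ℕ → ℕ} (hL : 1 ≤ L) (hN : ∀ ℓ ≤ L, 1 ≤ N ℓ)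
    (hm : AEStronglyMeasurable (estimator f g U T M₀ L N) (law d₁ d₂))
    (h : eLpNorm (fun ω => estimator f g U T M₀ L N ω - nested f g) 2 (law d₁ d₂) ≤
      ENNReal.ofReal (√α / 2 * t)) : Admissible f g U T M₀ α t L N := by
  set X := estimator f g U T M₀ L N
  set I := nested f g
  have hs0 : 0 < √α := Real.sqrt_pos.2 hα.1
  have hs1 : √α ≤ 1 := Real.sqrt_le_one.2 hα.2.le
  have hmD : AEStronglyMeasurable (fun ω => X ω - I) (law d₁ d₂) :=
    hm.sub aestronglyMeasurable_const
  have hD : MemLp (fun ω => X ω - I) 2 (law d₁ d₂) :=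
    ⟨hmD, h.trans_lt ENNReal.ofReal_lt_top⟩
  have hX : MemLp X 2 (law d₁ d₂) := by
    have := hD.add (memLp_const I)
    refine this.ae_eq (ae_of_all _ fun ω => ?_)
    show X ω - I + I = X ω
    ring
  have hXi : Integrable X (law d₁ d₂) := hX.integrable one_le_two
  refine ⟨hL, hN, hX, ?_, ?_⟩
  · have h1 : ∫ ω, X ω ∂law d₁ d₂ - I = ∫ ω, (X ω - I) ∂law d₁ d₂ := by
      rw [integral_sub hXi (integrable_const _)]; simp
    rw [h1]
    have h2 : eLpNorm (fun ω => X ω - I) 1 (law d₁ d₂) ≤ ENNReal.ofReal (√α / 2 * t) :=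
      (eLpNorm_le_eLpNorm_of_exponent_le one_le_two hmD).trans h
    have h3 : |∫ ω, (X ω - I) ∂law d₁ d₂| ≤ √α / 2 * t := by
      refine (abs_integral_le_integral_abs).trans ?_
      rw [eLpNorm_one_eq_lintegral_enorm,
        ← ofReal_integral_norm_eq_lintegral_enorm (hD.integrable one_le_two)] at h2
      exact (ENNReal.ofReal_le_ofReal_iff (by positivity)).1 h2
    refine h3.trans ?_
    nlinarith
  · have h1 : variance X (law d₁ d₂) = variance (fun ω => X ω - I) (law d₁ d₂) :=
      (variance_sub_const hX.aestronglyMeasurable I).symm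
    rw [h1]
    refine (variance_le_expectation_sq hmD).trans ?_
    have h2 : ∫ ω, (X ω - I) ^ 2 ∂law d₁ d₂ =
        (eLpNorm (fun ω => X ω - I) 2 (law d₁ d₂)).toReal ^ 2 := by
      rw [← ENNReal.toReal_pow, eLpNorm_two_sq hD.integrable_sq,
        ENNReal.toReal_ofReal (integral_nonneg fun ω => sq_nonneg _)]
    have h3 : (eLpNorm (fun ω => X ω - I) 2 (law d₁ d₂)).toReal ≤ √α / 2 * t :=
      ENNReal.toReal_le_of_le_ofReal (by positivity) h
    show ∫ ω, (X ω - I) ^ 2 ∂law d₁ d₂ ≤ _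
    rw [h2]
    have h4 : t / 2 / (1 / √α) = √α / 2 * t := by field_simp
    rw [h4]
    exact pow_le_pow_left₀ ENNReal.toReal_nonneg h3 2

/-- The integrand whose mean is estimated at a level. -/
def levelFun (f : ℝ → ℝ) (g : (Fin d₁ → ℝ) → (Fin d₂ → ℝ) → ℝ) (T : SobolData d₂) (M₀ : ℕ) :
    ℕ → (Fin d₁ → ℝ) → ℝ
  | 0, y => f (innerAvg g (innerSize M₀ 0) T.point y)
  | ℓ + 1, y => f (innerAvg g (innerSize M₀ (ℓ + 1)) T.point y)
      - f (innerAvg g (innerSize M₀ ℓ) T.point y)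

lemma sum_levelFun (f : ℝ → ℝ) (g : (Fin d₁ → ℝ) → (Fin d₂ → ℝ) → ℝ) (T : SobolData d₂) (M₀ L : ℕ)
    (y : Fin d₁ → ℝ) : ∑ ℓ ∈ Finset.range (L + 1), levelFun f g T M₀ ℓ y =
      f (innerAvg g (innerSize M₀ L) T.point y) := by
  induction L with
  | zero => simp [levelFun]
  | succ L ih => rw [Finset.sum_range_succ, ih, levelFun]; ring

/-- The term of the finest level, with a single outer point. -/
def topTerm (f : ℝ → ℝ) (g : (Fin d₁ → ℝ) → (Fin d₂ → ℝ) → ℝ) (U : SobolData d₁) (T : SobolData d₂)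
    (M₀ L : ℕ) (ω : Sample d₁ d₂) : ℝ :=
  f (innerAvg g (innerSize M₀ L) (T.scrambledPoint ω.2) (outerPoint U ω L 0))
    - f (innerAvg g (innerSize M₀ (L - 1)) T.point (outerPoint U ω L 0))

/-- With one outer point at the finest level, the estimator is a sum of scrambled means and of the term
of that level. -/
lemma estimator_eq (f : ℝ → ℝ) (g : (Fin d₁ → ℝ) → (Fin d₂ → ℝ) → ℝ) (U : SobolData d₁)
    (T : SobolData d₂) (M₀ : ℕ) {L : ℕ} (hL : 1 ≤ L) {N : ℕ → ℕ} (hN : N L = 1)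
    (ω : Sample d₁ d₂) : estimator f g U T M₀ L N ω =
      ∑ ℓ ∈ Finset.range L,
        (∑ n ∈ Finset.range (N ℓ), levelFun f g T M₀ ℓ (outerPoint U ω ℓ n)) / N ℓ
      + topTerm f g U T M₀ L ω := by
  have h : ∑ ℓ ∈ Finset.range L,
        (∑ n ∈ Finset.range (N ℓ), levelFun f g T M₀ ℓ (outerPoint U ω ℓ n)) / N ℓ =
      (∑ n ∈ Finset.range (N 0), f (innerAvg g (innerSize M₀ 0) T.point (outerPoint U ω 0 n))) / N 0
      + ∑ ℓ ∈ Finset.Ico 1 L, (∑ n ∈ Finset.range (N ℓ),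
        (f (innerAvg g (innerSize M₀ ℓ) T.point (outerPoint U ω ℓ n))
          - f (innerAvg g (innerSize M₀ (ℓ - 1)) T.point (outerPoint U ω ℓ n)))) / N ℓ := by
    rw [Finset.range_eq_Ico, Finset.sum_eq_sum_Ico_succ_bot (by omega)]
    congr 1
    refine Finset.sum_congr rfl fun ℓ hℓ => ?_
    obtain ⟨m, rfl⟩ : ∃ m, ℓ = m + 1 := ⟨ℓ - 1, by have := (Finset.mem_Ico.1 hℓ).1; omega⟩
    rfl
  rw [h, estimator, hN]
  simp [topTerm]

/-- The error of the estimator in mean square. Each level but the finest one contributes the error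
of a scrambled mean; at the finest level, the bound of the integrand itself is small enough. -/
lemma exists_eLpNorm_estimator_sub_le {f : ℝ → ℝ} {g : (Fin d₁ → ℝ) → (Fin d₂ → ℝ) → ℝ}
    (U : SobolData d₁) {T : SobolData d₂} {M₀ : ℕ} {a b e r : ℝ} (ha0 : 0 ≤ a) (ha : a < 1 / 2)
    (hr : r < 1 - a) (hb : 0 ≤ b)
    (hlevel : ∀ ℓ : ℕ, BoundaryGrowth (levelFun f g T M₀ ℓ) (b * 2 ^ (-(e * ℓ))) fun _ => a)
    (hdet : ∀ ℓ : ℕ, BoundaryGrowth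
      (fun y => f (innerAvg g (innerSize M₀ ℓ) T.point y) - f (gBar g y))
      (b * 2 ^ (-(e * ℓ))) fun _ => a)
    (hrand : ∀ ℓ : ℕ, 1 ≤ ℓ → ∀ᵐ c ∂innerLaw d₂, BoundaryGrowth
      (fun y => f (innerAvg g (innerSize M₀ ℓ) (T.scrambledPoint c) y) - f (gBar g y))
      (b * 2 ^ (-(e * ℓ))) fun _ => a)
    (hint : IntegrableOn (fun y => f (gBar g y)) (cube d₁))
    (hmeas : ∀ L, AEStronglyMeasurable (topTerm f g U T M₀ L) (law d₁ d₂)) :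
    ∃ C : ℝ, 0 ≤ C ∧ ∀ (L : ℕ) (k N : ℕ → ℕ), 1 ≤ L → (∀ ℓ < L, N ℓ = 2 ^ k ℓ) → N L = 1 →
      AEStronglyMeasurable (estimator f g U T M₀ L N) (law d₁ d₂) ∧
      eLpNorm (fun ω => estimator f g U T M₀ L N ω - nested f g) 2 (law d₁ d₂) ≤
        ENNReal.ofReal (C * (∑ ℓ ∈ Finset.range L, 2 ^ (-(e * ℓ)) * 2 ^ (-(k ℓ * r))
          + 2 ^ (-(e * L)))) := by
  obtain ⟨C₁, hC₁, hmain⟩ := exists_eLpNorm_scrambled_mean_le U ha0 ha hr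
  set W : (Fin d₁ → ℝ) → ℝ := fun y => ∏ i, bdist (y i) ^ (-a) with hW
  have hWint : Integrable W (volume.restrict (cube d₁)) := integrable_prod_bdist (by linarith)
  have hW2 : Integrable (fun y => W y ^ 2) (volume.restrict (cube d₁)) := by
    refine (integrable_prod_bdist (d := d₁) (q := 2 * a) (by linarith)).congr ?_
    filter_upwards [ae_mem_openCube d₁] with y hy
    rw [hW, ← Finset.prod_pow]
    refine Finset.prod_congr rfl fun i _ => ?_
    rw [← Real.rpow_natCast, ← Real.rpow_mul (bdist_pos (hy i)).le]
    congr 1; push_cast; ring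
  have hWL : MemLp W 2 (volume.restrict (cube d₁)) :=
    (memLp_two_iff_integrable_sq hWint.aestronglyMeasurable).2 hW2
  set w₁ := ∫ y in cube d₁, W y with hw₁
  have hw₁0 : 0 ≤ w₁ := by
    refine integral_nonneg_of_ae ?_
    filter_upwards [ae_mem_openCube d₁] with y hy using (prod_bdist_rpow_pos hy _ _).le
  set w₂ := (eLpNorm W 2 (volume.restrict (cube d₁))).toReal with hw₂
  have hw₂0 : 0 ≤ w₂ := ENNReal.toReal_nonneg
  refine ⟨b * (C₁ + (1 + 2 ^ e) * w₂ + 2 ^ e * w₁), by positivity,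
    fun L k N hL hN hNL => ?_⟩
  have hpt : ∀ ℓ n, MeasurePreserving (fun ω : Sample d₁ d₂ => outerPoint U ω ℓ n) (law d₁ d₂)
      (volume.restrict (cube d₁)) := fun ℓ n =>
    (measurePreserving_scrambledPoint U n).comp (measurePreserving_level ℓ)
  have hprev : (2 : ℝ) ^ (-(e * (L - 1 : ℕ))) = 2 ^ e * 2 ^ (-(e * L)) := by
    rw [← Real.rpow_add two_pos, Nat.cast_sub hL]; congr 1; push_cast; ring
  -- up to the topmost term, the estimator is a sum of scrambled means
  set x : ℕ → (Fin d₁ × List (ZMod 2) → ZMod 2) → ℝ := fun ℓ c =>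
    (∑ n ∈ Finset.range (2 ^ k ℓ), levelFun f g T M₀ ℓ (U.scrambledPoint c n)) / 2 ^ k ℓ
      - ∫ y in cube d₁, levelFun f g T M₀ ℓ y with hx
  have hxm : ∀ ℓ, AEStronglyMeasurable (x ℓ) (innerLaw d₁) := fun ℓ => by
    refine AEStronglyMeasurable.sub ?_ aestronglyMeasurable_const
    refine AEStronglyMeasurable.mul_const ?_ _ |>.congr
      (ae_of_all _ fun c => (div_eq_mul_inv _ _).symm)
    refine Finset.aestronglyMeasurable_fun_sum _ fun n _ => ?_
    exact ((hlevel ℓ).aestronglyMeasurable ha0).comp_measurePreserving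
      (measurePreserving_scrambledPoint U n)
  set X : ℕ → Sample d₁ d₂ → ℝ := fun ℓ ω => x ℓ fun p => ω.1 (ℓ, p) with hX
  have hXm : ∀ ℓ, AEStronglyMeasurable (X ℓ) (law d₁ d₂) := fun ℓ =>
    (hxm ℓ).comp_measurePreserving (measurePreserving_level ℓ)
  set δ := ∫ y in cube d₁, (f (innerAvg g (innerSize M₀ (L - 1)) T.point y) - f (gBar g y)) with hδ
  have hsum : ∑ ℓ ∈ Finset.range L, ∫ y in cube d₁, levelFun f g T M₀ ℓ y = nested f g + δ := by
    rw [← integral_finsetSum _ fun ℓ _ => (hlevel ℓ).integrable ha0 (by linarith), nested, hδ,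
      ← integral_add hint ((hdet (L - 1)).integrable ha0 (by linarith))]
    congr 1; funext y
    obtain ⟨L, rfl⟩ : ∃ m, L = m + 1 := ⟨L - 1, by omega⟩
    rw [sum_levelFun, Nat.add_sub_cancel]; ring
  have hdecomp : ∀ ω, estimator f g U T M₀ L N ω - nested f g =
      (∑ ℓ ∈ Finset.range L, X ℓ) ω + (topTerm f g U T M₀ L ω + δ) := by
    intro ω
    have h1 : ∑ ℓ ∈ Finset.range L,
        (∑ n ∈ Finset.range (N ℓ), levelFun f g T M₀ ℓ (outerPoint U ω ℓ n)) / N ℓ =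
        (∑ ℓ ∈ Finset.range L, X ℓ) ω
          + ∑ ℓ ∈ Finset.range L, ∫ y in cube d₁, levelFun f g T M₀ ℓ y := by
      rw [Finset.sum_apply, ← Finset.sum_add_distrib]
      refine Finset.sum_congr rfl fun ℓ hℓ => ?_
      rw [hN ℓ (Finset.mem_range.1 hℓ)]
      simp [hX, hx, outerPoint]
    rw [estimator_eq f g U T M₀ hL hNL, h1, hsum]; ring
  have hSm : AEStronglyMeasurable (∑ ℓ ∈ Finset.range L, X ℓ) (law d₁ d₂) :=
    Finset.aestronglyMeasurable_sum _ fun ℓ _ => hXm ℓ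
  constructor
  · refine ((hSm.add ((hmeas L).add (aestronglyMeasurable_const (b := δ)))).add
      (aestronglyMeasurable_const (b := nested f g))).congr (ae_of_all _ fun ω => ?_)
    have := hdecomp ω
    show (∑ ℓ ∈ Finset.range L, X ℓ) ω + (topTerm f g U T M₀ L ω + δ) + nested f g = _
    rw [← this]; ring
  · have hδle : |δ| ≤ b * 2 ^ e * 2 ^ (-(e * L)) * w₁ := by
      rw [hδ, hw₁, ← integral_const_mul]
      refine abs_integral_le_integral_abs.trans (integral_mono_ae
        ((hdet (L - 1)).integrable ha0 (by linarith)).abs (hWint.const_mul _) ?_)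
      filter_upwards [ae_mem_openCube d₁] with y hy
      refine ((hdet (L - 1)).abs_le hy).trans_eq ?_
      rw [hprev]; ring
    have htop : ∀ᵐ ω ∂law d₁ d₂, ‖topTerm f g U T M₀ L ω‖ ≤
        b * (1 + 2 ^ e) * 2 ^ (-(e * L)) * ‖W (outerPoint U ω L 0)‖ := by
      have h1 : ∀ᵐ ω ∂law d₁ d₂, outerPoint U ω L 0 ∈ openCube d₁ :=
        (hpt L 0).quasiMeasurePreserving.ae (ae_mem_openCube d₁)
      have h2 : ∀ᵐ ω ∂law d₁ d₂, BoundaryGrowth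
          (fun y => f (innerAvg g (innerSize M₀ L) (T.scrambledPoint ω.2) y) - f (gBar g y))
          (b * 2 ^ (-(e * L))) fun _ => a :=
        (measurePreserving_snd (μ := Measure.infinitePi fun _ : ℕ × Fin d₁ × List (ZMod 2) => coin)
          (ν := innerLaw d₂)).quasiMeasurePreserving.ae (hrand L hL)
      filter_upwards [h1, h2] with ω hω1 hω2
      have h3 := hω2.abs_le hω1
      have h4 := (hdet (L - 1)).abs_le hω1
      rw [hprev] at h4
      have h5 : topTerm f g U T M₀ L ω =
          (f (innerAvg g (innerSize M₀ L) (T.scrambledPoint ω.2) (outerPoint U ω L 0))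
            - f (gBar g (outerPoint U ω L 0)))
          - (f (innerAvg g (innerSize M₀ (L - 1)) T.point (outerPoint U ω L 0))
            - f (gBar g (outerPoint U ω L 0))) := by rw [topTerm]; ring
      rw [Real.norm_of_nonneg (prod_bdist_rpow_pos hω1 _ _).le, h5, Real.norm_eq_abs]
      refine (abs_sub _ _).trans ((add_le_add h3 h4).trans_eq ?_)
      ring
    have htopn : eLpNorm (topTerm f g U T M₀ L) 2 (law d₁ d₂) ≤
        ENNReal.ofReal (b * (1 + 2 ^ e) * 2 ^ (-(e * L)) * w₂) := by
      refine (eLpNorm_le_mul_eLpNorm_of_ae_le_mul htop 2).trans_eq ?_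
      rw [ENNReal.ofReal_mul (p := b * (1 + 2 ^ e) * 2 ^ (-(e * (L : ℝ)))) (q := w₂)
        (by positivity), hw₂, ENNReal.ofReal_toReal hWL.eLpNorm_ne_top]
      exact congrArg _ (eLpNorm_comp_measurePreserving hWint.aestronglyMeasurable (hpt L 0))
    have hXn : ∀ ℓ ∈ Finset.range L, eLpNorm (X ℓ) 2 (law d₁ d₂) ≤
        ENNReal.ofReal (b * C₁ * (2 ^ (-(e * ℓ)) * 2 ^ (-(k ℓ * r)))) := by
      intro ℓ _
      have h1 : eLpNorm (X ℓ) 2 (law d₁ d₂) = eLpNorm (x ℓ) 2 (innerLaw d₁) :=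
        eLpNorm_level_comp (hxm ℓ) ℓ
      rw [h1]
      refine (hmain _ _ (hlevel ℓ) (k ℓ)).trans_eq ?_
      congr 1; ring
    have hδn : eLpNorm (fun _ : Sample d₁ d₂ => δ) 2 (law d₁ d₂) ≤
        ENNReal.ofReal (b * 2 ^ e * 2 ^ (-(e * L)) * w₁) := by
      rw [eLpNorm_const _ two_ne_zero (IsProbabilityMeasure.ne_zero _), measure_univ,
        ENNReal.one_rpow, mul_one, Real.enorm_eq_ofReal_abs]
      exact ENNReal.ofReal_le_ofReal hδle
    have hfun : (fun ω => estimator f g U T M₀ L N ω - nested f g) =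
        (∑ ℓ ∈ Finset.range L, X ℓ) + (topTerm f g U T M₀ L + fun _ => δ) :=
      funext hdecomp
    rw [hfun]
    refine (eLpNorm_add_le hSm ((hmeas L).add aestronglyMeasurable_const) one_le_two).trans ?_
    refine (add_le_add ((eLpNorm_sum_le (fun ℓ _ => hXm ℓ) one_le_two).trans
      (Finset.sum_le_sum hXn)) ((eLpNorm_add_le (hmeas L) aestronglyMeasurable_const
        one_le_two).trans (add_le_add htopn hδn))).trans ?_
    rw [← ENNReal.ofReal_sum_of_nonneg fun ℓ _ => by positivity,
      ← ENNReal.ofReal_add (by positivity) (by positivity),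
      ← ENNReal.ofReal_add (Finset.sum_nonneg fun ℓ _ => by positivity) (by positivity),
      ← Finset.mul_sum]
    refine ENNReal.ofReal_le_ofReal ?_
    have hS : 0 ≤ ∑ ℓ ∈ Finset.range L, (2 : ℝ) ^ (-(e * ℓ)) * 2 ^ (-(k ℓ * r)) :=
      Finset.sum_nonneg fun ℓ _ => by positivity
    generalize ∑ ℓ ∈ Finset.range L, (2 : ℝ) ^ (-(e * ℓ)) * 2 ^ (-(k ℓ * r)) = S at hS ⊢
    have hE : 0 ≤ b * C₁ * (2 : ℝ) ^ (-(e * L)) := by positivity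
    have hF : 0 ≤ b * ((1 + 2 ^ e) * w₂ + 2 ^ e * w₁) * S := by positivity
    linarith

lemma measurable_scrambledPoint {d : ℕ} (S : SobolData d) (n : ℕ) :
    Measurable fun c => S.scrambledPoint c n := (measurePreserving_scrambledPoint S n).measurable

/-- The function `f` need not be measurable outside of the interval `J`, but the estimator only
evaluates it there, almost surely. -/
lemma aestronglyMeasurable_topTerm {f : ℝ → ℝ} {J : Set ℝ} (hJ_open : IsOpen J)
    (hJ_conn : J.OrdConnected) (hf : ContinuousOn f J) {g : (Fin d₁ → ℝ) → (Fin d₂ → ℝ) → ℝ}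
    (hg_meas : Measurable (Function.uncurry g))
    (hg_mem : ∀ y ∈ openCube d₁, ∀ x ∈ cube d₂, g y x ∈ J) (U : SobolData d₁) (T : SobolData d₂)
    {M₀ : ℕ} (hM₀ : 1 ≤ M₀) (L : ℕ) :
    AEStronglyMeasurable (topTerm f g U T M₀ L) (law d₁ d₂) := by
  classical
  set F := J.piecewise f 0 with hF
  have hFm : Measurable F := hf.measurable_piecewise continuousOn_const hJ_open.measurableSet
  have hout : Measurable fun ω : Sample d₁ d₂ => outerPoint U ω L 0 :=
    (measurable_scrambledPoint U 0).comp (measurePreserving_level L).measurable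
  have havg : ∀ (M : ℕ) (z : Sample d₁ d₂ → ℕ → Fin d₂ → ℝ), (∀ m, Measurable fun ω => z ω m) →
      Measurable fun ω => innerAvg g M (z ω) (outerPoint U ω L 0) := by
    intro M z hz
    unfold innerAvg
    exact (Finset.measurable_fun_sum _ fun m _ => hg_meas.comp (hout.prodMk (hz m))).div_const _
  have hm : Measurable fun ω : Sample d₁ d₂ =>
      F (innerAvg g (innerSize M₀ L) (T.scrambledPoint ω.2) (outerPoint U ω L 0))
        - F (innerAvg g (innerSize M₀ (L - 1)) T.point (outerPoint U ω L 0)) :=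
    (hFm.comp (havg _ (fun ω => T.scrambledPoint ω.2)
      fun m => (measurable_scrambledPoint T m).comp measurable_snd)).sub
      (hFm.comp (havg _ (fun _ => T.point) fun m => measurable_const))
  refine hm.aestronglyMeasurable.congr ?_
  have h1 : ∀ᵐ ω ∂law d₁ d₂, outerPoint U ω L 0 ∈ openCube d₁ :=
    ((measurePreserving_scrambledPoint U 0).comp
      (measurePreserving_level L)).quasiMeasurePreserving.ae (ae_mem_openCube d₁)
  filter_upwards [h1] with ω hω
  rw [topTerm, hF, piecewise_eq_of_mem _ _ _ (innerAvg_mem hJ_conn (hg_mem _ hω)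
      (innerSize_pos hM₀ _) fun m => scrambledPoint_mem_cube T _ m),
    piecewise_eq_of_mem _ _ _ (innerAvg_mem hJ_conn (hg_mem _ hω)
      (innerSize_pos hM₀ _) fun m => point_mem_cube T m)]

/-- The sum of the first- and the second-order term is the error of the inner average under `f`. -/
lemma boundaryGrowth_error {f : ℝ → ℝ} {J : Set ℝ} (hJ_open : IsOpen J)
    (hJ_conn : J.OrdConnected) (hf : ContDiffOn ℝ 2 f J) {g : (Fin d₁ → ℝ) → (Fin d₂ → ℝ) → ℝ}
    (hg_mem : ∀ y ∈ openCube d₁, ∀ x ∈ cube d₂, g y x ∈ J)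
    (hg_int : ∀ y ∈ openCube d₁, IntegrableOn (g y) (cube d₂)) {M₀ : ℕ} (hM₀ : 1 ≤ M₀) (ℓ : ℕ)
    {x : ℕ → Fin d₂ → ℝ} (hx : ∀ m, x m ∈ cube d₂) {A₁ A₂ : Fin d₁ → ℝ} {a b₁ b₂ ε : ℝ}
    (hb₁ : 0 ≤ b₁) (hb₂ : 0 ≤ b₂) (hε : ε ≤ 1)
    (hA₁ : ∀ i, A₁ i ≤ a) (hA₂ : ∀ i, A₂ i ≤ a)
    (h_I : BoundaryGrowth (phiI f g (innerSize M₀ ℓ) x) (b₁ * (innerSize M₀ ℓ : ℝ) ^ (-1 + ε)) A₁)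
    (h_II : BoundaryGrowth (phiII f g (innerSize M₀ ℓ) x)
      (b₂ * (innerSize M₀ ℓ : ℝ) ^ (-2 + 2 * ε)) A₂) :
    BoundaryGrowth (fun y => f (innerAvg g (innerSize M₀ ℓ) x y) - f (gBar g y))
      ((b₁ + b₂) * 2 ^ (-((1 - ε) * ℓ))) fun _ => a := by
  have hM : (1 : ℝ) ≤ innerSize M₀ ℓ := by exact_mod_cast innerSize_pos hM₀ ℓ
  have hle := innerSize_rpow_le hM₀ ℓ (sub_nonneg.2 hε)
  have e1 : (innerSize M₀ ℓ : ℝ) ^ (-1 + ε) ≤ 2 ^ (-((1 - ε) * ℓ)) := by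
    rwa [show -(1 - ε) = -1 + ε by ring] at hle
  have e2 : (innerSize M₀ ℓ : ℝ) ^ (-2 + 2 * ε) ≤ 2 ^ (-((1 - ε) * ℓ)) :=
    (Real.rpow_le_rpow_of_exponent_le hM (by linarith)).trans e1
  have h := (h_I.mono (mul_le_mul_of_nonneg_left e1 hb₁) hA₁).add
    (h_II.mono (mul_le_mul_of_nonneg_left e2 hb₂) hA₂)
  rw [← add_mul] at h
  refine h.congr fun y hy => ?_
  rw [taylor_integral hJ_open hJ_conn hf (gBar_mem hJ_conn (hg_mem y hy) (hg_int y hy))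
    (innerAvg_mem hJ_conn (hg_mem y hy) (innerSize_pos hM₀ ℓ) hx), phiI, phiII]
  ring

end Estimator

end MLDLQ

end

theorem mainTheorem2 {d₁ d₂ : ℕ}
    -- the outer integrand, twice continuously differentiable on an open interval `J`
    (f : ℝ → ℝ) (J : Set ℝ) (hJ_open : IsOpen J) (hJ_conn : J.OrdConnected)
    (hf : ContDiffOn ℝ 2 f J)
    -- the inner integrand
    (g : (Fin d₁ → ℝ) → (Fin d₂ → ℝ) → ℝ) (hg_meas : Measurable (Function.uncurry g))
    (hg_mem : ∀ y ∈ MLDLQ.openCube d₁, ∀ x ∈ MLDLQ.cube d₂, g y x ∈ J)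
    (hg_int : ∀ y ∈ MLDLQ.openCube d₁, IntegrableOn (g y) (MLDLQ.cube d₂))
    -- the Sobol' sequences for the outer and the inner points, and the remaining parameters
    (U : MLDLQ.SobolData d₁) (T : MLDLQ.SobolData d₂)
    (M₀ : ℕ) (hM₀ : 1 ≤ M₀) (α : ℝ) (hα : α ∈ Ioo (0 : ℝ) 1)
    (A₀ A₁ A₂ : Fin d₁ → ℝ) (b₀ b₁ b₂ ε Amax : ℝ)
    (hA₀ : MLDLQ.maxExp A₀ ∈ Ioo (0 : ℝ) (1 / 2))
    (hA₁ : MLDLQ.maxExp A₁ ∈ Ioo (0 : ℝ) (1 / 2))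
    (hA₂ : MLDLQ.maxExp A₂ ∈ Ioo (0 : ℝ) (1 / 2))
    (hAmax : Amax = max (MLDLQ.maxExp A₀) (max (MLDLQ.maxExp A₁) (MLDLQ.maxExp A₂)))
    (hε_pos : 0 < ε) (hε_lt : ε < 1 - Amax)
    -- boundary growth at level `0`
    (h_zero : MLDLQ.BoundaryGrowth
      (MLDLQ.phiZero f g (MLDLQ.innerSize M₀ 0) T.point) b₀ A₀)
    -- boundary growth of the first- and second-order terms for the deterministic inner points
    (h_I : ∀ ℓ : ℕ, MLDLQ.BoundaryGrowth
      (MLDLQ.phiI f g (MLDLQ.innerSize M₀ ℓ) T.point)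
      (b₁ * (MLDLQ.innerSize M₀ ℓ : ℝ) ^ (-1 + ε)) A₁)
    (h_II : ∀ ℓ : ℕ, MLDLQ.BoundaryGrowth
      (MLDLQ.phiII f g (MLDLQ.innerSize M₀ ℓ) T.point)
      (b₂ * (MLDLQ.innerSize M₀ ℓ : ℝ) ^ (-2 + 2 * ε)) A₂)
    -- the same for the scrambled inner points that are used at the finest level
    (h_I_rand : ∀ ℓ : ℕ, 1 ≤ ℓ → ∀ᵐ c ∂(MLDLQ.innerLaw d₂), MLDLQ.BoundaryGrowth
      (MLDLQ.phiI f g (MLDLQ.innerSize M₀ ℓ) (T.scrambledPoint c))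
      (b₁ * (MLDLQ.innerSize M₀ ℓ : ℝ) ^ (-1 + ε)) A₁)
    (h_II_rand : ∀ ℓ : ℕ, 1 ≤ ℓ → ∀ᵐ c ∂(MLDLQ.innerLaw d₂), MLDLQ.BoundaryGrowth
      (MLDLQ.phiII f g (MLDLQ.innerSize M₀ ℓ) (T.scrambledPoint c))
      (b₂ * (MLDLQ.innerSize M₀ ℓ : ℝ) ^ (-2 + 2 * ε)) A₂) :
    IntegrableOn (fun y => f (MLDLQ.gBar g y)) (MLDLQ.cube d₁) ∧
    ∃ C : ℝ, ∀ᶠ TOL : ℝ in 𝓝[>] 0,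
      MLDLQ.optimalWork f g U T M₀ α TOL ≤
        ENNReal.ofReal (C * TOL ^ (-(1 / (1 - ε - Amax)))) := by
  have hmax : ∀ {A : Fin d₁ → ℝ}, MLDLQ.maxExp A ≤ Amax → ∀ i, A i ≤ Amax := fun h i =>
    (MLDLQ.le_maxExp _ i).trans h
  have hA₀' : ∀ i, A₀ i ≤ Amax := hmax (hAmax ▸ le_max_left _ _)
  have hA₁' : ∀ i, A₁ i ≤ Amax := hmax (hAmax ▸ (le_max_left _ _).trans (le_max_right _ _))
  have hA₂' : ∀ i, A₂ i ≤ Amax := hmax (hAmax ▸ (le_max_right _ _).trans (le_max_right _ _))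
  have ha0 : 0 < Amax := hAmax ▸ lt_max_of_lt_left hA₀.1
  have ha : Amax < 1 / 2 := hAmax ▸ max_lt hA₀.2 (max_lt hA₁.2 hA₂.2)
  have hM : (0 : ℝ) < MLDLQ.innerSize M₀ 0 := by
    exact_mod_cast MLDLQ.innerSize_pos hM₀ 0
  have hb₀ : 0 ≤ b₀ := h_zero.const_nonneg
  have hb₁ : 0 ≤ b₁ := nonneg_of_mul_nonneg_left (h_I 0).const_nonneg (by positivity)
  have hb₂ : 0 ≤ b₂ := nonneg_of_mul_nonneg_left (h_II 0).const_nonneg (by positivity)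
  have hε1 : ε ≤ 1 := by linarith
  set e := 1 - ε with he
  have hdet := fun ℓ => MLDLQ.boundaryGrowth_error hJ_open hJ_conn hf hg_mem hg_int hM₀ ℓ
    (MLDLQ.point_mem_cube T) hb₁ hb₂ hε1 hA₁' hA₂' (h_I ℓ) (h_II ℓ)
  have hrand : ∀ ℓ : ℕ, 1 ≤ ℓ → ∀ᵐ c ∂MLDLQ.innerLaw d₂, MLDLQ.BoundaryGrowth
      (fun y => f (MLDLQ.innerAvg g (MLDLQ.innerSize M₀ ℓ) (T.scrambledPoint c) y)
        - f (MLDLQ.gBar g y)) ((b₁ + b₂) * 2 ^ (-(e * ℓ))) fun _ => Amax := by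
    intro ℓ hℓ
    filter_upwards [h_I_rand ℓ hℓ, h_II_rand ℓ hℓ] with c h1 h2
    exact MLDLQ.boundaryGrowth_error hJ_open hJ_conn hf hg_mem hg_int hM₀ ℓ
      (MLDLQ.scrambledPoint_mem_cube T c) hb₁ hb₂ hε1 hA₁' hA₂' h1 h2
  have hzero := h_zero.mono le_rfl hA₀'
  have hint : IntegrableOn (fun y => f (MLDLQ.gBar g y)) (MLDLQ.cube d₁) := by
    refine ((hzero.sub (hdet 0)).congr (ψ := fun y => f (MLDLQ.gBar g y))
      fun y _ => ?_).integrable ha0.le (by linarith)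
    simp [MLDLQ.phiZero]
  refine ⟨hint, ?_⟩
  have h2e : (0 : ℝ) < 2 ^ e := by positivity
  -- one constant for level `0`, for the differences of consecutive errors, and for the errors
  set b := b₀ + (b₁ + b₂) * (1 + 2 ^ e) with hb
  have hb12 : (b₁ + b₂) ≤ b := by
    have : 0 ≤ (b₁ + b₂) * 2 ^ e := by positivity
    rw [hb]; linarith
  have hlevel : ∀ ℓ : ℕ, MLDLQ.BoundaryGrowth (MLDLQ.levelFun f g T M₀ ℓ) (b * 2 ^ (-(e * ℓ)))
      fun _ => Amax := by
    rintro (_ | ℓ)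
    · refine hzero.mono ?_ fun _ => le_rfl
      have : 0 ≤ (b₁ + b₂) * (1 + 2 ^ e) := by positivity
      simp [hb, this]
    · refine (((hdet (ℓ + 1)).sub (hdet ℓ)).congr fun y _ => ?_).mono ?_ fun _ => le_rfl
      · simp [MLDLQ.levelFun]
      · have h1 : (2 : ℝ) ^ (-(e * ℓ)) = 2 ^ e * 2 ^ (-(e * (ℓ + 1 : ℕ))) := by
          rw [← Real.rpow_add two_pos]; congr 1; push_cast; ring
        rw [h1, hb]
        have : 0 ≤ b₀ * (2 : ℝ) ^ (-(e * (ℓ + 1 : ℕ))) := by positivity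
        linarith
  have hb' : ∀ ℓ : ℕ, (b₁ + b₂) * (2 : ℝ) ^ (-(e * ℓ)) ≤ b * 2 ^ (-(e * ℓ)) := fun ℓ =>
    mul_le_mul_of_nonneg_right hb12 (by positivity)
  obtain ⟨C, hC, hest⟩ := MLDLQ.exists_eLpNorm_estimator_sub_le (f := f) (g := g) (M₀ := M₀) (T := T)
    (a := Amax) (b := b) (e := e) (r := e - Amax) U ha0.le ha (by linarith) (by positivity) hlevel
    (fun ℓ => (hdet ℓ).mono (hb' ℓ) fun _ => le_rfl)
    (fun ℓ hℓ => (hrand ℓ hℓ).mono fun c h => h.mono (hb' ℓ) fun _ => le_rfl) hint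
    (MLDLQ.aestronglyMeasurable_topTerm hJ_open hJ_conn hf.continuousOn hg_meas hg_mem U T hM₀)
  obtain ⟨C', -, hpar⟩ := MLDLQ.exists_parameters (r := e - Amax) (e := e) (s := √α / 2) hC
    (by linarith) (by linarith) (by have := Real.sqrt_pos.2 hα.1; positivity)
  refine ⟨M₀ * C', ?_⟩
  filter_upwards [Ioc_mem_nhdsGT (zero_lt_one' ℝ)] with t ht
  obtain ⟨L, k, hL, herr, hwork⟩ := hpar t ht.1 ht.2
  set N : ℕ → ℕ := fun ℓ => if ℓ < L then 2 ^ k ℓ else 1 with hN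
  have hNlt : ∀ ℓ < L, N ℓ = 2 ^ k ℓ := fun ℓ hℓ => if_pos hℓ
  have hNL : N L = 1 := if_neg (lt_irrefl L)
  have hN1 : ∀ ℓ ≤ L, 1 ≤ N ℓ := fun ℓ _ => by
    simp only [hN]; split_ifs
    exacts [Nat.one_le_two_pow, le_rfl]
  obtain ⟨hmeas, hle⟩ := hest L k N hL hNlt hNL
  have hadm := MLDLQ.admissible_of_eLpNorm_le hα ht.1 hL hN1 hmeas
    (hle.trans (ENNReal.ofReal_le_ofReal herr))
  refine (iInf₂_le_of_le L N (iInf_le _ hadm)).trans ?_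
  rw [← ENNReal.ofReal_natCast]
  refine ENNReal.ofReal_le_ofReal ?_
  have hcast : (MLDLQ.work M₀ L N : ℝ) = M₀ * (∑ ℓ ∈ Finset.range L, (2 : ℝ) ^ k ℓ * 2 ^ ℓ + 2 ^ L
      + ∑ ℓ ∈ Finset.range (L + 1), (2 : ℝ) ^ ℓ) := by
    have h1 : ∑ ℓ ∈ Finset.range L, (N ℓ : ℝ) * (M₀ * 2 ^ ℓ) =
        M₀ * ∑ ℓ ∈ Finset.range L, (2 : ℝ) ^ k ℓ * 2 ^ ℓ := by
      rw [Finset.mul_sum]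
      refine Finset.sum_congr rfl fun ℓ hℓ => ?_
      rw [hNlt ℓ (Finset.mem_range.1 hℓ)]; push_cast; ring
    simp only [MLDLQ.work, MLDLQ.innerSize]
    push_cast
    rw [← Finset.mul_sum, Finset.sum_range_succ, h1, hNL]
    push_cast; ring
  rw [hcast, mul_assoc]
  exact mul_le_mul_of_nonneg_left hwork (Nat.cast_nonneg _)
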